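/- Let $d\ge 2$ be an integer and $0<s<d-1$. Let $\sigma_d$ be the normalized surface area measure on the unit sphere $\mathbb S^d\subset\mathbb R^{d+1}$, and $$W_s=\inf_\mu\iint|x-y|^{-s}\,d\mu(x)\,d\mu(y),$$ the infimum being over Borel probability measures $\mu$ on $\mathbb S^d$. Let $\mathbf p=(\mathbf 0,1)$ be the North Pole. For $0\le R<1$ put $\mathbf a=R\,\mathbf p$ and $U(R)=\int|\mathbf a-y|^{-s}\,d\sigma_d(y)$, and for $q<0$ consider the external field $Q(x)=q/|x-\mathbf a|^s$ of a charge $q$ at $\mathbf a$. A signed $s$-equilibrium associated with $Q$ is a finite signed Borel measure $\eta$ on $\mathbb S^d$ with $\eta(\mathbb S^d)=1$ for which $\int|x-y|^{-s}\,d\eta(y)+Q(x)$ is (well defined and) a finite constant for all $x\in\mathbb S^d$. Put $$f(R)=\frac{(1-R)^{d-s}}{(1+R)^d}-U(R),\qquad \mathcal D_q(R)=\frac{W_s}{q}(1+R)^d-(1-R)^{d-s}+(1+R)^dU(R).$$ A critical distance for $q<0$ is an $R\in(0,1)$ with $W_s/q=f(R)$. Then for all $q<0$ and $0\le R<1$ there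 is exactly one signed $s$-equilibrium $\eta_{R,q}$, and it has a unique continuous density $\eta'_{R,q}$ with respect to $\sigma_d$. The solutions of Gonchar's problem for $q$ are the distances $1-R$ to the sphere, $0\le R<1$, for which $\eta'_{R,q}(-\mathbf p)=0$. On $(0,1)$ the function $f$ attains its minimum at exactly one point $R^*$, and $f(R^*)<-W_s$. Put $q^*=W_s/f(R^*)\in(-1,0)$. For $q<0$ and $0\le R<1$ the signed $s$-equilibrium $\eta_{R,q}$ is a positive (that is, non-negative) measure if and only if one of the following conditions holds, and in that case its support is all of $\mathbb S^d$. (i) $q\in(q^*,0)$ and $R\in(0,1)$. There is no critical distance and Gonchar's problem has no solution. (ii) $q=q^*$ and $R\in(0,1)$. The only critical distance is $R^*$ and the only solution of Gonchar's problem is $1-R^*$; moreover $\eta'_{R,q}(-\mathbf p)=0$ at $R=R^*$ and $\eta'_{R,q}(-\mathbf p)>0$ for $R\in(0,R^*)\cup(R^*,1)$. (iii) $q\in(-1,q^*)$ and $R\in(0,R_{q,1}]\cup[R_{q,2},1)$, where $R_{q,1}<R_{q,2}$ are the only two zeros of $\mathcal D_q$ in $(0,1)$. They are the critical distances, Gonchar's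 problem has exactly the two solutions $1-R_{q,1}$ and $1-R_{q,2}$, and for $R\in(0,1)$ the density $\eta'_{R,q}$ is strictly positive on all of $\mathbb S^d$ if and only if $R\in(0,R_{q,1})\cup(R_{q,2},1)$. (iv) $q\le-1$ and $R\in(0,R_q]$, where $R_q$ is the unique zero of $\mathcal D_q$ in $(0,1)$. It is the only critical distance, and $1-R_q$ is the only solution of Gonchar's problem. (v) $R=0$ (trivial solution; here $\eta'_{0,q}>0$ on all of $\mathbb S^d$, so $R=0$ gives no solution of Gonchar's problem). If moreover $s=d-1-2m$ for a non-negative integer $m$, then for every $q<0$ the function $\mathcal D_q$ is a polynomial in $R$ on $[0,1)$. -/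

import Mathlib

open MeasureTheory Set
open scoped ENNReal Polynomial

noncomputable section

namespace Gonchar

/-- The unit sphere `S^d` of `ℝ^(d+1)`. -/
abbrev Sphere (d : ℕ) : Type :=
  Metric.sphere (0 : EuclideanSpace ℝ (Fin (d + 1))) 1

/-- The unit vector on the polar axis, as a point of `ℝ^(d+1)`. -/
def pole (d : ℕ) : EuclideanSpace ℝ (Fin (d + 1)) :=
  EuclideanSpace.single (Fin.last d) (1 : ℝ)

/-- The North Pole `p`, as a point of the sphere. -/
def northPole (d : ℕ) : Sphere d :=
  ⟨pole d, by simp [pole]⟩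

/-- The South Pole `-p`, as a point of the sphere. -/
def southPole (d : ℕ) : Sphere d :=
  -northPole d

/-- The position `a = (0, R)` of the source of the external field. -/
def source (d : ℕ) (R : ℝ) : EuclideanSpace ℝ (Fin (d + 1)) :=
  R • pole d

/-- The normalized surface area measure `σ_d` on `S^d`. -/
def sigma (d : ℕ) : Measure (Sphere d) :=
  ((volume : Measure (EuclideanSpace ℝ (Fin (d + 1)))).toSphere univ)⁻¹ •
    (volume : Measure (EuclideanSpace ℝ (Fin (d + 1)))).toSphere

/-- The Riesz `s`-potential `∫ |x - y|^(-s) dμ(y)` of a positive measure on `S^d`, at any point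
`x` of `ℝ^(d+1)`, with values in `[0, ∞]` (for `s > 0` the kernel is `∞` where `y = x`). -/
def rieszPotential {d : ℕ} (s : ℝ) (μ : Measure (Sphere d))
    (x : EuclideanSpace ℝ (Fin (d + 1))) : ℝ≥0∞ :=
  ∫⁻ y : Sphere d, edist x (y : EuclideanSpace ℝ (Fin (d + 1))) ^ (-s) ∂μ

/-- The Riesz `s`-energy of a positive measure on `S^d`. -/
def rieszEnergy {d : ℕ} (s : ℝ) (μ : Measure (Sphere d)) : ℝ≥0∞ :=
  ∫⁻ x : Sphere d, rieszPotential s μ x ∂μ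

/-- The Riesz `s`-energy `W_s(S^d)` of the sphere: the infimum of the energies of all Borel
probability measures on `S^d`. It is finite for `0 < s < d`. -/
def sphereEnergy (d : ℕ) (s : ℝ) : ℝ :=
  (⨅ μ : ProbabilityMeasure (Sphere d), rieszEnergy s (μ : Measure (Sphere d))).toReal

/-- The potential `U_s^{σ_d}(R)` of `σ_d` at distance `R` from the centre. -/
def sigmaPotential (d : ℕ) (s R : ℝ) : ℝ :=
  (rieszPotential s (sigma d) (source d R)).toReal

/-- The external field `Q(x) = q / |x - a|^s` of a charge `q` at `a = (0, R)`. -/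
def externalField (d : ℕ) (s q R : ℝ) (x : EuclideanSpace ℝ (Fin (d + 1))) : ℝ :=
  q / ‖x - source d R‖ ^ s

/-- `η` is a signed `s`-equilibrium on `S^d` associated with `Q`: its total charge is `1` and its
weighted `s`-potential is (well defined and) a finite constant everywhere on `S^d`. -/
def IsSignedEquilibrium (d : ℕ) (s : ℝ) (Q : EuclideanSpace ℝ (Fin (d + 1)) → ℝ)
    (η : SignedMeasure (Sphere d)) : Prop :=
  η univ = 1 ∧
  ∃ G : ℝ, ∀ x : Sphere d,
    rieszPotential s η.toJordanDecomposition.posPart x ≠ ∞ ∧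
    rieszPotential s η.toJordanDecomposition.negPart x ≠ ∞ ∧
    (rieszPotential s η.toJordanDecomposition.posPart x).toReal -
      (rieszPotential s η.toJordanDecomposition.negPart x).toReal + Q x = G

/-- `g` is the continuous density, with respect to `σ_d`, of a signed `s`-equilibrium on `S^d`
associated with the field of a charge `q` at `(0, R)`. -/
def IsEquilibriumDensity (d : ℕ) (s q R : ℝ) (g : C(Sphere d, ℝ)) : Prop :=
  IsSignedEquilibrium d s (externalField d s q R) ((sigma d).withDensityᵥ g)

/-- `f(R) = |R - 1|^(d-s) / (R + 1)^d - U_s^{σ_d}(R)`. -/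
def charFun (d : ℕ) (s R : ℝ) : ℝ :=
  |R - 1| ^ ((d : ℝ) - s) / (R + 1) ^ d - sigmaPotential d s R

/-- The Gonchar function of the fourth kind. -/
def goncharD (d : ℕ) (s q R : ℝ) : ℝ :=
  sphereEnergy d s / q * (1 + R) ^ d - (1 - R) ^ ((d : ℝ) - s) +
    (1 + R) ^ d * sigmaPotential d s R

/-- The zeros in `(0, 1)` of the Gonchar function of the fourth kind. -/
def goncharDZeros (d : ℕ) (s q : ℝ) : Set ℝ :=
  {R | R ∈ Ioo (0 : ℝ) 1 ∧ goncharD d s q R = 0}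

/-- The critical distances (from the centre) in `(0, 1)` for a negative charge `q`: the solutions
of the characteristic equation `W_s(S^d) / q = f(R)`. -/
def criticalDistances (d : ℕ) (s q : ℝ) : Set ℝ :=
  {R | R ∈ Ioo (0 : ℝ) 1 ∧ sphereEnergy d s / q = charFun d s R}

/-- The solutions of Gonchar's problem for a negative charge `q` inside the sphere: the distances
`1 - R` from the source to the sphere for which the density of the signed equilibrium vanishes
at the South Pole. -/
def goncharSolutions (d : ℕ) (s q : ℝ) : Set ℝ :=
  {δ | ∃ R ∈ Ico (0 : ℝ) 1, δ = 1 - R ∧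
    ∃ g : C(Sphere d, ℝ), IsEquilibriumDensity d s q R g ∧ g (southPole d) = 0}

end Gonchar

end

/-! Write `σ` for `sigma d`, `U` for `sigmaPotential d s`, `f` for `charFun d s`, `W` for the energy
of the sphere. The equilibrium is found in closed form, and the theorem becomes a question about the
graph of `f`.

Reflections show that the potential of `σ` is constant on the sphere. The Riesz kernel is an
integral of products of Gaussians, hence positive definite, so `2 I(μ, σ) ≤ I(μ) + I(σ)`; since the
potential of `σ` is constant, `I(μ, σ) = I(σ)` for every probability measure `μ`, and the constant
is `W = U(1)` (`le_rieszEnergy`, `sphereEnergy_eq`). The Möbius involution of the sphere swapping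
the end points of the chords through `a` has Jacobian the `d`-th power of a conformal factor.
Changing variables by it in the constant potential shows that `b(y) = (1 - R²)^(d-s) |y - a|^(s-2d)`
is the density of a measure of mass `U(R)` with potential `W |x - a|^(-s)` on the sphere
(`lintegral_edist_mul_balayageDensity`, `integral_balayageDensity`). Hence `1 + q U(R) / W - (q / W)
b` is an equilibrium density. For `q < 0` it is least at the South Pole, where `b = f(R) + U(R)` and
its value is `-(q / W) (f(R) - W / q)`. Positivity, vanishing at the South Pole and critical
distances all compare `f(R)` with `W / q`.

For uniqueness, two equilibria give two positive measures of equal mass whose potentials differ by a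
constant on the sphere. Integrating against the densities `b` for all points `a` of the ball gives
the potentials inside the ball; these determine all moments, hence the measures.

Finally `f(0) = 0`, `f(1) = -W`, and `f` falls strictly and then rises strictly
(`exists_charFun_unimodal`). Differentiating the Möbius invariance of `σ` in the parameter of the
involution gives a divergence theorem, hence a radial differential equation for the means of powers
of the distance, which controls the signs and the growth of their slopes. Euler's transformation,
again a Möbius change of variables, writes `f'` as a positive factor times a strictly increasing
function that changes sign. So the minimum of `f` lies below `-W`, and the intermediate value
theorem on the two branches yields the cases. The radial equation also gives the polynomial case, by
induction on `m`. -/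

namespace Gonchar

/-! ### Möbius involutions of the sphere and their norm preserving extensions -/

section Geometry

variable {E : Type*} [NormedAddCommGroup E] [InnerProductSpace ℝ E]

/-- A linear map that scales by `β` on the orthogonal complement of a unit vector `u`, and
isometrically along `u`, has determinant `± β ^ (dim - 1)`. -/
lemma abs_det_of_norm_sq_eq [FiniteDimensional ℝ E] {n : ℕ} (hn : Module.finrank ℝ E = n + 1)
    (L : E →L[ℝ] E) {u : E} (hu : ‖u‖ = 1) {β : ℝ} (hβ : 0 < β)
    (h : ∀ x, ‖L x‖ ^ 2 = (1 - β ^ 2) * inner ℝ u x ^ 2 + β ^ 2 * ‖x‖ ^ 2) :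
    |L.det| = β ^ n := by
  have hpol : ∀ x y, inner ℝ (L x) (L y) =
      (1 - β ^ 2) * (inner ℝ u x * inner ℝ u y) + β ^ 2 * inner ℝ x y := by
    intro x y
    have h1 := h (x + y)
    have h2 := h x
    have h3 := h y
    rw [map_add, norm_add_sq_real, norm_add_sq_real, inner_add_right] at h1
    linear_combination (1 / 2) * (h1 - h2 - h3)
  -- `L* L` is `β²` times a rank one perturbation `x + g(x) u` of the identity, whose determinant is
  -- `1 + g(u)`; this is the square of the determinant of `L`.
  have hadj : (LinearMap.adjoint (L : E →ₗ[ℝ] E)) ∘ₗ (L : E →ₗ[ℝ] E) =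
      (β ^ 2) • LinearMap.transvection
        (((1 - β ^ 2) / β ^ 2) • (innerSL ℝ u : E →L[ℝ] ℝ).toLinearMap) u := by
    ext x
    refine ext_inner_right ℝ fun y => ?_
    rw [LinearMap.comp_apply, LinearMap.adjoint_inner_left]
    simp only [ContinuousLinearMap.coe_coe, LinearMap.smul_apply, LinearMap.transvection.apply,
      inner_smul_left, inner_add_left, hpol, innerSL_apply_apply, smul_eq_mul]
    simp only [conj_trivial]
    field_simp
    ring
  have hsq := LinearMap.normDet_sq (L : E →ₗ[ℝ] E)
  rw [hadj, LinearMap.det_smul, LinearMap.transvection.det, hn, LinearMap.normDet_eq_abs_det] at hsq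
  have huu : inner ℝ u u = (1 : ℝ) := by rw [real_inner_self_eq_norm_sq, hu]; norm_num
  simp only [LinearMap.smul_apply, ContinuousLinearMap.coe_coe, innerSL_apply_apply, huu,
    smul_eq_mul, mul_one] at hsq
  have h4 : |L.det| ^ 2 = (β ^ n) ^ 2 := by
    change (|LinearMap.det (L : E →ₗ[ℝ] E)|) ^ 2 = _
    have : (β ^ n) ^ 2 = (β ^ 2) ^ (n + 1) * (1 + (1 - β ^ 2) / β ^ 2) := by
      field_simp
      ring
    rw [this]
    simpa using hsq
  exact (pow_left_inj₀ (abs_nonneg _) (by positivity) two_ne_zero).1 h4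

/-- The conformal factor of the Möbius involution of the unit sphere that swaps the two end points
of each chord through `a`, extended to be constant on rays. -/
noncomputable def confFactor (a z : E) : ℝ := (1 - ‖a‖ ^ 2) * ‖z‖ ^ 2 / ‖z - ‖z‖ • a‖ ^ 2

/-- The norm preserving homogeneous extension of the Möbius involution of the unit sphere that
swaps the two end points of each chord through `a`. -/
noncomputable def coneMap (a z : E) : E := ‖z‖ • a - confFactor a z • (z - ‖z‖ • a)

variable {a : E}

lemma sub_norm_smul_ne_zero (ha : ‖a‖ < 1) {z : E} (hz : z ≠ 0) : z - ‖z‖ • a ≠ 0 := by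
  intro h
  have h1 : ‖z‖ = ‖z‖ * ‖a‖ := by
    conv_lhs => rw [sub_eq_zero.1 h]
    simp [norm_smul]
  have : 0 < ‖z‖ := norm_pos_iff.2 hz
  nlinarith

lemma confFactor_pos (ha : ‖a‖ < 1) {z : E} (hz : z ≠ 0) : 0 < confFactor a z := by
  have h1 : 0 < ‖z - ‖z‖ • a‖ := norm_pos_iff.2 (sub_norm_smul_ne_zero ha hz)
  have h2 : 0 < ‖z‖ := norm_pos_iff.2 hz
  have h3 : 0 < 1 - ‖a‖ ^ 2 := by nlinarith [norm_nonneg a]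
  unfold confFactor
  positivity

/-- Clearing the denominator in `confFactor` trades `⟪z, a⟫` for norms; this is all that the inner
product identity needs to know about the factor. -/
lemma confFactor_mul_inner (ha : ‖a‖ < 1) {z : E} (hz : z ≠ 0) :
    2 * (confFactor a z * inner ℝ z a) =
      ‖z‖ * (confFactor a z * (1 + ‖a‖ ^ 2) - (1 - ‖a‖ ^ 2)) := by
  have h1 : 0 < ‖z - ‖z‖ • a‖ := norm_pos_iff.2 (sub_norm_smul_ne_zero ha hz)
  have h2 : 0 < ‖z‖ := norm_pos_iff.2 hz
  have h3 : confFactor a z * ‖z - ‖z‖ • a‖ ^ 2 = (1 - ‖a‖ ^ 2) * ‖z‖ ^ 2 := by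
    unfold confFactor
    field_simp
  rw [norm_sub_sq_real, norm_smul, inner_smul_right, Real.norm_of_nonneg h2.le] at h3
  have h4 : ‖z‖ * (2 * (confFactor a z * inner ℝ z a)) =
      ‖z‖ * (‖z‖ * (confFactor a z * (1 + ‖a‖ ^ 2) - (1 - ‖a‖ ^ 2))) := by
    linear_combination -h3
  exact mul_left_cancel₀ h2.ne' h4

/-- The source of the metric properties of the involution: `z = w` gives preservation of norms, and
expanding a squared difference gives the distance law. -/
lemma inner_coneMap (ha : ‖a‖ < 1) {z w : E} (hz : z ≠ 0) (hw : w ≠ 0) :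
    inner ℝ (coneMap a z) (coneMap a w) =
      ‖z‖ * ‖w‖ - confFactor a z * confFactor a w * (‖z‖ * ‖w‖ - inner ℝ z w) := by
  have h1 := confFactor_mul_inner ha hz
  have h2 := confFactor_mul_inner ha hw
  have h3 : inner ℝ a w = inner ℝ w a := real_inner_comm _ _
  simp only [coneMap, inner_sub_left, inner_sub_right, inner_smul_left, inner_smul_right,
    conj_trivial, real_inner_self_eq_norm_sq, h3]
  linear_combination (-‖w‖ * (1 + confFactor a w) / 2) * h1 + (-‖z‖ * (1 + confFactor a z) / 2) * h2

@[simp] lemma coneMap_zero : coneMap a 0 = 0 := by simp [coneMap]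

lemma norm_coneMap (ha : ‖a‖ < 1) (z : E) : ‖coneMap a z‖ = ‖z‖ := by
  rcases eq_or_ne z 0 with rfl | hz
  · simp
  have h := inner_coneMap ha hz hz
  rw [real_inner_self_eq_norm_sq, real_inner_self_eq_norm_sq] at h
  have h' : ‖coneMap a z‖ ^ 2 = ‖z‖ ^ 2 := by rw [h]; ring
  exact (pow_left_inj₀ (norm_nonneg _) (norm_nonneg _) two_ne_zero).1 h'

/-- For points of equal norm the radial term drops out and squared distances scale by the product of
the two conformal factors. -/
lemma norm_coneMap_sub_sq (ha : ‖a‖ < 1) {z w : E} (hz : z ≠ 0) (hw : w ≠ 0) :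
    ‖coneMap a z - coneMap a w‖ ^ 2 =
      (1 - confFactor a z * confFactor a w) * (‖z‖ - ‖w‖) ^ 2 +
        confFactor a z * confFactor a w * ‖z - w‖ ^ 2 := by
  rw [norm_sub_sq_real, norm_sub_sq_real, inner_coneMap ha hz hw, norm_coneMap ha, norm_coneMap ha]
  ring

lemma coneMap_sub (z : E) : coneMap a z - ‖z‖ • a = -(confFactor a z • (z - ‖z‖ • a)) := by
  simp [coneMap]

lemma confFactor_coneMap (ha : ‖a‖ < 1) {z : E} (hz : z ≠ 0) :
    confFactor a (coneMap a z) = (confFactor a z)⁻¹ := by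
  have h1 : 0 < ‖z - ‖z‖ • a‖ := norm_pos_iff.2 (sub_norm_smul_ne_zero ha hz)
  have h2 : 0 < ‖z‖ := norm_pos_iff.2 hz
  have h3 : 0 < 1 - ‖a‖ ^ 2 := by nlinarith [norm_nonneg a]
  have hb := confFactor_pos ha hz
  rw [confFactor, norm_coneMap ha, coneMap_sub, norm_neg, norm_smul, Real.norm_of_nonneg hb.le]
  have h4 : confFactor a z = (1 - ‖a‖ ^ 2) * ‖z‖ ^ 2 / ‖z - ‖z‖ • a‖ ^ 2 := rfl
  rw [h4]
  field_simp

lemma coneMap_coneMap (ha : ‖a‖ < 1) (z : E) : coneMap a (coneMap a z) = z := by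
  rcases eq_or_ne z 0 with rfl | hz
  · simp
  have hb := confFactor_pos ha hz
  conv_lhs => rw [coneMap, norm_coneMap ha, coneMap_sub, confFactor_coneMap ha hz]
  rw [smul_neg, smul_smul, inv_mul_cancel₀ hb.ne']
  simp

lemma confFactor_smul {r : ℝ} (hr : 0 < r) (z : E) : confFactor a (r • z) = confFactor a z := by
  have h : r • z - ‖r • z‖ • a = r • (z - ‖z‖ • a) := by
    rw [norm_smul, Real.norm_of_nonneg hr.le, smul_sub, smul_smul]
  rw [confFactor, h, norm_smul, norm_smul, Real.norm_of_nonneg hr.le, confFactor, mul_pow, mul_pow,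
    mul_left_comm, mul_div_mul_left _ _ (by positivity)]

lemma coneMap_smul {r : ℝ} (hr : 0 < r) (z : E) : coneMap a (r • z) = r • coneMap a z := by
  rw [coneMap, coneMap, confFactor_smul hr, norm_smul, Real.norm_of_nonneg hr.le]
  module

lemma continuousAt_confFactor (ha : ‖a‖ < 1) {z : E} (hz : z ≠ 0) :
    ContinuousAt (confFactor a) z := by
  have h1 : ‖z - ‖z‖ • a‖ ^ 2 ≠ 0 := by
    have := norm_pos_iff.2 (sub_norm_smul_ne_zero ha hz)
    positivity
  unfold confFactor
  exact ContinuousAt.div (by fun_prop) (by fun_prop) h1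

lemma differentiableAt_coneMap (ha : ‖a‖ < 1) {z : E} (hz : z ≠ 0) :
    DifferentiableAt ℝ (coneMap a) z := by
  have h1 := sub_norm_smul_ne_zero ha hz
  have h2 : ‖z - ‖z‖ • a‖ ^ 2 ≠ 0 := by
    have := norm_pos_iff.2 h1
    positivity
  have hn : DifferentiableAt ℝ (fun z : E => ‖z‖) z := (differentiableAt_id).norm ℝ hz
  have hw : DifferentiableAt ℝ (fun z : E => z - ‖z‖ • a) z :=
    differentiableAt_id.sub (hn.smul_const a)
  unfold coneMap confFactor
  have hw2 : DifferentiableAt ℝ (fun z : E => ‖z - ‖z‖ • a‖ ^ 2) z := (hw.norm ℝ h1).pow 2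
  have hn2 : DifferentiableAt ℝ (fun z : E => (1 - ‖a‖ ^ 2) * ‖z‖ ^ 2) z := (hn.pow 2).const_mul _
  have hc : DifferentiableAt ℝ (fun z : E => (1 - ‖a‖ ^ 2) * ‖z‖ ^ 2 / ‖z - ‖z‖ • a‖ ^ 2) z := by
    simp only [div_eq_mul_inv]
    exact hn2.mul (DifferentiableAt.inv hw2 h2)
  exact (hn.smul_const a).sub (hc.smul hw)

/-- Divide the distance law for `z + t x` and `z` by `t²` and let `t → 0`; no formula for the
derivative is needed. The map is isometric radially and scales by `confFactor` in the orthogonal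
directions. -/
lemma norm_fderiv_coneMap_sq (ha : ‖a‖ < 1) {z : E} (hz : z ≠ 0) (x : E) :
    ‖fderiv ℝ (coneMap a) z x‖ ^ 2 =
      (1 - confFactor a z ^ 2) * inner ℝ (‖z‖⁻¹ • z) x ^ 2 + confFactor a z ^ 2 * ‖x‖ ^ 2 := by
  have hline : HasDerivAt (fun t : ℝ => z + t • x) x 0 := by
    simpa using ((hasDerivAt_id (0 : ℝ)).smul_const x).const_add z
  have hF : HasDerivAt (fun t : ℝ => coneMap a (z + t • x)) (fderiv ℝ (coneMap a) z x) 0 := by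
    have h := (differentiableAt_coneMap ha hz).hasFDerivAt
    have h' : HasFDerivAt (coneMap a) (fderiv ℝ (coneMap a) z) (z + (0 : ℝ) • x) := by simpa using h
    exact h'.comp_hasDerivAt (0 : ℝ) hline
  have hN : HasDerivAt (fun t : ℝ => ‖z + t • x‖) (inner ℝ (‖z‖⁻¹ • z) x) 0 := by
    have hsq := hline.norm_sq
    simp only [zero_smul, add_zero] at hsq
    have h2 := hsq.sqrt (by simpa using hz)
    simp only [zero_smul, add_zero, Real.sqrt_sq (norm_nonneg _)] at h2
    refine h2.congr_deriv ?_
    rw [inner_smul_left, conj_trivial]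
    have : ‖z‖ ≠ 0 := norm_ne_zero_iff.2 hz
    field_simp
  have h1 := (hasDerivAt_iff_tendsto_slope_zero.1 hF).norm.pow 2
  have h2 := (hasDerivAt_iff_tendsto_slope_zero.1 hN).pow 2
  have hcont : Filter.Tendsto (fun t : ℝ => confFactor a (z + t • x)) (nhdsWithin 0 {0}ᶜ)
      (nhds (confFactor a z)) := by
    have h : ContinuousAt (confFactor a) (z + (0 : ℝ) • x) := by
      simpa using continuousAt_confFactor ha hz
    have := h.comp (f := fun t : ℝ => z + t • x) (x := (0 : ℝ)) (by fun_prop)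
    simpa [ContinuousAt, Function.comp_def] using this.tendsto.mono_left nhdsWithin_le_nhds
  have hb := hcont.mul_const (confFactor a z)
  have h3 := ((hb.const_sub 1).mul h2).add (hb.mul_const (‖x‖ ^ 2))
  rw [← sq] at h3
  -- Both limits are limits of one and the same squared difference quotient, for small `t ≠ 0`.
  refine tendsto_nhds_unique (h1.congr' ?_) h3
  have hne : ∀ᶠ t : ℝ in nhdsWithin 0 {0}ᶜ, z + t • x ≠ 0 := by
    have : ContinuousAt (fun t : ℝ => z + t • x) 0 := by fun_prop
    exact (this.eventually_ne (by simpa using hz)).filter_mono nhdsWithin_le_nhds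
  filter_upwards [hne, self_mem_nhdsWithin] with t ht ht0
  have ht0' : t ≠ 0 := ht0
  simp only [zero_add, zero_smul, add_zero, norm_smul, mul_pow, smul_eq_mul]
  rw [norm_coneMap_sub_sq ha ht hz, add_sub_cancel_left, norm_smul, mul_pow, Real.norm_eq_abs,
    Real.norm_eq_abs, sq_abs, sq_abs]
  field_simp

lemma abs_det_fderiv_coneMap [FiniteDimensional ℝ E] {n : ℕ} (hn : Module.finrank ℝ E = n + 1)
    (ha : ‖a‖ < 1) {z : E} (hz : z ≠ 0) :
    |(fderiv ℝ (coneMap a) z).det| = confFactor a z ^ n :=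
  abs_det_of_norm_sq_eq hn _
    (by rw [norm_smul, norm_inv, norm_norm, inv_mul_cancel₀ (norm_ne_zero_iff.2 hz)])
    (confFactor_pos ha hz) (norm_fderiv_coneMap_sq ha hz)

end Geometry

/-! ### Change of variables on the sphere through the solid ball -/

section Sphere

variable {E : Type*} [NormedAddCommGroup E] [InnerProductSpace ℝ E] [FiniteDimensional ℝ E]
  [MeasurableSpace E] [BorelSpace E]

/-- Integration in polar coordinates over the punctured unit ball of a function that is constant
on rays. -/
lemma lintegral_cone [Nontrivial E] {H : E → ℝ≥0∞} (hH : Measurable H) :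
    ∫⁻ z in ({0}ᶜ : Set E), (Metric.ball (0 : E) 1).indicator (fun z => H (‖z‖⁻¹ • z)) z =
      (∫⁻ y : Metric.sphere (0 : E) 1, H y ∂(volume : Measure E).toSphere) *
        Measure.volumeIoiPow (Module.finrank ℝ E - 1) (Iio ⟨1, mem_Ioi.2 one_pos⟩) := by
  have hmp := (volume : Measure E).measurePreserving_homeomorphUnitSphereProd
  have hG : Measurable fun p : Metric.sphere (0 : E) 1 × Ioi (0 : ℝ) =>
      H p.1 * (Iio (⟨1, mem_Ioi.2 one_pos⟩ : Ioi (0 : ℝ))).indicator 1 p.2 := by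
    refine (hH.comp (measurable_subtype_coe.comp measurable_fst)).mul ?_
    exact (measurable_one.indicator measurableSet_Iio).comp measurable_snd
  have h1 := hmp.lintegral_comp hG
  rw [lintegral_prod _ hG.aemeasurable] at h1
  have h2 : ∀ y : Metric.sphere (0 : E) 1,
      ∫⁻ r : Ioi (0 : ℝ), H y * (Iio (⟨1, mem_Ioi.2 one_pos⟩ : Ioi (0 : ℝ))).indicator 1 r
        ∂Measure.volumeIoiPow (Module.finrank ℝ E - 1) =
      H y * Measure.volumeIoiPow (Module.finrank ℝ E - 1) (Iio ⟨1, mem_Ioi.2 one_pos⟩) := by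
    intro y
    rw [lintegral_const_mul _ (measurable_one.indicator measurableSet_Iio),
      lintegral_indicator_one measurableSet_Iio]
  simp only [h2] at h1
  rw [lintegral_mul_const (μ := (volume : Measure E).toSphere)
    (f := fun y : Metric.sphere (0 : E) 1 => H y) _ (hH.comp measurable_subtype_coe)] at h1
  rw [← h1, ← lintegral_subtype_comap (measurableSet_singleton (0 : E)).compl]
  refine lintegral_congr fun z => ?_
  have hz : ‖(z : E)‖ ≠ 0 := norm_ne_zero_iff.2 z.2
  by_cases h : ‖(z : E)‖ < 1
  · have h' : (homeomorphUnitSphereProd E z).2 ∈ Iio (⟨1, mem_Ioi.2 one_pos⟩ : Ioi (0 : ℝ)) := by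
      rw [mem_Iio, ← Subtype.coe_lt_coe]
      simpa using h
    rw [indicator_of_mem (by simpa using h), indicator_of_mem h']
    simp
  · have h' : (homeomorphUnitSphereProd E z).2 ∉ Iio (⟨1, mem_Ioi.2 one_pos⟩ : Ioi (0 : ℝ)) := by
      rw [mem_Iio, ← Subtype.coe_lt_coe]
      simpa using h
    rw [indicator_of_notMem (by simpa using h), indicator_of_notMem h']
    simp

/-- Change of variables on the unit sphere under an involution that extends to a norm preserving
homogeneous map. -/
lemma lintegral_toSphere_comp [Nontrivial E] {F : E → E} {J : E → ℝ}
    (hFn : ∀ z, ‖F z‖ = ‖z‖) (hFF : ∀ z, F (F z) = z)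
    (hFs : ∀ r : ℝ, 0 < r → ∀ z, F (r • z) = r • F z)
    (hFd : ∀ z ≠ 0, DifferentiableAt ℝ F z) (hJ : ∀ z ≠ 0, |(fderiv ℝ F z).det| = J z)
    (hJs : ∀ r : ℝ, 0 < r → ∀ z, J (r • z) = J z) (hFm : Measurable F) (hJm : Measurable J)
    {H : E → ℝ≥0∞} (hH : Measurable H) :
    ∫⁻ y : Metric.sphere (0 : E) 1, H y ∂(volume : Measure E).toSphere =
      ∫⁻ y : Metric.sphere (0 : E) 1, ENNReal.ofReal (J y) * H (F y)
        ∂(volume : Measure E).toSphere := by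
  set C := Measure.volumeIoiPow (Module.finrank ℝ E - 1) (Iio (⟨1, mem_Ioi.2 one_pos⟩ : Ioi (0 : ℝ))) with hC
  have hC0 : C ≠ 0 := by
    rw [hC, Measure.volumeIoiPow_apply_Iio]
    simp only [one_pow, ne_eq, ENNReal.ofReal_eq_zero, not_le]
    positivity
  have hCt : C ≠ ∞ := by
    rw [hC, Measure.volumeIoiPow_apply_Iio]
    exact ENNReal.ofReal_ne_top
  have hm : Measurable fun z : E => ENNReal.ofReal (J z) * H (F z) :=
    hJm.ennreal_ofReal.mul (hH.comp hFm)
  -- The radial mass `C` is finite and nonzero, so both sides may be multiplied by it. They become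
  -- integrals over the punctured ball, which `F` maps onto itself because it preserves norms.
  refine (ENNReal.mul_left_inj hC0 hCt).1 ?_
  rw [hC, ← lintegral_cone hH, ← lintegral_cone hm]
  have himg : F '' ({0}ᶜ : Set E) = {0}ᶜ := by
    have hne : ∀ z, z ≠ 0 → F z ≠ 0 := fun z hz => by
      rw [← norm_ne_zero_iff, hFn]
      exact norm_ne_zero_iff.2 hz
    ext z
    constructor
    · rintro ⟨w, hw, rfl⟩
      exact hne w hw
    · exact fun hz => ⟨F z, hne z hz, hFF z⟩
  conv_lhs => rw [← himg]
  rw [lintegral_image_eq_lintegral_abs_det_fderiv_mul volume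
    (measurableSet_singleton (0 : E)).compl
    (fun z hz => (hFd z hz).hasFDerivAt.hasFDerivWithinAt)
    (fun z _ w _ h => by rw [← hFF z, h, hFF w])]
  refine setLIntegral_congr_fun (measurableSet_singleton (0 : E)).compl fun z hz => ?_
  have hz' : 0 < ‖z‖⁻¹ := inv_pos.2 (norm_pos_iff.2 hz)
  by_cases h : ‖z‖ < 1
  · have h2 : ‖F z‖ < 1 := by rwa [hFn]
    rw [indicator_of_mem (by simpa using h2), indicator_of_mem (by simpa using h), hJ z hz,
      hJs _ hz', hFs _ hz', hFn]
  · have h2 : ¬ ‖F z‖ < 1 := by rwa [hFn]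
    rw [indicator_of_notMem (by simpa using h2), indicator_of_notMem (by simpa using h), mul_zero]

end Sphere

end Gonchar

/-! ### Invariance of `σ` under Möbius involutions and reflections -/

namespace Gonchar

variable {d : ℕ}

@[simp] lemma norm_coe_sphere (y : Sphere d) : ‖(y : EuclideanSpace ℝ (Fin (d + 1)))‖ = 1 := by
  simp

lemma coe_sphere_ne_zero (y : Sphere d) : (y : EuclideanSpace ℝ (Fin (d + 1))) ≠ 0 := by
  rw [← norm_ne_zero_iff]
  simp

instance isProbabilityMeasure_sigma (d : ℕ) : IsProbabilityMeasure (sigma d) := by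
  refine ⟨?_⟩
  rw [sigma, Measure.smul_apply, smul_eq_mul]
  refine ENNReal.inv_mul_cancel ?_ (measure_ne_top _ _)
  rw [Ne, Measure.measure_univ_eq_zero]
  exact Measure.toSphere_ne_zero _

instance isOpenPosMeasure_sigma (d : ℕ) : (sigma d).IsOpenPosMeasure := by
  refine ⟨fun U hU hne => ?_⟩
  rw [sigma, Measure.smul_apply, smul_eq_mul]
  exact mul_ne_zero (ENNReal.inv_ne_zero.2 (measure_ne_top _ _)) (hU.measure_ne_zero _ hne)

/-- The extension is isometric along rays, so its Jacobian in dimension `d + 1` is already the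
`d`-th power of the conformal factor. -/
lemma lintegral_sigma_mobius {a : EuclideanSpace ℝ (Fin (d + 1))} (ha : ‖a‖ < 1)
    {H : EuclideanSpace ℝ (Fin (d + 1)) → ℝ≥0∞} (hH : Measurable H) :
    ∫⁻ y, H y ∂sigma d =
      ∫⁻ y : Sphere d, ENNReal.ofReal (confFactor a (y : EuclideanSpace ℝ (Fin (d + 1))) ^ d) *
        H (coneMap a y) ∂sigma d := by
  have hm : Measurable (confFactor a) := by
    unfold confFactor
    fun_prop
  rw [sigma, lintegral_smul_measure, lintegral_smul_measure,
    lintegral_toSphere_comp (F := coneMap a) (J := fun z => confFactor a z ^ d) (norm_coneMap ha)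
      (coneMap_coneMap ha) (fun r hr z => coneMap_smul hr z)
      (fun z hz => differentiableAt_coneMap ha hz)
      (fun z hz => abs_det_fderiv_coneMap (by simp) ha hz)
      (fun r hr z => by rw [confFactor_smul hr]) _ (hm.pow_const d) hH]
  unfold coneMap
  fun_prop

lemma lintegral_sigma_reflection (K : Submodule ℝ (EuclideanSpace ℝ (Fin (d + 1))))
    {H : EuclideanSpace ℝ (Fin (d + 1)) → ℝ≥0∞} (hH : Measurable H) :
    ∫⁻ y, H y ∂sigma d = ∫⁻ y : Sphere d, H (K.reflection y) ∂sigma d := by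
  rw [sigma, lintegral_smul_measure, lintegral_smul_measure,
    lintegral_toSphere_comp (F := K.reflection) (J := fun _ => 1) (fun z => by simp)
      (fun z => by simp) (fun r hr z => by simp)
      (fun z hz => K.reflection.differentiable z)
      (fun z hz => ?_) (fun r hr z => rfl) K.reflection.continuous.measurable measurable_const hH]
  · simp
  · have h1 : fderiv ℝ K.reflection z = (K.reflection : EuclideanSpace ℝ (Fin (d + 1)) →L[ℝ]
        EuclideanSpace ℝ (Fin (d + 1))) :=
      (K.reflection : EuclideanSpace ℝ (Fin (d + 1)) →L[ℝ]
        EuclideanSpace ℝ (Fin (d + 1))).fderiv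
    rw [h1]
    change |LinearMap.det (K.reflection.toLinearIsometry.toLinearMap)| = 1
    rw [← LinearMap.normDet_eq_abs_det, LinearIsometry.normDet_eq_one]

/-- The Möbius involution of the sphere that swaps the two end points of each chord through `a`. -/
noncomputable def mobius {a : EuclideanSpace ℝ (Fin (d + 1))} (ha : ‖a‖ < 1) (y : Sphere d) :
    Sphere d :=
  ⟨coneMap a y, by simp [norm_coneMap ha]⟩

@[simp] lemma coe_mobius {a : EuclideanSpace ℝ (Fin (d + 1))} (ha : ‖a‖ < 1) (y : Sphere d) :
    (mobius ha y : EuclideanSpace ℝ (Fin (d + 1))) = coneMap a y := rfl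

lemma confFactor_coe (a : EuclideanSpace ℝ (Fin (d + 1))) (y : Sphere d) :
    confFactor a (y : EuclideanSpace ℝ (Fin (d + 1))) =
      (1 - ‖a‖ ^ 2) / ‖(y : EuclideanSpace ℝ (Fin (d + 1))) - a‖ ^ 2 := by
  simp [confFactor]

lemma coneMap_coe (a : EuclideanSpace ℝ (Fin (d + 1))) (y : Sphere d) :
    coneMap a (y : EuclideanSpace ℝ (Fin (d + 1))) =
      a - confFactor a (y : EuclideanSpace ℝ (Fin (d + 1))) •
        ((y : EuclideanSpace ℝ (Fin (d + 1))) - a) := by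
  simp [coneMap]

lemma norm_coe_sub_pos {a : EuclideanSpace ℝ (Fin (d + 1))} (ha : ‖a‖ < 1) (y : Sphere d) :
    0 < ‖(y : EuclideanSpace ℝ (Fin (d + 1))) - a‖ := by
  have := sub_norm_smul_ne_zero ha (coe_sphere_ne_zero y)
  simpa using norm_pos_iff.2 this

lemma norm_mobius_sub_mobius {a : EuclideanSpace ℝ (Fin (d + 1))} (ha : ‖a‖ < 1)
    (x y : Sphere d) :
    ‖coneMap a (x : EuclideanSpace ℝ (Fin (d + 1))) - coneMap a y‖ =
      (1 - ‖a‖ ^ 2) * ‖(x : EuclideanSpace ℝ (Fin (d + 1))) - y‖ /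
        (‖(x : EuclideanSpace ℝ (Fin (d + 1))) - a‖ *
          ‖(y : EuclideanSpace ℝ (Fin (d + 1))) - a‖) := by
  have hx := norm_coe_sub_pos ha x
  have hy := norm_coe_sub_pos ha y
  have h3 : 0 < 1 - ‖a‖ ^ 2 := by nlinarith [norm_nonneg a]
  have h := norm_coneMap_sub_sq ha (coe_sphere_ne_zero x) (coe_sphere_ne_zero y)
  rw [norm_coe_sphere, norm_coe_sphere, confFactor_coe, confFactor_coe] at h
  refine (pow_left_inj₀ (norm_nonneg _) (by positivity) two_ne_zero).1 ?_
  rw [h]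
  field_simp
  ring

lemma measurable_mobius {a : EuclideanSpace ℝ (Fin (d + 1))} (ha : ‖a‖ < 1) :
    Measurable (mobius (d := d) ha) := by
  refine Measurable.subtype_mk ?_
  have : Measurable (coneMap a) := by
    unfold coneMap confFactor
    fun_prop
  exact this.comp measurable_subtype_coe

lemma measurable_confFactor_coe (a : EuclideanSpace ℝ (Fin (d + 1))) :
    Measurable fun y : Sphere d => confFactor a (y : EuclideanSpace ℝ (Fin (d + 1))) := by
  unfold confFactor
  fun_prop

/-- Stated for measures so that integrands of either sign can be transported as well. -/
lemma map_mobius_sigma {a : EuclideanSpace ℝ (Fin (d + 1))} (ha : ‖a‖ < 1) :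
    ((sigma d).withDensity fun y => ENNReal.ofReal
      (confFactor a (y : EuclideanSpace ℝ (Fin (d + 1))) ^ d)).map (mobius ha) = sigma d := by
  have hemb : MeasurableEmbedding ((↑) : Sphere d → EuclideanSpace ℝ (Fin (d + 1))) :=
    MeasurableEmbedding.subtype_coe Metric.isClosed_sphere.measurableSet
  have hc := ((measurable_confFactor_coe a).pow_const d).ennreal_ofReal
  ext s hs
  have hs' : MeasurableSet (Subtype.val '' s) := hemb.measurableSet_image.2 hs
  have h := lintegral_sigma_mobius ha (H := (Subtype.val '' s).indicator 1)
    (measurable_one.indicator hs')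
  have h1 : ∀ y : Sphere d, (Subtype.val '' s).indicator (1 : EuclideanSpace ℝ (Fin (d + 1)) → ℝ≥0∞)
      (y : EuclideanSpace ℝ (Fin (d + 1))) = s.indicator 1 y := by
    intro y
    by_cases hy : y ∈ s
    · rw [indicator_of_mem hy, indicator_of_mem (mem_image_of_mem _ hy)]; rfl
    · rw [indicator_of_notMem hy, indicator_of_notMem]
      rintro ⟨z, hz, hzy⟩
      exact hy (Subtype.ext hzy ▸ hz)
  simp only [← coe_mobius ha, h1] at h
  rw [lintegral_indicator_one hs] at h
  rw [h, Measure.map_apply (measurable_mobius ha) hs,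
    ← lintegral_indicator_one (measurable_mobius ha hs),
    lintegral_withDensity_eq_lintegral_mul _ hc
      (measurable_one.indicator (measurable_mobius ha hs))]
  rfl

lemma integral_sigma_mobius {a : EuclideanSpace ℝ (Fin (d + 1))} (ha : ‖a‖ < 1)
    {h : Sphere d → ℝ} (hh : Measurable h) :
    ∫ y, h y ∂sigma d =
      ∫ y : Sphere d, confFactor a (y : EuclideanSpace ℝ (Fin (d + 1))) ^ d * h (mobius ha y)
        ∂sigma d := by
  conv_lhs => rw [← map_mobius_sigma ha]
  rw [integral_map (measurable_mobius ha).aemeasurable hh.aestronglyMeasurable,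
    integral_withDensity_eq_integral_toReal_smul
      ((measurable_confFactor_coe a).pow_const d).ennreal_ofReal
      (Filter.Eventually.of_forall fun _ => ENNReal.ofReal_lt_top)]
  refine integral_congr_ae (Filter.Eventually.of_forall fun y => ?_)
  have hc := confFactor_pos ha (coe_sphere_ne_zero y)
  simp only [smul_eq_mul]
  rw [ENNReal.toReal_ofReal (by positivity)]

/-- The height of a point of the sphere over the equatorial plane. -/
noncomputable def height (y : Sphere d) : ℝ := inner ℝ (pole d) (y : EuclideanSpace ℝ (Fin (d + 1)))

@[simp] lemma norm_pole : ‖pole d‖ = 1 := by simp [pole]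

lemma continuous_height : Continuous (height (d := d)) := by
  unfold height
  fun_prop

lemma abs_height_le (y : Sphere d) : |height y| ≤ 1 := by
  have := abs_real_inner_le_norm (pole d) (y : EuclideanSpace ℝ (Fin (d + 1)))
  simpa [height] using this

lemma height_mem_Icc (y : Sphere d) : height y ∈ Icc (-1 : ℝ) 1 := abs_le.1 (abs_height_le y)

lemma norm_source (R : ℝ) : ‖source d R‖ = |R| := by simp [source, norm_smul]

lemma norm_sub_source_sq (R : ℝ) (y : Sphere d) :
    ‖(y : EuclideanSpace ℝ (Fin (d + 1))) - source d R‖ ^ 2 = 1 + R ^ 2 - 2 * R * height y := by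
  rw [norm_sub_sq_real, norm_source, norm_coe_sphere, sq_abs, source, inner_smul_right, height,
    real_inner_comm]
  ring

lemma height_southPole : height (southPole d) = -1 := by
  have : ((southPole d : Sphere d) : EuclideanSpace ℝ (Fin (d + 1))) = -pole d := rfl
  rw [height, this, inner_neg_right, real_inner_self_eq_norm_sq]
  simp

lemma height_eq_neg_one_iff {y : Sphere d} : height y = -1 ↔ y = southPole d := by
  refine ⟨fun h => ?_, fun h => h ▸ height_southPole⟩
  have h1 := norm_sub_source_sq (-1) y
  rw [h] at h1
  norm_num at h1
  rw [sub_eq_zero] at h1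
  refine Subtype.ext ?_
  rw [h1]
  simp [source, southPole, northPole]

/-- The square of the distance from the source at `R` to the points at height `u`. -/
def distSq (R u : ℝ) : ℝ := 1 + R ^ 2 - 2 * R * u

lemma distSq_pos {R u : ℝ} (hR : |R| < 1) (hu : u ∈ Icc (-1 : ℝ) 1) : 0 < distSq R u := by
  unfold distSq
  obtain ⟨h1, h2⟩ := abs_lt.1 hR
  nlinarith [hu.1, hu.2, mul_nonneg (sub_nonneg.2 hu.2) (by linarith : 0 ≤ 1 + R),
    mul_nonneg (by linarith [hu.1] : 0 ≤ 1 + u) (by linarith : 0 ≤ 1 - R),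
    pow_pos (by linarith : 0 < 1 - R) 2, pow_pos (by linarith : 0 < 1 + R) 2]

lemma confFactor_source {R : ℝ} (y : Sphere d) :
    confFactor (source d R) (y : EuclideanSpace ℝ (Fin (d + 1))) =
      (1 - R ^ 2) / distSq R (height y) := by
  rw [confFactor_coe, norm_sub_source_sq, norm_source, sq_abs, distSq]

lemma height_mobius {R : ℝ} (hR : ‖source d R‖ < 1) (y : Sphere d) :
    height (mobius hR y) = R - (1 - R ^ 2) / distSq R (height y) * (height y - R) := by
  rw [height, coe_mobius, coneMap_coe, confFactor_source, inner_sub_right, inner_smul_right,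
    inner_sub_right, source, inner_smul_right, real_inner_self_eq_norm_sq]
  simp [height]

end Gonchar

/-! ### Differentiation under the integral and the radial differential equation -/

namespace Gonchar

section Parametric

variable {X : Type*} [MeasurableSpace X] {μ : Measure X} {u : X → ℝ}

lemma measurable_comp_of_continuousOn (hu : Measurable u) {s : Set ℝ} (hs : ∀ x, u x ∈ s)
    {f : ℝ → ℝ} (hf : ContinuousOn f s) : Measurable fun x => f (u x) :=
  hf.domRestrict.measurable.comp (hu.subtype_mk (h := hs))

lemma integrable_comp_of_continuousOn [IsFiniteMeasure μ] (hu : Measurable u) {s : Set ℝ}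
    (hsc : IsCompact s) (hs : ∀ x, u x ∈ s) {f : ℝ → ℝ} (hf : ContinuousOn f s) :
    Integrable (fun x => f (u x)) μ := by
  obtain ⟨C, hC⟩ := hsc.exists_bound_of_continuousOn hf
  exact Integrable.of_bound (measurable_comp_of_continuousOn hu hs hf).aestronglyMeasurable C
    (Filter.Eventually.of_forall fun x => hC _ (hs x))

/-- Differentiation under the integral sign for continuously differentiable integrands that
depend on the point through a function with values in a compact set. -/
lemma hasDerivAt_integral_of_contDiffAt [IsFiniteMeasure μ] (hu : Measurable u) {s : Set ℝ}
    (hsc : IsCompact s) (hs : ∀ x, u x ∈ s) {Φ : ℝ → ℝ → ℝ} {Φ' : ℝ → ℝ} {r : ℝ}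
    (hΦ : ∀ v ∈ s, ContDiffAt ℝ 1 (Function.uncurry Φ) (r, v))
    (hΦ' : ∀ v ∈ s, HasDerivAt (fun R => Φ R v) (Φ' v) r) :
    HasDerivAt (fun R => ∫ x, Φ R (u x) ∂μ) (∫ x, Φ' (u x) ∂μ) r := by
  set O : Set (ℝ × ℝ) := {p | ContDiffAt ℝ 1 (Function.uncurry Φ) p} with hO
  have hOo : IsOpen O := isOpen_iff_mem_nhds.2 fun p hp =>
    ContDiffAt.eventually (n := 1) hp (by simp)
  have hcd : ContDiffOn ℝ 1 (Function.uncurry Φ) O := fun p hp => ContDiffAt.contDiffWithinAt hp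
  -- The tube lemma gives one neighbourhood of `r` that serves all `v` in the compact set; there the
  -- partial derivative is bounded, and the bound is the dominating constant.
  obtain ⟨U, V, hU, -, hrU, hsV, hUV⟩ := generalized_tube_lemma (isCompact_singleton (x := r)) hsc
    hOo (by rintro ⟨R, v⟩ ⟨hR, hv⟩; obtain rfl : R = r := hR; exact hΦ v hv)
  obtain ⟨ε, hε, hεU⟩ := Metric.nhds_basis_closedBall.mem_iff.1 (hU.mem_nhds (hrU rfl))
  have hsub : Metric.closedBall r ε ×ˢ s ⊆ O := (prod_mono hεU hsV).trans hUV
  have hsec : ∀ {R v}, (R, v) ∈ O →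
      HasDerivAt (fun R => Φ R v) (fderiv ℝ (Function.uncurry Φ) (R, v) (1, 0)) R := by
    intro R v h
    have h1 := (ContDiffAt.differentiableAt (n := 1) (f := Function.uncurry Φ) h
      one_ne_zero).hasFDerivAt
    exact h1.comp_hasDerivAt R ((hasDerivAt_id R).prodMk (hasDerivAt_const R v))
  have hDc : ContinuousOn (fun p => fderiv ℝ (Function.uncurry Φ) p (1, 0)) O :=
    (hcd.continuousOn_fderiv_of_isOpen hOo le_rfl).clm_apply continuousOn_const
  obtain ⟨C, hC⟩ := ((isCompact_closedBall r ε).prod hsc).exists_bound_of_continuousOn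
    (hDc.mono hsub)
  have hslice : ∀ R ∈ Metric.closedBall r ε, ContinuousOn (Φ R) s := fun R hR =>
    (hcd.continuousOn.mono hsub).comp (f := fun v => (R, v)) (by fun_prop) fun v hv => ⟨hR, hv⟩
  have hslice' : ∀ R ∈ Metric.closedBall r ε,
      ContinuousOn (fun v => fderiv ℝ (Function.uncurry Φ) (R, v) (1, 0)) s := fun R hR =>
    (hDc.mono hsub).comp (f := fun v => (R, v)) (by fun_prop) fun v hv => ⟨hR, hv⟩
  have hr := Metric.mem_closedBall_self (x := r) hε.le
  have key := (hasDerivAt_integral_of_dominated_loc_of_deriv_le (μ := μ)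
    (F := fun R x => Φ R (u x))
    (F' := fun R x => fderiv ℝ (Function.uncurry Φ) (R, u x) (1, 0)) (bound := fun _ => C)
    (Metric.ball_mem_nhds r hε)
    (by
      filter_upwards [Metric.ball_mem_nhds r hε] with R hR
      exact (measurable_comp_of_continuousOn hu hs
        (hslice R (Metric.ball_subset_closedBall hR))).aestronglyMeasurable)
    (integrable_comp_of_continuousOn hu hsc hs (hslice r hr))
    (measurable_comp_of_continuousOn hu hs (hslice' r hr)).aestronglyMeasurable
    (Filter.Eventually.of_forall fun x R hR =>
      hC (R, u x) ⟨Metric.ball_subset_closedBall hR, hs x⟩)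
    (integrable_const C)
    (Filter.Eventually.of_forall fun x R hR =>
      hsec (hsub ⟨Metric.ball_subset_closedBall hR, hs x⟩))).2
  refine key.congr_deriv (integral_congr_ae (Filter.Eventually.of_forall fun x => ?_))
  exact (hsec (hsub ⟨hr, hs x⟩)).unique (hΦ' _ (hs x))

end Parametric

variable {d : ℕ}

lemma continuousOn_distSq_rpow {R : ℝ} (hR : |R| < 1) (k : ℝ) :
    ContinuousOn (fun u => distSq R u ^ k) (Icc (-1) 1) := by
  have : Continuous (distSq R) := by unfold distSq; fun_prop
  exact this.continuousOn.rpow_const fun u hu => Or.inl (distSq_pos hR hu).ne'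

lemma integrable_height {f : ℝ → ℝ} (hf : ContinuousOn f (Icc (-1) 1)) :
    Integrable (fun y => f (height y)) (sigma d) :=
  integrable_comp_of_continuousOn continuous_height.measurable isCompact_Icc height_mem_Icc hf

/-- The mean over the sphere of the power `-2k` of the distance to the source at `R`. -/
noncomputable def powMean (d : ℕ) (k R : ℝ) : ℝ := ∫ y, distSq R (height y) ^ (-k) ∂sigma d

/-- Up to the factor `2k`, the derivative of `powMean` in `R`. -/
noncomputable def powSlope (d : ℕ) (k R : ℝ) : ℝ :=
  ∫ y, (height y - R) * distSq R (height y) ^ (-k - 1) ∂sigma d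

lemma hasDerivAt_distSq_rpow {R u : ℝ} (h : 0 < distSq R u) (k : ℝ) :
    HasDerivAt (fun R => distSq R u ^ (-k)) (2 * k * ((u - R) * distSq R u ^ (-k - 1))) R := by
  have h1 : HasDerivAt (fun R => distSq R u) (2 * R - 2 * u) R := by
    unfold distSq
    have := (((hasDerivAt_id R).pow 2).const_add 1).sub (((hasDerivAt_id R).const_mul 2).mul_const u)
    refine this.congr_deriv ?_
    simp
  refine (h1.rpow_const (Or.inl h.ne')).congr_deriv ?_
  ring

lemma contDiffAt_distSq_rpow {R u : ℝ} (h : 0 < distSq R u) (k : ℝ) :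
    ContDiffAt ℝ 1 (fun p : ℝ × ℝ => distSq p.1 p.2 ^ k) (R, u) := by
  have h1 : ContDiffAt ℝ 1 (fun p : ℝ × ℝ => distSq p.1 p.2) (R, u) := by
    unfold distSq
    fun_prop
  exact h1.rpow_const_of_ne h.ne'

lemma hasDerivAt_powMean (k : ℝ) {R : ℝ} (hR : |R| < 1) :
    HasDerivAt (powMean d k) (2 * k * powSlope d k R) R := by
  have h := hasDerivAt_integral_of_contDiffAt (μ := sigma d) continuous_height.measurable
    isCompact_Icc height_mem_Icc (Φ := fun R u => distSq R u ^ (-k)) (r := R)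
    (fun v hv => contDiffAt_distSq_rpow (distSq_pos hR hv) _)
    (fun v hv => hasDerivAt_distSq_rpow (distSq_pos hR hv) k)
  rw [integral_const_mul] at h
  exact h

lemma hasDerivAt_powSlope (k : ℝ) {R : ℝ} (hR : |R| < 1) :
    HasDerivAt (powSlope d k) (∫ y, (2 * (k + 1) * ((height y - R) ^ 2 *
      distSq R (height y) ^ (-k - 2)) - distSq R (height y) ^ (-k - 1)) ∂sigma d) R := by
  refine hasDerivAt_integral_of_contDiffAt (μ := sigma d) continuous_height.measurable
    isCompact_Icc height_mem_Icc (Φ := fun R u => (u - R) * distSq R u ^ (-k - 1)) (r := R)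
    (Φ' := fun u => 2 * (k + 1) * ((u - R) ^ 2 * distSq R u ^ (-k - 2)) - distSq R u ^ (-k - 1))
    (fun v hv => ?_) (fun v hv => ?_)
  · exact ContDiffAt.mul (f := fun p : ℝ × ℝ => p.2 - p.1) (by fun_prop)
      (contDiffAt_distSq_rpow (distSq_pos hR hv) _)
  · have h1 := hasDerivAt_distSq_rpow (distSq_pos hR hv) (k + 1)
    have h2 := ((hasDerivAt_id R).const_sub v).mul h1
    have e1 : -(k + 1) = -k - 1 := by ring
    have e2 : -k - 1 - 1 = -k - 2 := by ring
    rw [e1, e2] at h2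
    refine h2.congr_deriv ?_
    simp only [id]
    ring

/-- The divergence theorem on the sphere for a zonal field, from the invariance of `sigma` under
Möbius maps close to the identity. -/
lemma integral_height_mul_distSq (k : ℝ) {r : ℝ} (hr : |r| < 1) :
    d * ∫ y, height y * distSq r (height y) ^ (-k) ∂sigma d =
      2 * r * k * ∫ y, (1 - height y ^ 2) * distSq r (height y) ^ (-k - 1) ∂sigma d := by
  -- `Φ R` is the pullback of `distSq (-r) ^ (-k)` by the involution with source at `R`, times its
  -- Jacobian. At `R = 0` that involution is the antipodal map, hence `-r`: `distSq (-r) (-v) =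
  -- distSq r v`.
  set Φ : ℝ → ℝ → ℝ := fun R u => ((1 - R ^ 2) / distSq R u) ^ d *
    distSq (-r) (R - (1 - R ^ 2) / distSq R u * (u - R)) ^ (-k) with hΦ
  have hmem : ∀ v ∈ Icc (-1 : ℝ) 1, -v ∈ Icc (-1 : ℝ) 1 := fun v hv =>
    ⟨by linarith [hv.2], by linarith [hv.1]⟩
  have hr' : |-r| < 1 := by rwa [abs_neg]
  have h0 : ∀ v, distSq 0 v = 1 := fun v => by simp [distSq]
  have hD0 : ∀ v : ℝ, HasDerivAt (fun R => distSq R v) (-2 * v) 0 := by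
    intro v
    unfold distSq
    have := (((hasDerivAt_id (0 : ℝ)).pow 2).const_add 1).sub
      (((hasDerivAt_id (0 : ℝ)).const_mul 2).mul_const v)
    refine this.congr_deriv ?_
    simp
  have hneg : ∀ v, distSq (-r) (-v) = distSq r v := fun v => by simp [distSq]
  have hderiv := hasDerivAt_integral_of_contDiffAt (μ := sigma d) continuous_height.measurable
    isCompact_Icc height_mem_Icc (Φ := Φ) (r := 0)
    (Φ' := fun u => 2 * d * (u * distSq r u ^ (-k)) -
      2 * (2 * r * k) * ((1 - u ^ 2) * distSq r u ^ (-k - 1))) (fun v hv => ?_) (fun v hv => ?_)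
  -- By invariance the integral does not depend on `R`, so its derivative at `0` vanishes; that is
  -- the claim.
  · have hconst : (fun R => ∫ y, Φ R (height y) ∂sigma d) =ᶠ[nhds 0]
        fun _ => ∫ y, distSq (-r) (height y) ^ (-k) ∂sigma d := by
      filter_upwards [Metric.ball_mem_nhds (0 : ℝ) one_pos] with R hR
      have hR' : ‖source d R‖ < 1 := by
        rw [norm_source]
        simpa using hR
      rw [integral_sigma_mobius hR' (measurable_comp_of_continuousOn continuous_height.measurable
        height_mem_Icc (continuousOn_distSq_rpow hr' (-k)))]
      simp only [height_mobius hR', confFactor_source, hΦ]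
    have h := hderiv.unique ((hasDerivAt_const _ _).congr_of_eventuallyEq hconst)
    rw [integral_sub, integral_const_mul, integral_const_mul] at h
    · linarith
    · exact (integrable_height (f := fun u => u * distSq r u ^ (-k))
        (continuousOn_id.mul (continuousOn_distSq_rpow hr _))).const_mul _
    · exact (integrable_height (f := fun u => (1 - u ^ 2) * distSq r u ^ (-k - 1))
        ((by fun_prop : Continuous fun u : ℝ => 1 - u ^ 2).continuousOn.mul
          (continuousOn_distSq_rpow hr _))).const_mul _
  · have h1 : ContDiffAt ℝ 1 (fun p : ℝ × ℝ => (1 - p.1 ^ 2) / distSq p.1 p.2) (0, v) := by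
      refine ContDiffAt.div (by fun_prop) ?_ (by simp [h0])
      unfold distSq
      fun_prop
    have h2 : ContDiffAt ℝ 1 (fun p : ℝ × ℝ =>
        distSq (-r) (p.1 - (1 - p.1 ^ 2) / distSq p.1 p.2 * (p.2 - p.1))) (0, v) := by
      have h3 : ContDiffAt ℝ 1 (fun p : ℝ × ℝ =>
          p.1 - (1 - p.1 ^ 2) / distSq p.1 p.2 * (p.2 - p.1)) (0, v) :=
        contDiffAt_fst.sub (h1.mul (by fun_prop))
      exact contDiffAt_const.sub (contDiffAt_const.mul h3)
    refine (h1.pow d).mul (h2.rpow_const_of_ne ?_)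
    simp only [h0]
    norm_num
    rw [hneg]
    exact (distSq_pos hr hv).ne'
  · have h1 : HasDerivAt (fun R : ℝ => (1 - R ^ 2) / distSq R v) (2 * v) 0 := by
      have := (((hasDerivAt_id (0 : ℝ)).pow 2).const_sub 1).div (hD0 v) (by simp [h0])
      refine this.congr_deriv ?_
      simp [h0]
    have h2 : HasDerivAt (fun R : ℝ => R - (1 - R ^ 2) / distSq R v * (v - R))
        (2 * (1 - v ^ 2)) 0 := by
      have := (hasDerivAt_id (0 : ℝ)).sub (h1.mul ((hasDerivAt_id (0 : ℝ)).const_sub v))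
      refine this.congr_deriv ?_
      simp [h0]
      ring
    have h3 : HasDerivAt (fun R : ℝ => distSq (-r) (R - (1 - R ^ 2) / distSq R v * (v - R)))
        (2 * r * (2 * (1 - v ^ 2))) 0 := by
      unfold distSq at h2 ⊢
      refine ((h2.const_mul (2 * -r)).const_sub (1 + (-r) ^ 2)).congr_deriv ?_
      ring
    have e : distSq (-r) (0 - (1 - 0 ^ 2) / distSq 0 v * (v - 0)) = distSq r v := by
      rw [h0, ← hneg]
      norm_num
    have h4 := h3.rpow_const (p := -k) (Or.inl (by rw [e]; exact (distSq_pos hr hv).ne'))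
    rw [e] at h4
    have h5 := (h1.pow d).mul h4
    rw [Pi.pow_apply, e, h0] at h5
    refine h5.congr_deriv ?_
    norm_num
    ring

lemma integrable_distSq_rpow {R : ℝ} (hR : |R| < 1) (k : ℝ) :
    Integrable (fun y => distSq R (height y) ^ k) (sigma d) :=
  integrable_height (continuousOn_distSq_rpow hR k)

/-- The radial differential equation of the Riesz potentials of the sphere. -/
lemma hasDerivAt_powSlope' (k : ℝ) {R : ℝ} (hR : |R| < 1) :
    ∃ N', HasDerivAt (powSlope d k) N' R ∧
      R * N' + d * powSlope d k R = (2 * k + 1 - d) * (R * powMean d (k + 1) R) := by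
  refine ⟨_, hasDerivAt_powSlope k hR, ?_⟩
  have hS := integral_height_mul_distSq (d := d) (k + 1) hR
  have e1 : -(k + 1) = -k - 1 := by ring
  have e2 : -k - 1 - 1 = -k - 2 := by ring
  rw [e1, e2] at hS
  have i1 := integrable_distSq_rpow (d := d) hR (-k - 1)
  have i2 : Integrable (fun y => height y * distSq R (height y) ^ (-k - 1)) (sigma d) :=
    integrable_height (f := fun u => u * distSq R u ^ (-k - 1))
        (continuousOn_id.mul (continuousOn_distSq_rpow hR _))
  have i3 : Integrable (fun y => (1 - height y ^ 2) * distSq R (height y) ^ (-k - 2)) (sigma d) :=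
    integrable_height (f := fun u => (1 - u ^ 2) * distSq R u ^ (-k - 2))
        ((by fun_prop : Continuous fun u : ℝ => 1 - u ^ 2).continuousOn.mul
          (continuousOn_distSq_rpow hR _))
  have i4 : Integrable (fun y => (height y - R) ^ 2 * distSq R (height y) ^ (-k - 2)) (sigma d) :=
    integrable_height (f := fun u => (u - R) ^ 2 * distSq R u ^ (-k - 2))
        ((by fun_prop : Continuous fun u : ℝ => (u - R) ^ 2).continuousOn.mul
          (continuousOn_distSq_rpow hR _))
  have hN : powSlope d k R = ∫ y, height y * distSq R (height y) ^ (-k - 1) ∂sigma d -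
      R * ∫ y, distSq R (height y) ^ (-k - 1) ∂sigma d := by
    rw [powSlope, ← integral_const_mul, ← integral_sub i2 (i1.const_mul R)]
    simp only [sub_mul]
  -- Rests on `(1 - u²) + (u - R)² = distSq R u`, which absorbs one power of the distance. The
  -- divergence theorem evaluates the first integral; the second occurs in the derivative of
  -- `powSlope`.
  have hM : powMean d (k + 1) R =
      ∫ y, (1 - height y ^ 2) * distSq R (height y) ^ (-k - 2) ∂sigma d +
        ∫ y, (height y - R) ^ 2 * distSq R (height y) ^ (-k - 2) ∂sigma d := by
    rw [← integral_add i3 i4, powMean]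
    refine integral_congr_ae (Filter.Eventually.of_forall fun y => ?_)
    have hp := distSq_pos hR (height_mem_Icc y)
    have e3 : -(k + 1) = 1 + (-k - 2) := by ring
    simp only
    rw [e3, Real.rpow_add hp, Real.rpow_one, ← add_mul]
    congr 1
    unfold distSq
    ring
  have hM1 : powMean d (k + 1) R = ∫ y, distSq R (height y) ^ (-k - 1) ∂sigma d := by
    rw [powMean, e1]
  rw [integral_sub (i4.const_mul _) i1, integral_const_mul, hN]
  rw [← hM1]
  rw [← hM1] at hN
  linear_combination hS - 2 * R * (k + 1) * hM

end Gonchar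

/-! ### Consequences of the radial equation: symmetries, signs, monotonicity, polynomials -/

namespace Gonchar

variable {d : ℕ}

lemma powMean_zero_right (k : ℝ) : powMean d k 0 = 1 := by simp [powMean, distSq]

/-- At `r = 0` the divergence theorem says that the mean height is zero. -/
lemma powSlope_zero_right (hd : d ≠ 0) (k : ℝ) : powSlope d k 0 = 0 := by
  have h := integral_height_mul_distSq (d := d) (k + 1) (r := 0) (by simp)
  have hd' : (d : ℝ) ≠ 0 := Nat.cast_ne_zero.2 hd
  simp only [mul_zero, zero_mul, mul_eq_zero, hd', false_or] at h
  rw [neg_add'] at h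
  simpa [powSlope] using h

lemma powMean_pos (k : ℝ) {R : ℝ} (hR : |R| < 1) : 0 < powMean d k R := by
  have hp : ∀ y : Sphere d, 0 < distSq R (height y) ^ (-k) := fun y =>
    Real.rpow_pos_of_pos (distSq_pos hR (height_mem_Icc y)) _
  rw [powMean, integral_pos_iff_support_of_nonneg (fun y => (hp y).le)
    (integrable_distSq_rpow hR _)]
  have : Function.support (fun y : Sphere d => distSq R (height y) ^ (-k)) = univ :=
    eq_univ_of_forall fun y => (hp y).ne'
  rw [this]
  simp

/-- The product of the two segments of a chord through the source is the power `1 - R²` of that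
point. -/
lemma distSq_height_mobius {R : ℝ} (hR : |R| < 1) (hs : ‖source d R‖ < 1) (y : Sphere d) :
    distSq R (height (mobius hs y)) = (1 - R ^ 2) ^ 2 / distSq R (height y) := by
  have h := distSq_pos hR (height_mem_Icc y)
  rw [height_mobius hs]
  have h2 : distSq R (R - (1 - R ^ 2) / distSq R (height y) * (height y - R)) =
    (1 - R ^ 2) * (distSq R (height y) + 2 * R * (height y - R)) / distSq R (height y) := by
    rw [distSq]
    field_simp
    ring
  rw [h2]
  congr 1
  unfold distSq
  ring

lemma one_sub_sq_pos {R : ℝ} (hR : |R| < 1) : 0 < 1 - R ^ 2 := by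
  obtain ⟨h1, h2⟩ := abs_lt.1 hR
  nlinarith

lemma rpow_mobius_aux {A D : ℝ} (hA : 0 < A) (hD : 0 < D) (k : ℝ) :
    (A / D) ^ d * (A ^ 2 / D) ^ (-k) = A ^ (d - 2 * k) * D ^ (k - d) := by
  rw [← Real.rpow_natCast, Real.div_rpow hA.le hD.le, Real.div_rpow (by positivity) hD.le,
    ← Real.rpow_natCast A 2, ← Real.rpow_mul hA.le, div_mul_div_comm, ← Real.rpow_add hA,
    ← Real.rpow_add hD, div_eq_mul_inv, ← Real.rpow_neg hD.le]
  congr 2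
  · push_cast
    ring
  · ring

/-- Euler's transformation of the potential, as a change of variables. -/
lemma powMean_eq_mobius (k : ℝ) {R : ℝ} (hR : |R| < 1) :
    powMean d k R = (1 - R ^ 2) ^ (d - 2 * k) * powMean d (d - k) R := by
  have hs : ‖source d R‖ < 1 := by rwa [norm_source]
  rw [powMean, integral_sigma_mobius hs (measurable_comp_of_continuousOn
    continuous_height.measurable height_mem_Icc (continuousOn_distSq_rpow hR _)), powMean,
    ← integral_const_mul]
  refine integral_congr_ae (Filter.Eventually.of_forall fun y => ?_)
  simp only
  rw [distSq_height_mobius hR, confFactor_source,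
    rpow_mobius_aux (one_sub_sq_pos hR) (distSq_pos hR (height_mem_Icc y)), neg_sub]

/-- The change of variables that proves `powMean_eq_mobius`. The sign appears because a point and
its image lie on opposite sides of the source, so `height - R` changes sign. -/
lemma powSlope_eq_mobius (k : ℝ) {R : ℝ} (hR : |R| < 1) :
    powSlope d k R = -((1 - R ^ 2) ^ (d - 2 * k - 1) * powSlope d (d - k - 1) R) := by
  have hs : ‖source d R‖ < 1 := by rwa [norm_source]
  rw [powSlope, integral_sigma_mobius hs (measurable_comp_of_continuousOn
    (f := fun u => (u - R) * distSq R u ^ (-k - 1))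
    continuous_height.measurable height_mem_Icc ((by fun_prop : Continuous fun u : ℝ =>
      u - R).continuousOn.mul (continuousOn_distSq_rpow hR _))), powSlope,
    ← integral_const_mul, ← integral_neg]
  refine integral_congr_ae (Filter.Eventually.of_forall fun y => ?_)
  simp only
  have hA := one_sub_sq_pos hR
  have hD := distSq_pos hR (height_mem_Icc y)
  have h := rpow_mobius_aux (d := d) hA hD (k + 1)
  rw [distSq_height_mobius hR, confFactor_source, height_mobius hs]
  have e1 : -k - 1 = -(k + 1) := by ring
  have e2 : d - 2 * (k + 1) = d - 2 * k - 1 - 1 := by ring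
  have e3 : -(d - k - 1) - 1 = k + 1 - d - 1 := by ring
  rw [e2, Real.rpow_sub_one hA.ne'] at h
  rw [e1, e3, Real.rpow_sub_one hD.ne']
  have : ∀ a b c e x : ℝ, a * b = c → a * ((R - e * x - R) * b) = -(c * (e * x)) := by
    intro a b c e x h
    rw [← h]
    ring
  rw [this _ _ _ _ _ h]
  field_simp

/-- `R ^ d` is the integrating factor of the radial equation. As `powMean` is positive, the sign of
`2 * k + 1 - d` decides the monotonicity of the product, which vanishes at `0`. -/
lemma hasDerivAt_pow_mul_powSlope (hd : d ≠ 0) (k : ℝ) {R : ℝ} (hR : |R| < 1) :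
    HasDerivAt (fun R => R ^ d * powSlope d k R)
      ((2 * k + 1 - d) * (R ^ d * powMean d (k + 1) R)) R := by
  obtain ⟨N', hN, h⟩ := hasDerivAt_powSlope' (d := d) k hR
  refine ((hasDerivAt_pow d R).mul hN).congr_deriv ?_
  obtain ⟨n, rfl⟩ := Nat.exists_eq_succ_of_ne_zero hd
  simp only [Nat.succ_eq_add_one, Nat.add_sub_cancel] at h ⊢
  linear_combination R ^ n * h

lemma abs_lt_one_of_mem_Ico {R : ℝ} (h : R ∈ Ico (0 : ℝ) 1) : |R| < 1 := by
  rw [abs_of_nonneg h.1]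
  exact h.2

lemma abs_lt_one_of_mem_Ioo {R : ℝ} (h : R ∈ Ioo (0 : ℝ) 1) : |R| < 1 :=
  abs_lt_one_of_mem_Ico ⟨h.1.le, h.2⟩

lemma continuousOn_pow_mul_powSlope (hd : d ≠ 0) (k : ℝ) :
    ContinuousOn (fun R => R ^ d * powSlope d k R) (Ico 0 1) := fun _ hR =>
  (hasDerivAt_pow_mul_powSlope hd k (abs_lt_one_of_mem_Ico hR)).continuousAt.continuousWithinAt

lemma powSlope_pos (hd : d ≠ 0) {k : ℝ} (hk : (d : ℝ) < 2 * k + 1) {R : ℝ}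
    (hR : R ∈ Ioo (0 : ℝ) 1) : 0 < powSlope d k R := by
  have hmono : StrictMonoOn (fun R => R ^ d * powSlope d k R) (Ico 0 1) := by
    refine strictMonoOn_of_deriv_pos (convex_Ico 0 1) (continuousOn_pow_mul_powSlope hd k) ?_
    rw [interior_Ico]
    intro x hx
    rw [(hasDerivAt_pow_mul_powSlope hd k (abs_lt_one_of_mem_Ioo hx)).deriv]
    have := powMean_pos (d := d) (k + 1) (abs_lt_one_of_mem_Ioo hx)
    have := pow_pos hx.1 d
    have : 0 < 2 * k + 1 - d := by linarith
    positivity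
  have h := hmono (left_mem_Ico.2 one_pos) ⟨hR.1.le, hR.2⟩ hR.1
  simp only [zero_pow hd, zero_mul] at h
  exact (pos_iff_pos_of_mul_pos h).1 (pow_pos hR.1 d)

lemma strictAntiOn_pow_mul_powSlope (hd : d ≠ 0) {k : ℝ} (hk : 2 * k + 1 < (d : ℝ)) :
    StrictAntiOn (fun R => R ^ d * powSlope d k R) (Ico 0 1) := by
  refine strictAntiOn_of_deriv_neg (convex_Ico 0 1) (continuousOn_pow_mul_powSlope hd k) ?_
  rw [interior_Ico]
  intro x hx
  rw [(hasDerivAt_pow_mul_powSlope hd k (abs_lt_one_of_mem_Ioo hx)).deriv]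
  have := powMean_pos (d := d) (k + 1) (abs_lt_one_of_mem_Ioo hx)
  have := pow_pos hx.1 d
  refine mul_neg_of_neg_of_pos (by linarith) (by positivity)

lemma powSlope_neg (hd : d ≠ 0) {k : ℝ} (hk : 2 * k + 1 < (d : ℝ)) {R : ℝ}
    (hR : R ∈ Ioo (0 : ℝ) 1) : powSlope d k R < 0 := by
  have h := strictAntiOn_pow_mul_powSlope hd hk (left_mem_Ico.2 one_pos) ⟨hR.1.le, hR.2⟩ hR.1
  simp only [zero_pow hd, zero_mul] at h
  have := pow_pos hR.1 d
  by_contra! hc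
  exact absurd h (not_lt.2 (by positivity))

/-- In `R N' = (2k + 1 - d) R M - d N`, with `M` the mean of index `k + 1`, the bound `N ≤ (2k + 1 -
d) / (d + 1) * R M` leaves a positive remainder. The bound holds because `M` increases on `(0, 1)`.
-/
lemma strictMonoOn_powSlope (hd : d ≠ 0) {k : ℝ} (hk : (d : ℝ) < 2 * k + 1) :
    StrictMonoOn (powSlope d k) (Ico 0 1) := by
  have hd1 : (1 : ℝ) ≤ d := by exact_mod_cast Nat.one_le_iff_ne_zero.2 hd
  have hk0 : 0 < k := by linarith
  have hc : 0 < 2 * k + 1 - d := by linarith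
  -- The constant is what integrating `(2k + 1 - d) R ^ d` gives if `powMean` is treated as
  -- constant. Only the derivative of `powMean` survives in `G'`, so `G` decreases from `0`.
  set G : ℝ → ℝ := fun R => R ^ d * powSlope d k R -
    (2 * k + 1 - d) / (d + 1) * (R ^ (d + 1) * powMean d (k + 1) R) with hG
  have hGd : ∀ R, |R| < 1 → HasDerivAt G (-((2 * k + 1 - d) / (d + 1) *
      (R ^ (d + 1) * (2 * (k + 1) * powSlope d (k + 1) R)))) R := by
    intro R hR
    have h1 := (hasDerivAt_pow (d + 1) R).mul (hasDerivAt_powMean (d := d) (k + 1) hR)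
    refine ((hasDerivAt_pow_mul_powSlope hd k hR).sub (h1.const_mul _)).congr_deriv ?_
    have : (d : ℝ) + 1 ≠ 0 := by positivity
    simp only [Nat.add_sub_cancel]
    push_cast
    field_simp
    ring
  have hGanti : AntitoneOn G (Ico 0 1) := by
    refine antitoneOn_of_deriv_nonpos (convex_Ico 0 1)
      (fun R hR => (hGd R (abs_lt_one_of_mem_Ico hR)).continuousAt.continuousWithinAt)
      ?_ ?_
    · rw [interior_Ico]
      exact fun R hR => (hGd R (abs_lt_one_of_mem_Ioo hR)).differentiableAt.differentiableWithinAt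
    · rw [interior_Ico]
      intro R hR
      rw [(hGd R (abs_lt_one_of_mem_Ioo hR)).deriv, neg_nonpos]
      have := powSlope_pos hd (k := k + 1) (by linarith) hR
      have := hR.1
      positivity
  refine strictMonoOn_of_deriv_pos (convex_Ico 0 1) (fun R hR =>
    (hasDerivAt_powSlope k (abs_lt_one_of_mem_Ico hR)).continuousAt.continuousWithinAt) ?_
  rw [interior_Ico]
  intro R hR
  obtain ⟨N', hN, h⟩ := hasDerivAt_powSlope' (d := d) k (abs_lt_one_of_mem_Ioo hR)
  rw [hN.deriv]
  have h0 := hGanti (left_mem_Ico.2 one_pos) ⟨hR.1.le, hR.2⟩ hR.1.le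
  simp only [hG, zero_pow hd, zero_mul, zero_pow (Nat.succ_ne_zero d), mul_zero, sub_zero] at h0
  have hM := powMean_pos (d := d) (k + 1) (abs_lt_one_of_mem_Ioo hR)
  have hRd := pow_pos hR.1 d
  have h1 : R ^ d * powSlope d k R ≤
      R ^ d * ((2 * k + 1 - d) / (d + 1) * (R * powMean d (k + 1) R)) := by
    have e : R ^ (d + 1) = R ^ d * R := pow_succ R d
    rw [e] at h0
    linarith
  have h2 := le_of_mul_le_mul_left h1 hRd
  have h3 : 0 < R * N' := by
    have h4 : R * N' = (2 * k + 1 - d) * (R * powMean d (k + 1) R) - d * powSlope d k R := by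
      linarith
    have h5 : d * powSlope d k R ≤
      d * ((2 * k + 1 - d) / (d + 1) * (R * powMean d (k + 1) R)) := by gcongr
    have h6 : (2 * k + 1 - d) * (R * powMean d (k + 1) R) -
        d * ((2 * k + 1 - d) / (d + 1) * (R * powMean d (k + 1) R)) =
        (2 * k + 1 - d) / (d + 1) * (R * powMean d (k + 1) R) := by
      have : (d : ℝ) + 1 ≠ 0 := by positivity
      field_simp
      ring
    have h7 : 0 < (2 * k + 1 - d) / (d + 1) * (R * powMean d (k + 1) R) := by
      have := hR.1
      positivity
    linarith
  exact (pos_iff_pos_of_mul_pos h3).1 hR.1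

/-- A bound uniform up to `R = 1`; it will make the potential of `σ` finite on the sphere itself. -/
lemma powMean_le_one (hd : d ≠ 0) {k : ℝ} (hk0 : 0 < k) (hk : 2 * k + 1 < (d : ℝ)) {R : ℝ}
    (hR : R ∈ Ico (0 : ℝ) 1) : powMean d k R ≤ 1 := by
  have hanti : AntitoneOn (powMean d k) (Ico 0 1) := by
    refine antitoneOn_of_deriv_nonpos (convex_Ico 0 1) (fun R hR =>
      (hasDerivAt_powMean k (abs_lt_one_of_mem_Ico hR)).continuousAt.continuousWithinAt) ?_ ?_
    · rw [interior_Ico]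
      exact fun R hR => (hasDerivAt_powMean k
        (abs_lt_one_of_mem_Ioo hR)).differentiableAt.differentiableWithinAt
    · rw [interior_Ico]
      intro R hR
      rw [(hasDerivAt_powMean k (abs_lt_one_of_mem_Ioo hR)).deriv]
      exact mul_nonpos_of_nonneg_of_nonpos (by positivity) (powSlope_neg hd hk hR).le
  rw [← powMean_zero_right (d := d) k]
  exact hanti (left_mem_Ico.2 one_pos) hR hR.1

/-- A polynomial solution of the inhomogeneous radial equation with polynomial right hand side. -/
lemma exists_polynomial_radial (d : ℕ) (P : ℝ[X]) : ∃ Q S : ℝ[X], S.eval 0 = 0 ∧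
    (∀ R : ℝ, HasDerivAt (fun R => R ^ d * S.eval R) (R ^ d * P.eval R) R) ∧
      ∀ R : ℝ, HasDerivAt (fun R => Q.eval R) (S.eval R) R := by
  have hS : ∃ S : ℝ[X], S.eval 0 = 0 ∧ ∀ R : ℝ, HasDerivAt (fun R => R ^ d * S.eval R) (R ^ d * P.eval R) R := by
    induction P using Polynomial.induction_on' with
    | add p q hp hq =>
      obtain ⟨S, hS0, hS⟩ := hp
      obtain ⟨T, hT0, hT⟩ := hq
      refine ⟨S + T, by simp [hS0, hT0], fun R => ?_⟩
      have := (hS R).add (hT R)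
      simpa [mul_add, Pi.add_def] using this
    | monomial n a =>
      refine ⟨Polynomial.monomial (n + 1) (a / (d + n + 1)), by simp, fun R => ?_⟩
      have h := (hasDerivAt_pow (d + n + 1) R).const_mul (a / (d + n + 1))
      have hne : (d : ℝ) + n + 1 ≠ 0 := by positivity
      have e : (fun R : ℝ => R ^ d * (Polynomial.monomial (n + 1) (a / (d + n + 1))).eval R) =
          fun R => a / (d + n + 1) * R ^ (d + n + 1) := by
        ext R
        rw [Polynomial.eval_monomial]
        ring
      rw [e]
      refine h.congr_deriv ?_
      rw [Polynomial.eval_monomial, Nat.add_sub_cancel]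
      push_cast
      field_simp
      ring
  have hQ : ∀ S : ℝ[X], ∃ Q : ℝ[X], ∀ R : ℝ, HasDerivAt (fun R => Q.eval R) (S.eval R) R := by
    intro S
    induction S using Polynomial.induction_on' with
    | add p q hp hq =>
      obtain ⟨S, hS⟩ := hp
      obtain ⟨T, hT⟩ := hq
      refine ⟨S + T, fun R => ?_⟩
      have := (hS R).add (hT R)
      simpa [Pi.add_def] using this
    | monomial n a =>
      refine ⟨Polynomial.monomial (n + 1) (a / (n + 1)), fun R => ?_⟩
      have h := (hasDerivAt_pow (n + 1) R).const_mul (a / (n + 1))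
      have hne : (n : ℝ) + 1 ≠ 0 := by positivity
      simp only [Polynomial.eval_monomial]
      refine h.congr_deriv ?_
      rw [Nat.add_sub_cancel]
      push_cast
      field_simp
  obtain ⟨S, hS0, hS⟩ := hS
  obtain ⟨Q, hQ⟩ := hQ S
  exact ⟨Q, S, hS0, hS, hQ⟩

lemma sub_eq_sub_of_hasDerivAt_eq {f g f' : ℝ → ℝ} (hf : ∀ x ∈ Ico (0 : ℝ) 1, HasDerivAt f (f' x) x)
    (hg : ∀ x ∈ Ico (0 : ℝ) 1, HasDerivAt g (f' x) x) {R : ℝ} (hR : R ∈ Ico (0 : ℝ) 1) :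
    f R - g R = f 0 - g 0 := by
  have hc : ∀ x ∈ Icc 0 R, x ∈ Ico (0 : ℝ) 1 := fun x hx => ⟨hx.1, hx.2.trans_lt hR.2⟩
  have hd : ∀ x ∈ Ico (0 : ℝ) 1, HasDerivAt (fun x => f x - g x) 0 x := fun x hx =>
    ((hf x hx).sub (hg x hx)).congr_deriv (sub_self _)
  exact constant_of_has_deriv_right_zero
    (fun x hx => (hd x (hc x hx)).continuousAt.continuousWithinAt)
    (fun x hx => (hd x (hc x (Ico_subset_Icc_self hx))).hasDerivWithinAt) R ⟨hR.1, le_rfl⟩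

/-- The radial equation expresses the mean of index `k` by two integrations of the mean of index `k
+ 1`, and both keep polynomials polynomial. The recursion stops at `2k + 1 = d`, where the right
hand side vanishes; raising `m` by one lowers `k` by one. -/
lemma exists_polynomial_powMean (hd : d ≠ 0) (m : ℕ) : ∀ k : ℝ, 2 * k = d - 1 - 2 * m →
    ∃ P : ℝ[X], ∀ R ∈ Ico (0 : ℝ) 1, powMean d k R = P.eval R := by
  have key : ∀ k : ℝ, (∃ P : ℝ[X], ∀ R ∈ Ico (0 : ℝ) 1,
      (2 * k + 1 - d) * powMean d (k + 1) R = P.eval R) →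
      ∃ P : ℝ[X], ∀ R ∈ Ico (0 : ℝ) 1, powMean d k R = P.eval R := by
    rintro k ⟨P, hP⟩
    obtain ⟨Q, S, hS0, hS, hQ⟩ := exists_polynomial_radial d P
    have hslope : ∀ R ∈ Ico (0 : ℝ) 1, powSlope d k R = S.eval R := by
      intro R hR
      rcases eq_or_lt_of_le hR.1 with rfl | hR0
      · rw [powSlope_zero_right hd, hS0]
      have h := sub_eq_sub_of_hasDerivAt_eq
        (fun x hx => hasDerivAt_pow_mul_powSlope hd k (abs_lt_one_of_mem_Ico hx))
        (fun x hx => (hS x).congr_deriv (by rw [← hP x hx]; ring)) hR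
      simp only [zero_pow hd, zero_mul, sub_zero, sub_eq_zero] at h
      exact mul_left_cancel₀ (pow_pos hR0 d).ne' h
    -- The constant term is fixed by `powMean d k 0 = 1`.
    refine ⟨Polynomial.C (1 - 2 * k * Q.eval 0) + Polynomial.C (2 * k) * Q, fun R hR => ?_⟩
    have h := sub_eq_sub_of_hasDerivAt_eq
      (fun x hx => hasDerivAt_powMean (d := d) k (abs_lt_one_of_mem_Ico hx))
      (fun x hx => ((hQ x).const_mul (2 * k)).congr_deriv (by rw [hslope x hx])) hR
    simp only [powMean_zero_right] at h
    simp only [Polynomial.eval_add, Polynomial.eval_mul, Polynomial.eval_C]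
    linarith
  induction m with
  | zero =>
    intro k hk
    refine key k ⟨0, fun R _ => ?_⟩
    have : 2 * k + 1 - d = 0 := by
      push_cast at hk
      linarith
    simp [this]
  | succ m ih =>
    intro k hk
    obtain ⟨P, hP⟩ := ih (k + 1) (by push_cast at hk ⊢; linarith)
    exact key k ⟨Polynomial.C (2 * k + 1 - d) * P, fun R hR => by simp [hP R hR]⟩

end Gonchar

/-! ### Potentials of `σ` and balayage of a point charge -/

namespace Gonchar

variable {d : ℕ} {s : ℝ}

lemma edist_rpow_eq_ofReal {E : Type*} [NormedAddCommGroup E] {x y : E} (h : 0 < ‖x - y‖) (s : ℝ) :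
    edist x y ^ s = ENNReal.ofReal (‖x - y‖ ^ s) := by
  rw [edist_dist, dist_eq_norm, ENNReal.ofReal_rpow_of_pos h]

lemma measurable_edist_rpow (x : EuclideanSpace ℝ (Fin (d + 1))) (s : ℝ) :
    Measurable fun y : EuclideanSpace ℝ (Fin (d + 1)) => edist x y ^ s :=
  (measurable_edist_right).pow_const s

lemma measurable_edist_rpow_coe (x : EuclideanSpace ℝ (Fin (d + 1))) (s : ℝ) :
    Measurable fun y : Sphere d => edist x (y : EuclideanSpace ℝ (Fin (d + 1))) ^ s :=
  (measurable_edist_rpow x s).comp measurable_subtype_coe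

lemma norm_source_sub (R : ℝ) (y : Sphere d) :
    ‖source d R - (y : EuclideanSpace ℝ (Fin (d + 1)))‖ = Real.sqrt (distSq R (height y)) := by
  rw [norm_sub_rev, distSq, ← norm_sub_source_sq, Real.sqrt_sq (norm_nonneg _)]

lemma norm_sub_source_rpow {R : ℝ} (y : Sphere d) (t : ℝ) :
    ‖(y : EuclideanSpace ℝ (Fin (d + 1))) - source d R‖ ^ t = distSq R (height y) ^ (t / 2) := by
  rw [norm_sub_rev, norm_source_sub, Real.sqrt_eq_rpow, ← Real.rpow_mul]
  · congr 1
    ring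
  · rw [distSq, ← norm_sub_source_sq]
    positivity

lemma rieszPotential_sigma_source {R : ℝ} (hR : |R| < 1) :
    rieszPotential s (sigma d) (source d R) = ENNReal.ofReal (powMean d (s / 2) R) := by
  rw [rieszPotential, powMean, ofReal_integral_eq_lintegral_ofReal (integrable_distSq_rpow hR _)
    (Filter.Eventually.of_forall fun y =>
      (Real.rpow_pos_of_pos (distSq_pos hR (height_mem_Icc y)) _).le)]
  refine lintegral_congr fun y => ?_
  have h : 0 < ‖source d R - (y : EuclideanSpace ℝ (Fin (d + 1)))‖ := by
    rw [norm_source_sub]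
    exact Real.sqrt_pos.2 (distSq_pos hR (height_mem_Icc y))
  rw [edist_rpow_eq_ofReal h, norm_sub_rev, norm_sub_source_rpow, neg_div]

lemma sigmaPotential_eq_powMean {R : ℝ} (hR : |R| < 1) :
    sigmaPotential d s R = powMean d (s / 2) R := by
  rw [sigmaPotential, rieszPotential_sigma_source hR, ENNReal.toReal_ofReal (powMean_pos _ hR).le]

/-- The reflection in the hyperplane orthogonal to `y - x` swaps the two points and preserves `σ`.
-/
lemma rieszPotential_sigma_eq_of_norm_eq {x y : EuclideanSpace ℝ (Fin (d + 1))}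
    (h : ‖x‖ = ‖y‖) : rieszPotential s (sigma d) x = rieszPotential s (sigma d) y := by
  have hxy : (Submodule.span ℝ {y - x})ᗮ.reflection y = x := Submodule.reflection_sub h.symm
  rw [rieszPotential, lintegral_sigma_reflection (Submodule.span ℝ {y - x})ᗮ
    (measurable_edist_rpow x (-s)), rieszPotential]
  refine lintegral_congr fun z => ?_
  have h1 := (Submodule.span ℝ {y - x})ᗮ.reflection.edist_map y z
  rw [hxy] at h1
  rw [h1]

lemma source_one : source d 1 = pole d := one_smul _ _

/-- Fatou's lemma along sources tending to the pole from inside, where `powMean_le_one` applies. -/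
lemma rieszPotential_sigma_le_one (hs : 0 < s) (hsd : s < (d : ℝ) - 1)
    {x : EuclideanSpace ℝ (Fin (d + 1))} (hx : ‖x‖ = 1) : rieszPotential s (sigma d) x ≤ 1 := by
  have hd : d ≠ 0 := by
    rintro rfl
    norm_num at hsd
    linarith
  rw [rieszPotential_sigma_eq_of_norm_eq (y := pole d) (by simpa using hx), rieszPotential]
  have hlim : Filter.Tendsto (fun n : ℕ => 1 - 1 / ((n : ℝ) + 1)) Filter.atTop (nhds 1) := by
    simpa using tendsto_one_div_add_atTop_nhds_zero_nat.const_sub (1 : ℝ)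
  have hker : ∀ y : Sphere d, edist (pole d) (y : EuclideanSpace ℝ (Fin (d + 1))) ^ (-s) =
      Filter.liminf (fun n : ℕ => edist (source d (1 - 1 / ((n : ℝ) + 1)))
        (y : EuclideanSpace ℝ (Fin (d + 1))) ^ (-s)) Filter.atTop := by
    intro y
    refine (Filter.Tendsto.liminf_eq ?_).symm
    have hc : Continuous fun R : ℝ => edist (source d R)
        (y : EuclideanSpace ℝ (Fin (d + 1))) ^ (-s) := by
      refine ENNReal.continuous_rpow_const.comp ?_
      unfold source
      fun_prop
    have := (hc.tendsto 1).comp hlim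
    rwa [source_one] at this
  simp only [hker]
  refine (lintegral_liminf_le fun n => measurable_edist_rpow_coe _ _).trans ?_
  refine Filter.liminf_le_of_frequently_le' (Filter.Eventually.frequently ?_)
  filter_upwards with n
  have hn : (1 - 1 / ((n : ℝ) + 1)) ∈ Ico (0 : ℝ) 1 := by
    have : (0 : ℝ) < n + 1 := by positivity
    constructor
    · rw [sub_nonneg, div_le_one this]
      linarith [n.cast_nonneg (α := ℝ)]
    · have := one_div_pos.2 this
      linarith
  have h := rieszPotential_sigma_source (d := d) (s := s) (abs_lt_one_of_mem_Ico hn)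
  rw [rieszPotential] at h
  rw [h, ← ENNReal.ofReal_one]
  exact ENNReal.ofReal_le_ofReal (powMean_le_one hd (by positivity) (by linarith) hn)

lemma rieszPotential_sigma_eq (hs : 0 < s) (hsd : s < (d : ℝ) - 1)
    {x : EuclideanSpace ℝ (Fin (d + 1))} (hx : ‖x‖ = 1) :
    rieszPotential s (sigma d) x = ENNReal.ofReal (sigmaPotential d s 1) := by
  rw [sigmaPotential, ENNReal.ofReal_toReal]
  · exact rieszPotential_sigma_eq_of_norm_eq (by rw [hx, norm_source, abs_one])
  · exact ((rieszPotential_sigma_le_one hs hsd (by rw [norm_source, abs_one])).trans_lt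
      ENNReal.one_lt_top).ne

lemma sigmaPotential_one_pos (hs : 0 < s) (hsd : s < (d : ℝ) - 1) : 0 < sigmaPotential d s 1 := by
  refine ENNReal.toReal_pos ?_ ?_
  · rw [rieszPotential]
    -- `2` is the diameter of the sphere.
    have h : (2 : ℝ≥0∞) ^ (-s) ≤ ∫⁻ y : Sphere d, edist (source d 1)
        (y : EuclideanSpace ℝ (Fin (d + 1))) ^ (-s) ∂sigma d := by
      calc (2 : ℝ≥0∞) ^ (-s) = ∫⁻ _ : Sphere d, (2 : ℝ≥0∞) ^ (-s) ∂sigma d := by simp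
        _ ≤ _ := by
          refine lintegral_mono fun y => ?_
          rw [ENNReal.rpow_neg, ENNReal.rpow_neg]
          gcongr
          rw [edist_dist, dist_eq_norm]
          refine ENNReal.ofReal_le_of_le_toReal ?_
          refine (norm_sub_le _ _).trans ?_
          rw [norm_source, norm_coe_sphere]
          norm_num
    have h2 : (0 : ℝ≥0∞) < 2 ^ (-s) := ENNReal.rpow_pos (by norm_num) (by norm_num)
    exact (h2.trans_le h).ne'
  · exact ((rieszPotential_sigma_le_one hs hsd (by rw [norm_source, abs_one])).trans_lt
      ENNReal.one_lt_top).ne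

/-- An atom would make the potential infinite at that point. -/
lemma sigma_singleton (hs : 0 < s) (hsd : s < (d : ℝ) - 1) (x : Sphere d) : sigma d {x} = 0 := by
  have h := rieszPotential_sigma_le_one hs hsd (norm_coe_sphere x)
  have h1 : ∫⁻ y in {x}, edist (x : EuclideanSpace ℝ (Fin (d + 1)))
      (y : EuclideanSpace ℝ (Fin (d + 1))) ^ (-s) ∂sigma d ≤ 1 :=
    (setLIntegral_le_lintegral _ _).trans h
  rw [lintegral_singleton, edist_self, ENNReal.zero_rpow_of_neg (by linarith)] at h1
  by_contra hne
  rw [ENNReal.top_mul hne] at h1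
  exact absurd h1 (by simp)

lemma continuousOn_sigmaPotential (hs : 0 < s) (hsd : s < (d : ℝ) - 1) :
    ContinuousOn (sigmaPotential d s) (Icc 0 1) := by
  intro R hR
  rcases eq_or_lt_of_le hR.2 with rfl | hR1
  · have hfin : rieszPotential s (sigma d) (source d 1) ≠ ∞ :=
      ((rieszPotential_sigma_le_one hs hsd (by rw [norm_source, abs_one])).trans_lt
        ENNReal.one_lt_top).ne
    refine (ENNReal.tendsto_toReal hfin).comp ?_
    -- For `R > 1/2`, `distSq R u - distSq 1 u / 2 = R² - (2R - 1) u ≥ (1 - R)² ≥ 0`, so a multiple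
    -- of the kernel at the pole dominates.
    refine tendsto_lintegral_filter_of_dominated_convergence
      (fun y => ENNReal.ofReal (Real.sqrt (1 / 2)) ^ (-s) *
        edist (source d 1) (y : EuclideanSpace ℝ (Fin (d + 1))) ^ (-s))
      (Filter.Eventually.of_forall fun R => measurable_edist_rpow_coe _ _) ?_ ?_ ?_
    · filter_upwards [self_mem_nhdsWithin, mem_nhdsWithin_of_mem_nhds
        (lt_mem_nhds (by norm_num : (1 / 2 : ℝ) < 1))] with R hR hR2
      refine Filter.Eventually.of_forall fun y => ?_
      rw [← ENNReal.mul_rpow_of_ne_top ENNReal.ofReal_ne_top (edist_ne_top _ _), ENNReal.rpow_neg,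
        ENNReal.rpow_neg]
      gcongr
      rw [edist_dist, edist_dist, dist_eq_norm, dist_eq_norm,
        ← ENNReal.ofReal_mul (Real.sqrt_nonneg _), norm_source_sub, norm_source_sub,
        ← Real.sqrt_mul (by norm_num)]
      refine ENNReal.ofReal_le_ofReal (Real.sqrt_le_sqrt ?_)
      unfold distSq
      nlinarith [sq_nonneg (1 - R), (height_mem_Icc y).2]
    · rw [lintegral_const_mul _ (measurable_edist_rpow_coe _ _)]
      refine ENNReal.mul_ne_top ?_ hfin
      refine ENNReal.rpow_ne_top_of_ne_zero ?_ ENNReal.ofReal_ne_top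
      simp
    · refine Filter.Eventually.of_forall fun y => ?_
      have hc : Continuous fun R : ℝ => edist (source d R)
          (y : EuclideanSpace ℝ (Fin (d + 1))) ^ (-s) := by
        refine ENNReal.continuous_rpow_const.comp ?_
        unfold source
        fun_prop
      exact (hc.tendsto 1).mono_left nhdsWithin_le_nhds
  · have hR' := abs_lt_one_of_mem_Ico ⟨hR.1, hR1⟩
    have h := (hasDerivAt_powMean (d := d) (s / 2) hR').continuousAt
    refine (h.congr ?_).continuousWithinAt
    have : ∀ᶠ x in nhds R, |x| < 1 := continuous_abs.continuousAt.eventually_lt_const hR'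
    filter_upwards [this] with x hx
    exact (sigmaPotential_eq_powMean hx).symm

/-- The density of the balayage onto the sphere of a point charge at `a`, up to the factor
`W_s(S^d)`. -/
noncomputable def balayageDensity (d : ℕ) (s : ℝ) (a : EuclideanSpace ℝ (Fin (d + 1)))
    (y : Sphere d) : ℝ :=
  (1 - ‖a‖ ^ 2) ^ ((d : ℝ) - s) * ‖(y : EuclideanSpace ℝ (Fin (d + 1))) - a‖ ^ (s - 2 * d)

lemma balayageDensity_pos {a : EuclideanSpace ℝ (Fin (d + 1))} (ha : ‖a‖ < 1) (y : Sphere d) :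
    0 < balayageDensity d s a y := by
  have h := norm_coe_sub_pos ha y
  have h3 : 0 < 1 - ‖a‖ ^ 2 := by nlinarith [norm_nonneg a]
  unfold balayageDensity
  positivity

lemma continuous_balayageDensity {a : EuclideanSpace ℝ (Fin (d + 1))} (ha : ‖a‖ < 1) :
    Continuous (balayageDensity d s a) := by
  unfold balayageDensity
  refine continuous_const.mul (Continuous.rpow_const (by fun_prop) fun y => Or.inl ?_)
  exact (norm_coe_sub_pos ha y).ne'

lemma confFactor_pow_mul {a : EuclideanSpace ℝ (Fin (d + 1))} (ha : ‖a‖ < 1) (y : Sphere d)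
    {c : ℝ} (hc : 0 < c) :
    confFactor a (y : EuclideanSpace ℝ (Fin (d + 1))) ^ d *
      ((1 - ‖a‖ ^ 2) / (c * ‖(y : EuclideanSpace ℝ (Fin (d + 1))) - a‖)) ^ (-s) =
    c ^ s * balayageDensity d s a y := by
  have h := norm_coe_sub_pos ha y
  have h3 : 0 < 1 - ‖a‖ ^ 2 := by nlinarith [norm_nonneg a]
  rw [confFactor_coe, balayageDensity]
  generalize ‖(y : EuclideanSpace ℝ (Fin (d + 1))) - a‖ = D at *
  generalize 1 - ‖a‖ ^ 2 = A at *
  rw [Real.rpow_sub h3, Real.rpow_sub h, Real.rpow_neg (by positivity), Real.div_rpow h3.le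
    (by positivity), Real.mul_rpow hc.le h.le, Real.rpow_mul h.le, Real.rpow_natCast,
    Real.rpow_natCast, div_pow]
  have : D ^ (2 : ℝ) = D ^ 2 := by exact_mod_cast Real.rpow_natCast D 2
  rw [this]
  have := Real.rpow_pos_of_pos h3 s
  have := Real.rpow_pos_of_pos h s
  have := Real.rpow_pos_of_pos hc s
  field_simp

/-- Write the constant potential of `σ` at the image of `x`, and pull the integral back by the
involution. By `norm_mobius_sub_mobius` the kernel splits into the kernel at `x`, the factor `|x -
a|^s`, and a function of `y` that with the Jacobian forms the balayage density. -/
lemma lintegral_edist_mul_balayageDensity (hs : 0 < s) (hsd : s < (d : ℝ) - 1)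
    {a : EuclideanSpace ℝ (Fin (d + 1))} (ha : ‖a‖ < 1) (x : Sphere d) :
    ∫⁻ y : Sphere d, edist (x : EuclideanSpace ℝ (Fin (d + 1)))
      (y : EuclideanSpace ℝ (Fin (d + 1))) ^ (-s) * ENNReal.ofReal (balayageDensity d s a y)
        ∂sigma d = ENNReal.ofReal (sigmaPotential d s 1 *
          ‖(x : EuclideanSpace ℝ (Fin (d + 1))) - a‖ ^ (-s)) := by
  have h0 := rieszPotential_sigma_eq hs hsd (norm_coe_sphere (mobius ha x))
  have hx := norm_coe_sub_pos ha x
  have h3 : 0 < 1 - ‖a‖ ^ 2 := by nlinarith [norm_nonneg a]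
  rw [rieszPotential, lintegral_sigma_mobius ha (measurable_edist_rpow _ _)] at h0
  have hker : ∀ y : Sphere d,
      ENNReal.ofReal (confFactor a (y : EuclideanSpace ℝ (Fin (d + 1))) ^ d) *
        edist ((mobius ha x : Sphere d) : EuclideanSpace ℝ (Fin (d + 1))) (coneMap a y) ^ (-s) =
      ENNReal.ofReal (‖(x : EuclideanSpace ℝ (Fin (d + 1))) - a‖ ^ s) *
        (edist (x : EuclideanSpace ℝ (Fin (d + 1)))
          (y : EuclideanSpace ℝ (Fin (d + 1))) ^ (-s) *
          ENNReal.ofReal (balayageDensity d s a y)) := by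
    intro y
    have hy := norm_coe_sub_pos ha y
    have hc := confFactor_pos ha (coe_sphere_ne_zero y)
    have e : edist ((mobius ha x : Sphere d) : EuclideanSpace ℝ (Fin (d + 1))) (coneMap a y) =
        ENNReal.ofReal ((1 - ‖a‖ ^ 2) / (‖(x : EuclideanSpace ℝ (Fin (d + 1))) - a‖ *
          ‖(y : EuclideanSpace ℝ (Fin (d + 1))) - a‖)) *
        edist (x : EuclideanSpace ℝ (Fin (d + 1))) (y : EuclideanSpace ℝ (Fin (d + 1))) := by
      rw [edist_dist, edist_dist, dist_eq_norm, dist_eq_norm, coe_mobius, norm_mobius_sub_mobius ha,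
        ← ENNReal.ofReal_mul (by positivity)]
      congr 1
      ring
    rw [e, ENNReal.mul_rpow_of_ne_top ENNReal.ofReal_ne_top (edist_ne_top _ _),
      ENNReal.ofReal_rpow_of_pos (by positivity), ← mul_assoc, ← ENNReal.ofReal_mul (by positivity),
      confFactor_pow_mul ha y hx, ENNReal.ofReal_mul (by positivity)]
    ring
  simp only [hker] at h0
  have hm : Measurable fun y : Sphere d => edist (x : EuclideanSpace ℝ (Fin (d + 1)))
      (y : EuclideanSpace ℝ (Fin (d + 1))) ^ (-s) * ENNReal.ofReal (balayageDensity d s a y) :=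
    (measurable_edist_rpow_coe _ _).mul (continuous_balayageDensity ha).measurable.ennreal_ofReal
  rw [lintegral_const_mul _ hm] at h0
  have hpos : 0 < ‖(x : EuclideanSpace ℝ (Fin (d + 1))) - a‖ ^ s := by positivity
  refine (ENNReal.mul_right_inj (ENNReal.ofReal_pos.2 hpos).ne' ENNReal.ofReal_ne_top).1 ?_
  rw [h0, ← ENNReal.ofReal_mul hpos.le, Real.rpow_neg hx.le]
  congr 1
  field_simp

/-- This is Euler's transformation `powMean_eq_mobius` with `k = s / 2`. -/
lemma integral_balayageDensity {R : ℝ} (hR : |R| < 1) :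
    ∫ y, balayageDensity d s (source d R) y ∂sigma d = sigmaPotential d s R := by
  rw [sigmaPotential_eq_powMean hR, powMean_eq_mobius _ hR, powMean, ← integral_const_mul]
  refine integral_congr_ae (Filter.Eventually.of_forall fun y => ?_)
  simp only [balayageDensity, norm_source, sq_abs, norm_sub_source_rpow]
  congr 2 <;> ring

end Gonchar

/-! ### Positive definiteness of the Riesz kernel and the energy of the sphere -/

namespace Gonchar

section PositiveDefinite

lemma ennreal_two_mul_le (a b : ℝ≥0∞) : 2 * (a * b) ≤ a * a + b * b := by
  wlog h : a ≤ b generalizing a b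
  · rw [mul_comm a b, add_comm]
    exact this b a (le_of_not_ge h)
  obtain ⟨c, rfl⟩ := le_iff_exists_add.1 h
  calc 2 * (a * (a + c)) ≤ 2 * (a * (a + c)) + c * c := le_self_add
    _ = a * a + (a + c) * (a + c) := by ring

variable {X Ω : Type*} [MeasurableSpace X] [MeasurableSpace Ω] {m : Measure Ω} [SFinite m]
  {φ : X → Ω → ℝ≥0∞}

/-- Tonelli turns the mutual energy into an inner product in `L²(m)`. -/
lemma lintegral_lintegral_factor (hφ : Measurable (Function.uncurry φ)) (μ ν : Measure X)
    [SFinite μ] [SFinite ν] :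
    ∫⁻ x, ∫⁻ y, ∫⁻ ω, φ x ω * φ y ω ∂m ∂ν ∂μ = ∫⁻ ω, (∫⁻ x, φ x ω ∂μ) * ∫⁻ y, φ y ω ∂ν ∂m := by
  have hx : ∀ ω, Measurable fun x => φ x ω := fun ω =>
    hφ.comp (f := fun x => (x, ω)) (by fun_prop)
  have hν : Measurable fun ω => ∫⁻ y, φ y ω ∂ν := hφ.lintegral_prod_left'
  have h1 : ∀ x, ∫⁻ y, ∫⁻ ω, φ x ω * φ y ω ∂m ∂ν = ∫⁻ ω, φ x ω * ∫⁻ y, φ y ω ∂ν ∂m := by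
    intro x
    have hm : Measurable fun p : X × Ω => φ x p.2 * φ p.1 p.2 :=
      (hφ.comp (f := fun p : X × Ω => (x, p.2)) (by fun_prop)).mul hφ
    rw [lintegral_lintegral_swap hm.aemeasurable]
    exact lintegral_congr fun ω => lintegral_const_mul _ (hx ω)
  simp only [h1]
  have hm : Measurable fun p : X × Ω => φ p.1 p.2 * ∫⁻ y, φ y p.2 ∂ν :=
    hφ.mul (hν.comp measurable_snd)
  rw [lintegral_lintegral_swap hm.aemeasurable]
  exact lintegral_congr fun ω => lintegral_mul_const _ (hx ω)

/-- A kernel that factors through an integral is positive definite. -/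
lemma two_mul_lintegral_factor_le (hφ : Measurable (Function.uncurry φ)) (μ ν : Measure X)
    [SFinite μ] [SFinite ν] :
    2 * ∫⁻ x, ∫⁻ y, ∫⁻ ω, φ x ω * φ y ω ∂m ∂ν ∂μ ≤
      ∫⁻ x, ∫⁻ y, ∫⁻ ω, φ x ω * φ y ω ∂m ∂μ ∂μ + ∫⁻ x, ∫⁻ y, ∫⁻ ω, φ x ω * φ y ω ∂m ∂ν ∂ν := by
  have h1 : Measurable fun ω => ∫⁻ y, φ y ω ∂μ := hφ.lintegral_prod_left'
  have h2 : Measurable fun ω => ∫⁻ y, φ y ω ∂ν := hφ.lintegral_prod_left'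
  have h3 : Measurable fun ω => (∫⁻ x, φ x ω ∂μ) * ∫⁻ y, φ y ω ∂ν := h1.mul h2
  have h4 : Measurable fun ω => (∫⁻ x, φ x ω ∂μ) * ∫⁻ y, φ y ω ∂μ := h1.mul h1
  rw [lintegral_lintegral_factor hφ, lintegral_lintegral_factor hφ, lintegral_lintegral_factor hφ,
    ← lintegral_const_mul _ h3, ← lintegral_add_left h4]
  exact lintegral_mono fun ω => ennreal_two_mul_le _ _

end PositiveDefinite

section Gaussian

variable {E : Type*} [NormedAddCommGroup E] [InnerProductSpace ℝ E] [FiniteDimensional ℝ E]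
  [MeasurableSpace E] [BorelSpace E]

/-- The square of this factor, integrated over `ξ` and over `t > 0`, is a Riesz kernel. -/
noncomputable def gaussFactor (E : Type*) [NormedAddCommGroup E] [InnerProductSpace ℝ E] (s : ℝ)
    (x : E) (p : ℝ × E) : ℝ :=
  Real.sqrt (p.1 ^ (s / 2 - 1) * (Real.pi / (4 * p.1)) ^ (-(Module.finrank ℝ E : ℝ) / 2)) *
    Real.exp (-(2 * p.1) * ‖x - p.2‖ ^ 2)

/-- By the parallelogram law the product of the Gaussians at `x` and `y` is a Gaussian in `ξ` about
the midpoint times `exp (-t |x - y|²)`; the prefactor in `gaussFactor` cancels the integral of the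
former. -/
lemma lintegral_gaussFactor_mul (s : ℝ) (x y : E) {t : ℝ} (ht : 0 < t) :
    ∫⁻ ξ : E, ENNReal.ofReal (gaussFactor E s x (t, ξ)) *
      ENNReal.ofReal (gaussFactor E s y (t, ξ)) =
    ENNReal.ofReal (t ^ (s / 2 - 1) * Real.exp (-(‖x - y‖ ^ 2 * t))) := by
  set n : ℝ := (Module.finrank ℝ E : ℝ) with hn
  set A : ℝ := t ^ (s / 2 - 1) * (Real.pi / (4 * t)) ^ (-n / 2) with hA
  have hpi := Real.pi_pos
  have hA0 : 0 ≤ A := by positivity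
  have hI : ∫ v : E, Real.exp (-(4 * t) * ‖v‖ ^ 2) = (Real.pi / (4 * t)) ^ (n / 2) := by
    have := GaussianFourier.integral_rexp_neg_mul_sq_norm (V := E) (b := 4 * t) (by positivity)
    exact this
  have hint : Integrable (fun v : E => Real.exp (-(4 * t) * ‖v‖ ^ 2)) := by
    refine Integrable.of_integral_ne_zero ?_
    rw [hI]
    positivity
  have hpt : ∀ ξ : E, ENNReal.ofReal (gaussFactor E s x (t, ξ)) *
      ENNReal.ofReal (gaussFactor E s y (t, ξ)) =
      ENNReal.ofReal (A * Real.exp (-(‖x - y‖ ^ 2 * t))) *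
        ENNReal.ofReal (Real.exp (-(4 * t) * ‖ξ - (1 / 2 : ℝ) • (x + y)‖ ^ 2)) := by
    intro ξ
    rw [← ENNReal.ofReal_mul (by unfold gaussFactor; positivity),
      ← ENNReal.ofReal_mul (by positivity)]
    congr 1
    simp only [gaussFactor]
    rw [mul_mul_mul_comm, Real.mul_self_sqrt hA0, ← Real.exp_add, mul_assoc A, ← Real.exp_add]
    congr 2
    have h1 := parallelogram_law_with_norm ℝ (x - ξ) (y - ξ)
    have h2 : x - ξ + (y - ξ) = (-2 : ℝ) • (ξ - (1 / 2 : ℝ) • (x + y)) := by module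
    have h3 : x - ξ - (y - ξ) = x - y := by abel
    rw [h2, h3, norm_smul] at h1
    norm_num at h1 ⊢
    linear_combination t * h1
  simp only [hpt]
  rw [lintegral_const_mul _ (by fun_prop),
    lintegral_sub_right_eq_self (fun v : E => ENNReal.ofReal (Real.exp (-(4 * t) * ‖v‖ ^ 2))),
    ← ofReal_integral_eq_lintegral_ofReal hint
      (Filter.Eventually.of_forall fun v => (Real.exp_pos _).le), hI,
    ← ENNReal.ofReal_mul (by positivity)]
  congr 1
  have h4 : (Real.pi / (4 * t)) ^ (-n / 2) * (Real.pi / (4 * t)) ^ (n / 2) = 1 := by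
    rw [← Real.rpow_add (by positivity)]
    ring_nf
    exact Real.rpow_zero _
  rw [hA]
  linear_combination (t ^ (s / 2 - 1) * Real.exp (-(‖x - y‖ ^ 2 * t))) * h4

lemma measurable_gaussFactor (s : ℝ) :
    Measurable (Function.uncurry fun (x : E) p => ENNReal.ofReal (gaussFactor E s x p)) := by
  unfold gaussFactor Function.uncurry
  fun_prop

/-- The remaining integral over `t` is Euler's integral for `Γ(s / 2)`. -/
lemma lintegral_gaussFactor {s : ℝ} (hs : 0 < s) {x y : E} (hxy : x ≠ y) :
    ∫⁻ p, ENNReal.ofReal (gaussFactor E s x p) * ENNReal.ofReal (gaussFactor E s y p)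
      ∂((volume.restrict (Ioi (0 : ℝ))).prod (volume : Measure E)) =
    ENNReal.ofReal (Real.Gamma (s / 2)) * edist x y ^ (-s) := by
  have hm : ∀ x : E, Measurable fun p => ENNReal.ofReal (gaussFactor E s x p) := fun x =>
    (measurable_gaussFactor s).comp (f := fun p => (x, p)) (by fun_prop)
  have hr : 0 < ‖x - y‖ := norm_pos_iff.2 (sub_ne_zero.2 hxy)
  have hm2 : Measurable fun p => ENNReal.ofReal (gaussFactor E s x p) *
      ENNReal.ofReal (gaussFactor E s y p) := (hm x).mul (hm y)
  rw [lintegral_prod _ hm2.aemeasurable,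
    setLIntegral_congr_fun measurableSet_Ioi
      (fun t ht => lintegral_gaussFactor_mul s x y (mem_Ioi.1 ht))]
  have hI := Real.integral_rpow_mul_exp_neg_mul_Ioi (a := s / 2) (r := ‖x - y‖ ^ 2)
    (by positivity) (by positivity)
  have hG := Real.Gamma_pos_of_pos (s := s / 2) (by positivity)
  rw [← ofReal_integral_eq_lintegral_ofReal, hI, edist_rpow_eq_ofReal hr,
    ← ENNReal.ofReal_mul hG.le]
  · congr 1
    rw [mul_comm, one_div, Real.inv_rpow (by positivity), ← Real.rpow_natCast,
      ← Real.rpow_mul hr.le, ← Real.rpow_neg hr.le]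
    congr 2
    push_cast
    ring
  · refine Integrable.of_integral_ne_zero ?_
    rw [hI]
    positivity
  · filter_upwards [ae_restrict_mem measurableSet_Ioi] with t ht
    have : (0 : ℝ) < t := ht
    positivity

/-- On the diagonal the right side is infinite, so the inequality suffices for the self-energies;
equality is needed only for the mutual energy with `σ`, which has no atoms. -/
lemma lintegral_gaussFactor_le {s : ℝ} (hs : 0 < s) (x y : E) :
    ∫⁻ p, ENNReal.ofReal (gaussFactor E s x p) * ENNReal.ofReal (gaussFactor E s y p)
      ∂((volume.restrict (Ioi (0 : ℝ))).prod (volume : Measure E)) ≤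
    ENNReal.ofReal (Real.Gamma (s / 2)) * edist x y ^ (-s) := by
  rcases eq_or_ne x y with rfl | hxy
  · have hG := Real.Gamma_pos_of_pos (s := s / 2) (by positivity)
    rw [edist_self, ENNReal.zero_rpow_of_neg (by linarith),
      ENNReal.mul_top (ENNReal.ofReal_pos.2 hG).ne']
    exact le_top
  · exact (lintegral_gaussFactor hs hxy).le

end Gaussian

variable {d : ℕ} {s : ℝ}

lemma rieszEnergy_sigma (hs : 0 < s) (hsd : s < (d : ℝ) - 1) :
    rieszEnergy s (sigma d) = ENNReal.ofReal (sigmaPotential d s 1) := by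
  rw [rieszEnergy]
  simp only [rieszPotential_sigma_eq hs hsd (norm_coe_sphere _)]
  simp

/-- The mutual energy of `μ` and `σ` equals the energy of `σ`, because the potential of `σ` is
constant. So `2 I(μ, σ) ≤ I(μ) + I(σ)` reduces to `I(σ) ≤ I(μ)`, after cancelling a finite term. -/
lemma le_rieszEnergy (hs : 0 < s) (hsd : s < (d : ℝ) - 1) (μ : Measure (Sphere d))
    [IsProbabilityMeasure μ] : ENNReal.ofReal (sigmaPotential d s 1) ≤ rieszEnergy s μ := by
  set C := ENNReal.ofReal (Real.Gamma (s / 2)) with hC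
  set W := ENNReal.ofReal (sigmaPotential d s 1) with hW
  have hC0 : C ≠ 0 := (ENNReal.ofReal_pos.2 (Real.Gamma_pos_of_pos (by positivity))).ne'
  set φ : Sphere d → ℝ × EuclideanSpace ℝ (Fin (d + 1)) → ℝ≥0∞ := fun x p =>
    ENNReal.ofReal (gaussFactor (EuclideanSpace ℝ (Fin (d + 1))) s x p) with hφ
  have hφm : Measurable (Function.uncurry φ) :=
    (measurable_gaussFactor s).comp (f := fun q : Sphere d × ℝ × EuclideanSpace ℝ (Fin (d + 1)) =>
      ((q.1 : EuclideanSpace ℝ (Fin (d + 1))), q.2)) (by fun_prop)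
  have key := two_mul_lintegral_factor_le
    (m := (volume.restrict (Ioi (0 : ℝ))).prod
      (volume : Measure (EuclideanSpace ℝ (Fin (d + 1))))) hφm μ (sigma d)
  have hle : ∀ ν : Measure (Sphere d), ∫⁻ x, ∫⁻ y, ∫⁻ ω, φ x ω * φ y ω
      ∂((volume.restrict (Ioi (0 : ℝ))).prod
        (volume : Measure (EuclideanSpace ℝ (Fin (d + 1))))) ∂ν ∂ν ≤ C * rieszEnergy s ν := by
    intro ν
    rw [rieszEnergy, ← lintegral_const_mul' _ _ ENNReal.ofReal_ne_top]
    refine lintegral_mono fun x => ?_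
    rw [rieszPotential, ← lintegral_const_mul' _ _ ENNReal.ofReal_ne_top]
    exact lintegral_mono fun y => lintegral_gaussFactor_le hs _ _
  have heq : ∫⁻ x, ∫⁻ y, ∫⁻ ω, φ x ω * φ y ω
      ∂((volume.restrict (Ioi (0 : ℝ))).prod
        (volume : Measure (EuclideanSpace ℝ (Fin (d + 1))))) ∂sigma d ∂μ = C * W := by
    have h1 : ∀ x : Sphere d, ∫⁻ y, ∫⁻ ω, φ x ω * φ y ω
      ∂((volume.restrict (Ioi (0 : ℝ))).prod
        (volume : Measure (EuclideanSpace ℝ (Fin (d + 1))))) ∂sigma d = C * W := by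
      intro x
      rw [hW, ← rieszPotential_sigma_eq hs hsd (norm_coe_sphere x), rieszPotential,
        ← lintegral_const_mul' _ _ ENNReal.ofReal_ne_top]
      refine lintegral_congr_ae ?_
      have : ∀ᵐ y ∂sigma d, y ≠ x := by
        rw [ae_iff]
        simpa using sigma_singleton hs hsd x
      filter_upwards [this] with y hy
      exact lintegral_gaussFactor hs fun h => hy (Subtype.ext h.symm)
    simp [h1]
  rw [heq] at key
  have h2 := key.trans (add_le_add (hle μ) (hle (sigma d)))
  rw [rieszEnergy_sigma hs hsd, two_mul] at h2
  have hfin : C * W ≠ ∞ := ENNReal.mul_ne_top ENNReal.ofReal_ne_top ENNReal.ofReal_ne_top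
  exact (ENNReal.mul_le_mul_iff_right hC0 ENNReal.ofReal_ne_top).1
    ((ENNReal.add_le_add_iff_right hfin).1 h2)

lemma sphereEnergy_eq (hs : 0 < s) (hsd : s < (d : ℝ) - 1) :
    sphereEnergy d s = sigmaPotential d s 1 := by
  have h : (⨅ μ : ProbabilityMeasure (Sphere d), rieszEnergy s (μ : Measure (Sphere d))) =
      ENNReal.ofReal (sigmaPotential d s 1) := by
    refine le_antisymm ?_ (le_iInf fun μ => le_rieszEnergy hs hsd _)
    rw [← rieszEnergy_sigma hs hsd]
    exact iInf_le (fun μ : ProbabilityMeasure (Sphere d) => rieszEnergy s (μ : Measure (Sphere d)))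
      ⟨sigma d, inferInstance⟩
  rw [sphereEnergy, h, ENNReal.toReal_ofReal (sigmaPotential_one_pos hs hsd).le]

end Gonchar

/-! ### The shape of `charFun`: strict decrease, then strict increase -/

namespace Gonchar

variable {d : ℕ} {s : ℝ}

lemma ne_zero_of_lt_sub_one (hs : 0 < s) (hsd : s < (d : ℝ) - 1) : d ≠ 0 := by
  rintro rfl
  norm_num at hsd
  linarith

/-- The factor of the derivative of `charFun` that carries its sign. -/
noncomputable def signFactor (d : ℕ) (s R : ℝ) : ℝ :=
  s * ((1 + R) ^ ((d : ℝ) - s - 1) * (1 + R) ^ (d + 1) * powSlope d (d - s / 2 - 1) R) -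
    (2 * d - s - s * R)

/-- `powSlope_eq_mobius` moves `U'` from index `s / 2` to `d - s / 2 - 1`. This exposes the factor
`(1 - R) ^ (d - s - 1)`, which the derivative of the first term of `f` has too. -/
lemma hasDerivAt_charFun {R : ℝ} (hR : R ∈ Ioo (0 : ℝ) 1) :
    HasDerivAt (charFun d s)
      ((1 - R) ^ ((d : ℝ) - s - 1) / (1 + R) ^ (d + 1) * signFactor d s R) R := by
  have hR' := abs_lt_one_of_mem_Ioo hR
  have h1 : 0 < 1 - R := by linarith [hR.2]
  have h2 : 0 < 1 + R := by linarith [hR.1]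
  have hf : charFun d s =ᶠ[nhds R]
      fun R => (1 - R) ^ ((d : ℝ) - s) / (1 + R) ^ d - powMean d (s / 2) R := by
    filter_upwards [isOpen_Ioo.mem_nhds hR] with x hx
    rw [charFun, sigmaPotential_eq_powMean (abs_lt_one_of_mem_Ioo hx), abs_sub_comm,
      abs_of_pos (by linarith [hx.2]), add_comm x 1]
  have d1 : HasDerivAt (fun R : ℝ => (1 - R) ^ ((d : ℝ) - s))
      (-(((d : ℝ) - s) * (1 - R) ^ ((d : ℝ) - s - 1))) R := by
    refine (((hasDerivAt_id R).const_sub 1).rpow_const (Or.inl h1.ne')).congr_deriv ?_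
    simp only [id]
    ring
  have d2 : HasDerivAt (fun R : ℝ => (1 + R) ^ d) (d * (1 + R) ^ (d - 1)) R := by
    refine (((hasDerivAt_id R).const_add 1).pow d).congr_deriv ?_
    simp
  have d3 := (d1.div d2 (pow_pos h2 d).ne').sub (hasDerivAt_powMean (d := d) (s / 2) hR')
  refine (d3.congr_of_eventuallyEq hf).congr_deriv ?_
  rw [powSlope_eq_mobius _ hR', signFactor]
  have e1 : (1 - R) ^ ((d : ℝ) - s) = (1 - R) ^ ((d : ℝ) - s - 1) * (1 - R) := by
    rw [Real.rpow_sub_one h1.ne']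
    field_simp
  have e2 : (1 - R ^ 2) ^ ((d : ℝ) - 2 * (s / 2) - 1) =
      (1 - R) ^ ((d : ℝ) - s - 1) * (1 + R) ^ ((d : ℝ) - s - 1) := by
    rw [← Real.mul_rpow h1.le h2.le]
    congr 1 <;> ring
  rw [e1, e2]
  have e3 : (d : ℝ) * (1 + R) ^ (d - 1) * (1 + R) = d * (1 + R) ^ d := by
    rcases Nat.eq_zero_or_pos d with rfl | hd
    · simp
    · rw [mul_assoc, ← pow_succ, Nat.sub_add_cancel hd]
  generalize (1 - R) ^ ((d : ℝ) - s - 1) = A at *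
  generalize (1 + R) ^ ((d : ℝ) - s - 1) = B at *
  have e4 : (d : ℝ) * (1 + R) ^ (d - 1) = d * (1 + R) ^ d / (1 + R) := by
    field_simp
    linarith
  rw [e4]
  generalize powSlope d (d - s / 2 - 1) R = N at *
  field_simp
  ring

/-- For `k = d - s / 2 - 1` the condition `d < 2k + 1` reads `s < d - 1`, so `powSlope` increases
from `0` and each factor grows. -/
lemma strictMonoOn_signFactor (hs : 0 < s) (hsd : s < (d : ℝ) - 1) :
    StrictMonoOn (signFactor d s) (Ico 0 1) := by
  have hd := ne_zero_of_lt_sub_one hs hsd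
  have hk : (d : ℝ) < 2 * (d - s / 2 - 1) + 1 := by linarith
  have hmono := strictMonoOn_powSlope hd hk
  intro x hx y hy hxy
  have hpx : 0 ≤ powSlope d (d - s / 2 - 1) x := by
    rw [← powSlope_zero_right hd (d - s / 2 - 1)]
    exact hmono.monotoneOn (left_mem_Ico.2 one_pos) hx hx.1
  have hpxy := (hmono hx hy hxy).le
  have h1 : (1 + x) ^ ((d : ℝ) - s - 1) ≤ (1 + y) ^ ((d : ℝ) - s - 1) :=
    Real.rpow_le_rpow (by linarith [hx.1]) (by linarith) (by linarith)
  have h2 : (1 + x) ^ (d + 1) ≤ (1 + y) ^ (d + 1) :=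
    pow_le_pow_left₀ (by linarith [hx.1]) (by linarith) _
  have hx0 : 0 < 1 + x := by linarith [hx.1]
  have hy0 : 0 < 1 + y := by linarith
  have h3 : s * ((1 + x) ^ ((d : ℝ) - s - 1) * (1 + x) ^ (d + 1) *
      powSlope d (d - s / 2 - 1) x) ≤ s * ((1 + y) ^ ((d : ℝ) - s - 1) * (1 + y) ^ (d + 1) *
      powSlope d (d - s / 2 - 1) y) := by gcongr
  have h4 : s * x < s * y := mul_lt_mul_of_pos_left hxy hs
  unfold signFactor
  linarith

lemma continuousOn_signFactor (d : ℕ) (s : ℝ) : ContinuousOn (signFactor d s) (Ico 0 1) := by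
  intro R hR
  have h := (hasDerivAt_powSlope (d := d) (d - s / 2 - 1) (abs_lt_one_of_mem_Ico hR)).continuousAt
  have h2 : ContinuousAt (fun R : ℝ => (1 + R) ^ ((d : ℝ) - s - 1)) R :=
    ContinuousAt.rpow_const (by fun_prop) (Or.inl (by linarith [hR.1]))
  have h3 : ContinuousAt (fun R : ℝ => (1 + R) ^ (d + 1)) R := by fun_prop
  have h4 : ContinuousAt (fun R : ℝ => 2 * (d : ℝ) - s - s * R) R := by fun_prop
  exact ((((h2.mul h3).mul h).const_mul s).sub h4).continuousWithinAt

/-- Multiplied by `(1 - R) ^ (d - s - 1)`, the negative terms tend to `0` as `R → 1`. Transformed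
back to index `s / 2`, the slope term is bounded below by `-s R ^ d powSlope(R)`, which increases
and so exceeds its positive value at `1/2`. -/
lemma exists_signFactor_pos (hs : 0 < s) (hsd : s < (d : ℝ) - 1) :
    ∃ R ∈ Ioo (0 : ℝ) 1, 0 < signFactor d s R := by
  have hd := ne_zero_of_lt_sub_one hs hsd
  have hk : 2 * (s / 2) + 1 < (d : ℝ) := by linarith
  have hhalf : (1 / 2 : ℝ) ∈ Ioo (0 : ℝ) 1 := by norm_num
  set c : ℝ := -((1 / 2) ^ d * powSlope d (s / 2) (1 / 2)) with hc
  have hc0 : 0 < c := by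
    have := powSlope_neg hd hk hhalf
    have h2 : (0 : ℝ) < (1 / 2) ^ d := by positivity
    rw [hc, neg_pos]
    exact mul_neg_of_pos_of_neg h2 this
  have hlim : Filter.Tendsto (fun R : ℝ => (1 - R) ^ ((d : ℝ) - s - 1) * (2 * d))
      (nhdsWithin 1 (Iio 1)) (nhds 0) := by
    have h : ContinuousAt (fun R : ℝ => (1 - R) ^ ((d : ℝ) - s - 1) * (2 * d)) 1 :=
      (ContinuousAt.rpow_const (by fun_prop) (Or.inr (by linarith))).mul continuousAt_const
    have h' := h.tendsto.mono_left (nhdsWithin_le_nhds (s := Iio 1))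
    rwa [sub_self, Real.zero_rpow (by linarith), zero_mul] at h'
  obtain ⟨R, hR1, hR2⟩ := ((hlim.eventually_lt_const (mul_pos hs hc0)).and
    (Ioo_mem_nhdsLT (by norm_num : (1 / 2 : ℝ) < 1))).exists
  have hR : R ∈ Ioo (0 : ℝ) 1 := ⟨by linarith [hR2.1], hR2.2⟩
  have hR' := abs_lt_one_of_mem_Ioo hR
  refine ⟨R, hR, ?_⟩
  have h1 : 0 < 1 - R := by linarith [hR.2]
  have h2 : 1 < 1 + R := by linarith [hR.1]
  have h3 : c < -(R ^ d * powSlope d (s / 2) R) := neg_lt_neg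
    (strictAntiOn_pow_mul_powSlope hd hk ⟨hhalf.1.le, hhalf.2⟩ ⟨hR.1.le, hR.2⟩ hR2.1)
  have h4 : c < -powSlope d (s / 2) R := by
    refine h3.trans_le ?_
    have hp := powSlope_neg hd hk hR
    have hq : R ^ d ≤ 1 := pow_le_one₀ hR.1.le hR.2.le
    nlinarith
  have hA : 0 < (1 - R) ^ ((d : ℝ) - s - 1) := by positivity
  rw [powSlope_eq_mobius _ hR', neg_neg] at h4
  have e2 : (1 - R ^ 2) ^ ((d : ℝ) - 2 * (s / 2) - 1) =
      (1 - R) ^ ((d : ℝ) - s - 1) * (1 + R) ^ ((d : ℝ) - s - 1) := by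
    rw [← Real.mul_rpow h1.le (by linarith)]
    congr 1 <;> ring
  rw [e2] at h4
  have h5 : (1 - R) ^ ((d : ℝ) - s - 1) * (2 * d) < (1 - R) ^ ((d : ℝ) - s - 1) *
      (s * ((1 + R) ^ ((d : ℝ) - s - 1) * powSlope d (d - s / 2 - 1) R)) := by
    have := mul_lt_mul_of_pos_left h4 hs
    linarith
  have h6 := lt_of_mul_lt_mul_left h5 hA.le
  have hN := powSlope_pos hd (k := d - s / 2 - 1) (by linarith) hR
  have h7 : s * ((1 + R) ^ ((d : ℝ) - s - 1) * powSlope d (d - s / 2 - 1) R) ≤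
      s * ((1 + R) ^ ((d : ℝ) - s - 1) * (1 + R) ^ (d + 1) * powSlope d (d - s / 2 - 1) R) := by
    have : 1 ≤ (1 + R) ^ (d + 1) := one_le_pow₀ h2.le
    have hB : 0 < (1 + R) ^ ((d : ℝ) - s - 1) := by positivity
    gcongr
    exact le_mul_of_one_le_right hB.le this
  have h8 := mul_pos hs hR.1
  unfold signFactor
  linarith

lemma continuousOn_charFun (hs : 0 < s) (hsd : s < (d : ℝ) - 1) :
    ContinuousOn (charFun d s) (Icc 0 1) := by
  unfold charFun
  refine ContinuousOn.sub (ContinuousOn.div ?_ (by fun_prop) ?_)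
    (continuousOn_sigmaPotential hs hsd)
  · exact (Continuous.rpow_const (by fun_prop) fun _ => Or.inr (by linarith)).continuousOn
  · intro x hx
    have : 0 < x + 1 := by linarith [hx.1]
    positivity

lemma charFun_zero (d : ℕ) (s : ℝ) : charFun d s 0 = 0 := by
  rw [charFun, sigmaPotential_eq_powMean (by simp), powMean_zero_right]
  simp

lemma charFun_one (hs : 0 < s) (hsd : s < (d : ℝ) - 1) :
    charFun d s 1 = -sphereEnergy d s := by
  rw [charFun, sphereEnergy_eq hs hsd, sub_self, abs_zero, Real.zero_rpow (by linarith)]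
  simp

/-- `charFun` decreases to its minimum and then increases. -/
lemma exists_charFun_unimodal (hs : 0 < s) (hsd : s < (d : ℝ) - 1) :
    ∃ Rs ∈ Ioo (0 : ℝ) 1, StrictAntiOn (charFun d s) (Icc 0 Rs) ∧
      StrictMonoOn (charFun d s) (Icc Rs 1) := by
  have hd := ne_zero_of_lt_sub_one hs hsd
  obtain ⟨R1, hR1, hpos⟩ := exists_signFactor_pos hs hsd
  have h0 : signFactor d s 0 < 0 := by
    rw [signFactor, powSlope_zero_right hd]
    have : (1 : ℝ) ≤ d := by exact_mod_cast Nat.one_le_iff_ne_zero.2 hd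
    simp only [mul_zero, zero_sub, sub_zero]
    linarith
  have hcont : ContinuousOn (signFactor d s) (Icc 0 R1) :=
    (continuousOn_signFactor d s).mono fun x hx => ⟨hx.1, hx.2.trans_lt hR1.2⟩
  obtain ⟨Rs, hRs, hz⟩ := intermediate_value_Ioo hR1.1.le hcont ⟨h0, hpos⟩
  have hRs' : Rs ∈ Ioo (0 : ℝ) 1 := ⟨hRs.1, hRs.2.trans hR1.2⟩
  have hmono := strictMonoOn_signFactor hs hsd
  have hfac : ∀ R ∈ Ioo (0 : ℝ) 1, 0 < (1 - R) ^ ((d : ℝ) - s - 1) / (1 + R) ^ (d + 1) := by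
    intro R hR
    have h1 : 0 < 1 - R := by linarith [hR.2]
    have h2 : 0 < 1 + R := by linarith [hR.1]
    positivity
  refine ⟨Rs, hRs', ?_, ?_⟩
  · refine strictAntiOn_of_deriv_neg (convex_Icc _ _) ((continuousOn_charFun hs hsd).mono
      (Icc_subset_Icc_right hRs'.2.le)) ?_
    rw [interior_Icc]
    intro x hx
    have hx' : x ∈ Ioo (0 : ℝ) 1 := ⟨hx.1, hx.2.trans hRs'.2⟩
    rw [(hasDerivAt_charFun hx').deriv]
    refine mul_neg_of_pos_of_neg (hfac x hx') ?_
    rw [← hz]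
    exact hmono ⟨hx'.1.le, hx'.2⟩ ⟨hRs'.1.le, hRs'.2⟩ hx.2
  · refine strictMonoOn_of_deriv_pos (convex_Icc _ _) ((continuousOn_charFun hs hsd).mono
      (Icc_subset_Icc_left hRs'.1.le)) ?_
    rw [interior_Icc]
    intro x hx
    have hx' : x ∈ Ioo (0 : ℝ) 1 := ⟨hRs'.1.trans hx.1, hx.2⟩
    rw [(hasDerivAt_charFun hx').deriv]
    refine mul_pos (hfac x hx') ?_
    rw [← hz]
    exact hmono ⟨hRs'.1.le, hRs'.2⟩ ⟨hx'.1.le, hx'.2⟩ hx.1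

end Gonchar

/-! ### The explicit signed equilibrium -/

namespace Gonchar

variable {d : ℕ} {s : ℝ}

lemma integrable_continuousMap (g : C(Sphere d, ℝ)) : Integrable g (sigma d) :=
  Integrable.of_bound g.continuous.aestronglyMeasurable ‖g‖
    (Filter.Eventually.of_forall g.norm_coe_le_norm)

/-- The positive and negative parts of the density give mutually singular measures, and the Jordan
decomposition is unique. -/
lemma toJordanDecomposition_withDensity (g : C(Sphere d, ℝ)) :
    (SignedMeasure.toJordanDecomposition ((sigma d).withDensityᵥ g)).posPart =
        (sigma d).withDensity (fun y => ENNReal.ofReal (g y)) ∧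
      (SignedMeasure.toJordanDecomposition ((sigma d).withDensityᵥ g)).negPart =
        (sigma d).withDensity (fun y => ENNReal.ofReal (-g y)) := by
  have hg := integrable_continuousMap g
  have := isFiniteMeasure_withDensity_ofReal hg.2
  have := isFiniteMeasure_withDensity_ofReal hg.neg.2
  have h := SignedMeasure.toJordanDecomposition_eq (s := (sigma d).withDensityᵥ g)
    (j := { posPart := (sigma d).withDensity (fun y => ENNReal.ofReal (g y))
            negPart := (sigma d).withDensity (fun y => ENNReal.ofReal (-g y))
            negPart_finite := this
            mutuallySingular := withDensity_ofReal_mutuallySingular g.continuous.measurable })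
    (withDensityᵥ_eq_withDensity_pos_part_sub_withDensity_neg_part hg)
  rw [h]
  exact ⟨rfl, rfl⟩

lemma rieszPotential_withDensity (x : EuclideanSpace ℝ (Fin (d + 1))) {φ : Sphere d → ℝ≥0∞}
    (hφ : Measurable φ) :
    rieszPotential s ((sigma d).withDensity φ) x =
      ∫⁻ y : Sphere d, edist x (y : EuclideanSpace ℝ (Fin (d + 1))) ^ (-s) * φ y ∂sigma d := by
  rw [rieszPotential, lintegral_withDensity_eq_lintegral_mul _ hφ (measurable_edist_rpow_coe _ _)]
  exact lintegral_congr fun y => mul_comm _ _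

lemma rieszPotential_withDensity_ne_top (hs : 0 < s) (hsd : s < (d : ℝ) - 1) (x : Sphere d)
    (g : C(Sphere d, ℝ)) :
    rieszPotential s ((sigma d).withDensity (fun y => ENNReal.ofReal (g y))) x ≠ ∞ := by
  rw [rieszPotential_withDensity _ g.continuous.measurable.ennreal_ofReal]
  have h : ∫⁻ y : Sphere d, edist (x : EuclideanSpace ℝ (Fin (d + 1)))
      (y : EuclideanSpace ℝ (Fin (d + 1))) ^ (-s) * ENNReal.ofReal (g y) ∂sigma d ≤
      rieszPotential s (sigma d) x * ENNReal.ofReal ‖g‖ := by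
    rw [rieszPotential, ← lintegral_mul_const' _ _ ENNReal.ofReal_ne_top]
    gcongr with y
    exact (le_abs_self _).trans (g.norm_coe_le_norm y)
  refine (h.trans_lt (ENNReal.mul_lt_top ?_ ENNReal.ofReal_lt_top)).ne
  rw [rieszPotential_sigma_eq hs hsd (norm_coe_sphere x)]
  exact ENNReal.ofReal_lt_top

/-- The density of the signed equilibrium in the field of a charge `q` at distance `R` from the
centre. -/
noncomputable def eqDensity (d : ℕ) (s q : ℝ) {R : ℝ} (hR : ‖source d R‖ < 1) : C(Sphere d, ℝ) where
  toFun y := 1 + q * sigmaPotential d s R / sphereEnergy d s +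
    -q / sphereEnergy d s * balayageDensity d s (source d R) y
  continuous_toFun := by
    have := continuous_balayageDensity (s := s) hR
    fun_prop

lemma eqDensity_apply (q : ℝ) {R : ℝ} (hR : ‖source d R‖ < 1) (y : Sphere d) :
    eqDensity d s q hR y = 1 + q * sigmaPotential d s R / sphereEnergy d s +
      -q / sphereEnergy d s * balayageDensity d s (source d R) y := rfl

lemma sphereEnergy_pos (hs : 0 < s) (hsd : s < (d : ℝ) - 1) : 0 < sphereEnergy d s := by
  rw [sphereEnergy_eq hs hsd]
  exact sigmaPotential_one_pos hs hsd

/-- The splitting of `α + β` into positive and negative parts, written additively so that it can be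
integrated in `ℝ≥0∞`, where subtraction is truncated. -/
lemma ofReal_add_ofReal_neg (α β : ℝ) (hβ : 0 ≤ β) :
    ENNReal.ofReal (α + β) + ENNReal.ofReal (-α) =
      ENNReal.ofReal (-(α + β)) + (ENNReal.ofReal α + ENNReal.ofReal β) := by
  rcases le_total 0 α with h | h
  · rw [ENNReal.ofReal_of_nonpos (neg_nonpos.2 h), add_zero,
      ENNReal.ofReal_of_nonpos (by linarith : -(α + β) ≤ 0), zero_add, ENNReal.ofReal_add h hβ]
  · rw [ENNReal.ofReal_of_nonpos h, zero_add]
    rcases le_total 0 (α + β) with h2 | h2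
    · rw [ENNReal.ofReal_of_nonpos (by linarith : -(α + β) ≤ 0), zero_add,
        ← ENNReal.ofReal_add h2 (by linarith)]
      congr 1
      ring
    · rw [ENNReal.ofReal_of_nonpos h2, zero_add, ← ENNReal.ofReal_add (by linarith) hβ]
      congr 1
      ring

lemma isEquilibriumDensity_eqDensity (hs : 0 < s) (hsd : s < (d : ℝ) - 1) {q : ℝ} (hq : q < 0)
    {R : ℝ} (hR : ‖source d R‖ < 1) : IsEquilibriumDensity d s q R (eqDensity d s q hR) := by
  have hW := sphereEnergy_pos hs hsd
  have hR' : |R| < 1 := by rwa [norm_source] at hR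
  have hP := (continuous_balayageDensity (s := s) hR)
  have hPint : Integrable (balayageDensity d s (source d R)) (sigma d) :=
    integrable_continuousMap ⟨_, hP⟩
  refine ⟨?_, ?_⟩
  · rw [withDensityᵥ_apply (integrable_continuousMap _) MeasurableSet.univ, setIntegral_univ]
    simp only [eqDensity_apply]
    rw [integral_add (integrable_const _) (hPint.const_mul _), integral_const_mul,
      integral_balayageDensity hR']
    simp
    ring
  -- The balayage part of the density cancels the external field; the constant part `α` has
  -- potential `α W`, which is this number.
  · refine ⟨sphereEnergy d s + q * sigmaPotential d s R, fun x => ?_⟩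
    obtain ⟨h1, h2⟩ := toJordanDecomposition_withDensity (eqDensity d s q hR)
    rw [h1, h2]
    have hf1 := rieszPotential_withDensity_ne_top hs hsd x (eqDensity d s q hR)
    have hf2 := rieszPotential_withDensity_ne_top hs hsd x (-eqDensity d s q hR)
    simp only [ContinuousMap.neg_apply] at hf2
    refine ⟨hf1, hf2, ?_⟩
    set α := 1 + q * sigmaPotential d s R / sphereEnergy d s with hα
    set β := -q / sphereEnergy d s with hβ
    have hβ0 : 0 < β := div_pos (by linarith) hW
    have hx := norm_coe_sub_pos hR x
    have hk := measurable_edist_rpow_coe (x : EuclideanSpace ℝ (Fin (d + 1))) (-s)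
    have hgm := (eqDensity d s q hR).continuous.measurable
    have hgn : Measurable fun y => ENNReal.ofReal (-eqDensity d s q hR y) :=
      hgm.neg.ennreal_ofReal
    have hsum : rieszPotential s ((sigma d).withDensity
        (fun y => ENNReal.ofReal (eqDensity d s q hR y))) x +
          ENNReal.ofReal (-α) * ENNReal.ofReal (sphereEnergy d s) =
        rieszPotential s ((sigma d).withDensity
          (fun y => ENNReal.ofReal (-eqDensity d s q hR y))) x +
          (ENNReal.ofReal α * ENNReal.ofReal (sphereEnergy d s) + ENNReal.ofReal β *
            ENNReal.ofReal (sphereEnergy d s *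
              ‖(x : EuclideanSpace ℝ (Fin (d + 1))) - source d R‖ ^ (-s))) := by
      have hU : ENNReal.ofReal (sphereEnergy d s) = rieszPotential s (sigma d) x := by
        rw [rieszPotential_sigma_eq hs hsd (norm_coe_sphere x), sphereEnergy_eq hs hsd]
      rw [hU, rieszPotential_withDensity _ hgm.ennreal_ofReal,
        rieszPotential_withDensity _ hgn, sphereEnergy_eq hs hsd,
        ← lintegral_edist_mul_balayageDensity hs hsd hR x, rieszPotential,
        ← lintegral_const_mul _ hk, ← lintegral_const_mul _ hk]
      have hm3 : Measurable fun y : Sphere d => edist (x : EuclideanSpace ℝ (Fin (d + 1)))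
          (y : EuclideanSpace ℝ (Fin (d + 1))) ^ (-s) *
            ENNReal.ofReal (balayageDensity d s (source d R) y) :=
        hk.mul hP.measurable.ennreal_ofReal
      have hm1 : Measurable fun y : Sphere d => edist (x : EuclideanSpace ℝ (Fin (d + 1)))
          (y : EuclideanSpace ℝ (Fin (d + 1))) ^ (-s) *
            ENNReal.ofReal (eqDensity d s q hR y) := hk.mul hgm.ennreal_ofReal
      have hm2 : Measurable fun y : Sphere d => edist (x : EuclideanSpace ℝ (Fin (d + 1)))
          (y : EuclideanSpace ℝ (Fin (d + 1))) ^ (-s) *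
            ENNReal.ofReal (-eqDensity d s q hR y) := hk.mul hgn
      rw [← lintegral_const_mul _ hm3, ← lintegral_add_left hm1,
        ← lintegral_add_left (hk.const_mul _), ← lintegral_add_left hm2]
      refine lintegral_congr fun y => ?_
      have hb := (balayageDensity_pos (s := s) hR y).le
      have h := ofReal_add_ofReal_neg α (β * balayageDensity d s (source d R) y)
        (mul_nonneg hβ0.le hb)
      rw [ENNReal.ofReal_mul hβ0.le] at h
      rw [eqDensity_apply, ← hα, ← hβ, mul_comm (ENNReal.ofReal (-α)), ← mul_add, h]
      ring
    have hreal := congrArg ENNReal.toReal hsum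
    have t1 : ENNReal.ofReal (-α) * ENNReal.ofReal (sphereEnergy d s) ≠ ∞ :=
      ENNReal.mul_ne_top ENNReal.ofReal_ne_top ENNReal.ofReal_ne_top
    have t2 : ENNReal.ofReal α * ENNReal.ofReal (sphereEnergy d s) ≠ ∞ :=
      ENNReal.mul_ne_top ENNReal.ofReal_ne_top ENNReal.ofReal_ne_top
    have t3 : ENNReal.ofReal β * ENNReal.ofReal (sphereEnergy d s *
              ‖(x : EuclideanSpace ℝ (Fin (d + 1))) - source d R‖ ^ (-s)) ≠ ∞ :=
      ENNReal.mul_ne_top ENNReal.ofReal_ne_top ENNReal.ofReal_ne_top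
    rw [ENNReal.toReal_add hf1 t1, ENNReal.toReal_add hf2 (ENNReal.add_ne_top.2 ⟨t2, t3⟩),
      ENNReal.toReal_add t2 t3, ENNReal.toReal_mul, ENNReal.toReal_mul, ENNReal.toReal_mul,
      ENNReal.toReal_ofReal hW.le, ENNReal.toReal_ofReal hβ0.le,
      ENNReal.toReal_ofReal (mul_nonneg hW.le (Real.rpow_nonneg hx.le (-s)))] at hreal
    have hαα : (ENNReal.ofReal α).toReal - (ENNReal.ofReal (-α)).toReal = α := by
      rcases le_total 0 α with h | h
      · rw [ENNReal.toReal_ofReal h, ENNReal.ofReal_of_nonpos (by linarith)]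
        simp
      · rw [ENNReal.toReal_ofReal (by linarith : 0 ≤ -α), ENNReal.ofReal_of_nonpos h]
        simp
    have e1 : β * (sphereEnergy d s * ‖(x : EuclideanSpace ℝ (Fin (d + 1))) - source d R‖ ^ (-s)) +
        externalField d s q R x = 0 := by
      rw [externalField, Real.rpow_neg hx.le, hβ]
      field_simp
      ring
    have e2 : α * sphereEnergy d s = sphereEnergy d s + q * sigmaPotential d s R := by
      rw [hα]
      field_simp
    rw [← e2]
    linear_combination hreal + e1 + sphereEnergy d s * hαα

end Gonchar

/-! ### Uniqueness of the signed equilibrium -/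

namespace Gonchar

variable {d : ℕ} {s : ℝ}

/-- By Tonelli and symmetry of the kernel, averaging a boundary potential against the balayage of
`a` gives `W` times the potential at the interior point `a`. -/
lemma lintegral_rieszPotential_mul_balayageDensity (hs : 0 < s) (hsd : s < (d : ℝ) - 1)
    (ν : Measure (Sphere d)) [IsFiniteMeasure ν] {a : EuclideanSpace ℝ (Fin (d + 1))}
    (ha : ‖a‖ < 1) :
    ∫⁻ x : Sphere d, rieszPotential s ν x * ENNReal.ofReal (balayageDensity d s a x) ∂sigma d =
      ∫⁻ y : Sphere d, ENNReal.ofReal (sigmaPotential d s 1 *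
        ‖(y : EuclideanSpace ℝ (Fin (d + 1))) - a‖ ^ (-s)) ∂ν := by
  have hm : Measurable fun p : Sphere d × Sphere d =>
      edist (p.1 : EuclideanSpace ℝ (Fin (d + 1))) (p.2 : EuclideanSpace ℝ (Fin (d + 1))) ^ (-s) *
        ENNReal.ofReal (balayageDensity d s a p.1) := by
    refine Measurable.mul ?_
      ((continuous_balayageDensity ha).measurable.ennreal_ofReal.comp measurable_fst)
    exact Measurable.pow_const (by fun_prop) _
  simp only [rieszPotential]
  simp_rw [← lintegral_mul_const' _ _ ENNReal.ofReal_ne_top]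
  rw [lintegral_lintegral_swap hm.aemeasurable]
  refine lintegral_congr fun y => ?_
  rw [← lintegral_edist_mul_balayageDensity hs hsd ha y]
  simp only [edist_comm]

lemma rpow_norm_sub_integral_eq {ν₁ ν₂ : Measure (Sphere d)} [IsFiniteMeasure ν₁]
    [IsFiniteMeasure ν₂] (hs : 0 < s) (hsd : s < (d : ℝ) - 1) (hmass : ν₁ univ = ν₂ univ)
    {c₁ c₂ : ℝ≥0∞} (hc₂ : c₂ ≠ ∞)
    (h : ∀ x : Sphere d, rieszPotential s ν₁ x + c₁ = rieszPotential s ν₂ x + c₂)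
    {a : EuclideanSpace ℝ (Fin (d + 1))} (ha : ‖a‖ < 1) :
    ∫ y : Sphere d, ‖(y : EuclideanSpace ℝ (Fin (d + 1))) - a‖ ^ (-s) ∂ν₁ =
      ∫ y : Sphere d, ‖(y : EuclideanSpace ℝ (Fin (d + 1))) - a‖ ^ (-s) ∂ν₂ := by
  have hW := sigmaPotential_one_pos hs hsd
  have key : ∀ a : EuclideanSpace ℝ (Fin (d + 1)), ‖a‖ < 1 →
      ∫⁻ y : Sphere d, ENNReal.ofReal (sigmaPotential d s 1 *
        ‖(y : EuclideanSpace ℝ (Fin (d + 1))) - a‖ ^ (-s)) ∂ν₁ +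
          c₁ * ∫⁻ x, ENNReal.ofReal (balayageDensity d s a x) ∂sigma d =
      ∫⁻ y : Sphere d, ENNReal.ofReal (sigmaPotential d s 1 *
        ‖(y : EuclideanSpace ℝ (Fin (d + 1))) - a‖ ^ (-s)) ∂ν₂ +
          c₂ * ∫⁻ x, ENNReal.ofReal (balayageDensity d s a x) ∂sigma d := by
    intro a ha
    have hm := (continuous_balayageDensity (d := d) (s := s) ha).measurable.ennreal_ofReal
    rw [← lintegral_rieszPotential_mul_balayageDensity hs hsd ν₁ ha,
      ← lintegral_rieszPotential_mul_balayageDensity hs hsd ν₂ ha, ← lintegral_const_mul _ hm,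
      ← lintegral_const_mul _ hm, ← lintegral_add_right _ (hm.const_mul _),
      ← lintegral_add_right _ (hm.const_mul _)]
    refine lintegral_congr fun x => ?_
    rw [← add_mul, ← add_mul, h]
  -- At the centre both the kernel and the balayage density are `1` on the sphere, so equal masses
  -- force `c₁ = c₂`.
  have h0 := key 0 (by simp)
  simp only [balayageDensity, sub_zero, norm_zero, norm_coe_sphere, Real.one_rpow, mul_one,
    lintegral_const, hmass, measure_univ, ENNReal.ofReal_one, ne_eq, OfNat.ofNat_ne_zero,
    not_false_eq_true, zero_pow] at h0
  have hc : c₁ = c₂ := (ENNReal.add_right_inj (ENNReal.mul_ne_top ENNReal.ofReal_ne_top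
    (measure_ne_top _ _))).1 h0
  have h1 := key a ha
  rw [hc] at h1
  have hfin : c₂ * ∫⁻ x, ENNReal.ofReal (balayageDensity d s a x) ∂sigma d ≠ ∞ :=
    ENNReal.mul_ne_top hc₂ (integrable_continuousMap
      ⟨_, continuous_balayageDensity (d := d) (s := s) ha⟩).lintegral_lt_top.ne
  rw [ENNReal.add_left_inj hfin] at h1
  have hcont : Continuous fun y : Sphere d => sigmaPotential d s 1 *
      ‖(y : EuclideanSpace ℝ (Fin (d + 1))) - a‖ ^ (-s) :=
    continuous_const.mul (Continuous.rpow_const (by fun_prop)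
      fun y => Or.inl (norm_coe_sub_pos ha y).ne')
  have h2 := congrArg ENNReal.toReal h1
  rw [← integral_eq_lintegral_of_nonneg_ae (Filter.Eventually.of_forall fun y => by positivity)
      hcont.aestronglyMeasurable,
    ← integral_eq_lintegral_of_nonneg_ae (Filter.Eventually.of_forall fun y => by positivity)
      hcont.aestronglyMeasurable, integral_const_mul, integral_const_mul] at h2
  exact mul_left_cancel₀ hW.ne' h2

/-- Up to a constant, the function `(1 - ⟪y, v⟫) ^ (-s / 2)` on the sphere is the kernel of a point
in the unit ball. -/
lemma exists_norm_sub_rpow_eq {v : EuclideanSpace ℝ (Fin (d + 1))} (hv : ‖v‖ < 1) :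
    ∃ a : EuclideanSpace ℝ (Fin (d + 1)), ‖a‖ < 1 ∧ ∃ c : ℝ, 0 < c ∧ ∀ y : Sphere d,
      ‖(y : EuclideanSpace ℝ (Fin (d + 1))) - a‖ ^ (-s) =
        c * (1 - inner ℝ v (y : EuclideanSpace ℝ (Fin (d + 1)))) ^ (-(s / 2)) := by
  set w := Real.sqrt (1 - ‖v‖ ^ 2) with hw
  have h1 : 0 < 1 - ‖v‖ ^ 2 := by nlinarith [norm_nonneg v]
  have hw0 : 0 < w := Real.sqrt_pos.2 h1
  have hw2 : w ^ 2 = 1 - ‖v‖ ^ 2 := Real.sq_sqrt h1.le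
  -- `|y - κ v|²` is a multiple of `1 - ⟪v, y⟫` exactly when `1 + κ² |v|² = 2κ`; this root puts `κ
  -- v` inside the ball.
  set κ := 1 / (1 + w) with hκ
  have hκ0 : 0 < κ := by positivity
  have hnorm : ‖κ • v‖ ^ 2 = 2 * κ - 1 := by
    rw [norm_smul, mul_pow, Real.norm_of_nonneg hκ0.le, hκ]
    field_simp
    linear_combination hw2
  refine ⟨κ • v, ?_, (2 * κ) ^ (-(s / 2)), by positivity, fun y => ?_⟩
  · have : κ < 1 := by
      rw [hκ, div_lt_one (by positivity)]
      linarith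
    rw [norm_smul, Real.norm_of_nonneg hκ0.le]
    nlinarith [norm_nonneg v]
  · have hin : inner ℝ v (y : EuclideanSpace ℝ (Fin (d + 1))) ≤ 1 := by
      have := real_inner_le_norm v (y : EuclideanSpace ℝ (Fin (d + 1)))
      rw [norm_coe_sphere, mul_one] at this
      linarith
    have hsq : ‖(y : EuclideanSpace ℝ (Fin (d + 1))) - κ • v‖ ^ 2 =
        2 * κ * (1 - inner ℝ v (y : EuclideanSpace ℝ (Fin (d + 1)))) := by
      rw [norm_sub_sq_real, hnorm, norm_coe_sphere, inner_smul_right, real_inner_comm]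
      ring
    rw [← Real.mul_rpow (by positivity) (by linarith), ← hsq, ← Real.rpow_natCast,
      ← Real.rpow_mul (norm_nonneg _)]
    congr 1
    push_cast
    ring

lemma inner_mem_Icc (b : EuclideanSpace ℝ (Fin (d + 1))) (y : Sphere d) :
    inner ℝ b (y : EuclideanSpace ℝ (Fin (d + 1))) ∈ Icc (-‖b‖) ‖b‖ := by
  have := abs_real_inner_le_norm b (y : EuclideanSpace ℝ (Fin (d + 1)))
  rw [norm_coe_sphere, mul_one] at this
  exact abs_le.1 this

lemma measurable_inner_coe (b : EuclideanSpace ℝ (Fin (d + 1))) :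
    Measurable fun y : Sphere d => inner ℝ b (y : EuclideanSpace ℝ (Fin (d + 1))) := by
  fun_prop

/-- Finite measures on the sphere with the same integrals of all functions
`(1 - ⟪v, y⟫) ^ (-p)` have the same moments. -/
lemma integral_inner_pow_eq {ν₁ ν₂ : Measure (Sphere d)} [IsFiniteMeasure ν₁]
    [IsFiniteMeasure ν₂] {p : ℝ} (hp : 0 < p)
    (h : ∀ v : EuclideanSpace ℝ (Fin (d + 1)), ‖v‖ < 1 →
      ∫ y : Sphere d, (1 - inner ℝ v (y : EuclideanSpace ℝ (Fin (d + 1)))) ^ (-p) ∂ν₁ =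
        ∫ y : Sphere d, (1 - inner ℝ v (y : EuclideanSpace ℝ (Fin (d + 1)))) ^ (-p) ∂ν₂)
    (b : EuclideanSpace ℝ (Fin (d + 1))) (k : ℕ) :
    ∫ y : Sphere d, inner ℝ b (y : EuclideanSpace ℝ (Fin (d + 1))) ^ k ∂ν₁ =
      ∫ y : Sphere d, inner ℝ b (y : EuclideanSpace ℝ (Fin (d + 1))) ^ k ∂ν₂ := by
  have hpos : ∀ τ : ℝ, |τ| * ‖b‖ < 1 → ∀ u ∈ Icc (-‖b‖) ‖b‖, 0 < 1 - τ * u := by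
    intro τ hτ u hu
    have h1 : |τ * u| ≤ |τ| * ‖b‖ := by
      rw [abs_mul]
      exact mul_le_mul_of_nonneg_left (abs_le.2 hu) (abs_nonneg _)
    linarith [le_abs_self (τ * u)]
  have hder : ∀ (ν : Measure (Sphere d)) [IsFiniteMeasure ν] (k : ℕ) (τ : ℝ), |τ| * ‖b‖ < 1 →
      HasDerivAt (fun τ => ∫ y : Sphere d, inner ℝ b (y : EuclideanSpace ℝ (Fin (d + 1))) ^ k *
        (1 - τ * inner ℝ b (y : EuclideanSpace ℝ (Fin (d + 1)))) ^ (-(p + k)) ∂ν)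
      ((p + k) * ∫ y : Sphere d, inner ℝ b (y : EuclideanSpace ℝ (Fin (d + 1))) ^ (k + 1) *
        (1 - τ * inner ℝ b (y : EuclideanSpace ℝ (Fin (d + 1)))) ^ (-(p + (k + 1 : ℕ))) ∂ν) τ := by
    intro ν _ k τ hτ
    have := hasDerivAt_integral_of_contDiffAt (μ := ν) (measurable_inner_coe b) isCompact_Icc
      (inner_mem_Icc b) (Φ := fun τ u => u ^ k * (1 - τ * u) ^ (-(p + k)))
      (Φ' := fun u => (p + k) * (u ^ (k + 1) * (1 - τ * u) ^ (-(p + (k + 1 : ℕ))))) (r := τ)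
      (fun u hu => ?_) (fun u hu => ?_)
    · rw [integral_const_mul] at this
      exact this
    · have h1 : ContDiffAt ℝ 1 (fun q : ℝ × ℝ => 1 - q.1 * q.2) (τ, u) := by fun_prop
      have h2 : ContDiffAt ℝ 1 (fun q : ℝ × ℝ => q.2 ^ k) (τ, u) := by fun_prop
      exact h2.mul (h1.rpow_const_of_ne (hpos τ hτ u hu).ne')
    · have h1 : HasDerivAt (fun τ : ℝ => 1 - τ * u) (-u) τ := by
        simpa using ((hasDerivAt_id τ).mul_const u).const_sub 1
      have h2 := (h1.rpow_const (p := -(p + k)) (Or.inl (hpos τ hτ u hu).ne')).const_mul (u ^ k)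
      refine h2.congr_deriv ?_
      have e : -(p + k) - 1 = -(p + (k + 1 : ℕ)) := by
        push_cast
        ring
      rw [e]
      ring
  -- Each derivative in `τ` raises the power of `⟪b, y⟫` by one, up to the factor `p + k > 0`; at `τ
  -- = 0` the weight becomes `1` and the moments remain.
  have hall : ∀ k : ℕ, ∀ τ : ℝ, |τ| * ‖b‖ < 1 →
      ∫ y : Sphere d, inner ℝ b (y : EuclideanSpace ℝ (Fin (d + 1))) ^ k *
        (1 - τ * inner ℝ b (y : EuclideanSpace ℝ (Fin (d + 1)))) ^ (-(p + k)) ∂ν₁ =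
      ∫ y : Sphere d, inner ℝ b (y : EuclideanSpace ℝ (Fin (d + 1))) ^ k *
        (1 - τ * inner ℝ b (y : EuclideanSpace ℝ (Fin (d + 1)))) ^ (-(p + k)) ∂ν₂ := by
    intro k
    induction k with
    | zero =>
      intro τ hτ
      have := h (τ • b) (by rwa [norm_smul, Real.norm_eq_abs])
      simpa [inner_smul_left] using this
    | succ k ih =>
      intro τ hτ
      have hev : ∀ᶠ τ' in nhds τ, |τ'| * ‖b‖ < 1 :=
        (by fun_prop : Continuous fun τ : ℝ => |τ| * ‖b‖).continuousAt.eventually_lt_const hτ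
      have h1 := (hder ν₁ k τ hτ).congr_of_eventuallyEq
        (f₁ := fun τ => ∫ y : Sphere d, inner ℝ b (y : EuclideanSpace ℝ (Fin (d + 1))) ^ k *
          (1 - τ * inner ℝ b (y : EuclideanSpace ℝ (Fin (d + 1)))) ^ (-(p + k)) ∂ν₂)
        (hev.mono fun τ' hτ' => (ih τ' hτ').symm)
      exact mul_left_cancel₀ (by positivity) (h1.unique (hder ν₂ k τ hτ))
  have := hall k 0 (by simp)
  simpa using this

/-- A finite measure on the sphere is determined by its moments. -/
lemma measure_eq_of_integral_inner_pow_eq {ν₁ ν₂ : Measure (Sphere d)} [IsFiniteMeasure ν₁]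
    [IsFiniteMeasure ν₂]
    (h : ∀ (b : EuclideanSpace ℝ (Fin (d + 1))) (k : ℕ),
      ∫ y : Sphere d, inner ℝ b (y : EuclideanSpace ℝ (Fin (d + 1))) ^ k ∂ν₁ =
        ∫ y : Sphere d, inner ℝ b (y : EuclideanSpace ℝ (Fin (d + 1))) ^ k ∂ν₂) : ν₁ = ν₂ := by
  have hemb : MeasurableEmbedding ((↑) : Sphere d → EuclideanSpace ℝ (Fin (d + 1))) :=
    MeasurableEmbedding.subtype_coe Metric.isClosed_sphere.measurableSet
  -- The characteristic function is expanded in the exponential series; `|⟪b, y⟫| ≤ ‖b‖` on the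
  -- sphere justifies termwise integration.
  have hsum : ∀ (ν : Measure (Sphere d)) [IsFiniteMeasure ν]
      (b : EuclideanSpace ℝ (Fin (d + 1))),
      HasSum (fun k : ℕ => (Complex.I ^ k / (k.factorial : ℂ)) *
        ((∫ y : Sphere d, inner ℝ b (y : EuclideanSpace ℝ (Fin (d + 1))) ^ k ∂ν : ℝ) : ℂ))
        (MeasureTheory.charFun (ν.map ((↑) : Sphere d → EuclideanSpace ℝ (Fin (d + 1)))) b) := by
    intro ν _ b
    set F : ℕ → Sphere d → ℂ := fun k y => (Complex.I ^ k / (k.factorial : ℂ)) *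
      ((inner ℝ b (y : EuclideanSpace ℝ (Fin (d + 1))) ^ k : ℝ) : ℂ) with hF
    have hFn : ∀ k y, ‖F k y‖ ≤ ‖b‖ ^ k / k.factorial := by
      intro k y
      rw [hF]
      simp only [norm_mul, norm_div, norm_pow, Complex.norm_I, one_pow, Complex.norm_natCast,
        Complex.norm_real, Real.norm_eq_abs]
      rw [div_mul_eq_mul_div, one_mul]
      gcongr
      exact abs_le.2 (inner_mem_Icc b y)
    have hFm : ∀ k, Measurable (F k) := fun k =>
      (Complex.measurable_ofReal.comp ((measurable_inner_coe b).pow_const k)).const_mul _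
    have hFi : ∀ k, Integrable (F k) ν := fun k =>
      Integrable.of_bound (hFm k).aestronglyMeasurable _ (Filter.Eventually.of_forall (hFn k))
    have hs : Summable fun k => ∫ y, ‖F k y‖ ∂ν := by
      refine Summable.of_nonneg_of_le (fun k => integral_nonneg fun y => norm_nonneg _)
        (fun k => ?_) ((Real.summable_pow_div_factorial ‖b‖).mul_right (ν.real univ))
      calc ∫ y, ‖F k y‖ ∂ν ≤ ∫ _, ‖b‖ ^ k / k.factorial ∂ν :=
            integral_mono (hFi k).norm (integrable_const _) (hFn k)
        _ = _ := by rw [integral_const, smul_eq_mul, mul_comm]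
    have key := hasSum_integral_of_summable_integral_norm hFi hs
    have e1 : ∀ k, ∫ y, F k y ∂ν = (Complex.I ^ k / (k.factorial : ℂ)) *
        ((∫ y : Sphere d, inner ℝ b (y : EuclideanSpace ℝ (Fin (d + 1))) ^ k ∂ν : ℝ) : ℂ) := by
      intro k
      rw [hF, integral_const_mul, integral_complex_ofReal]
    have e2 : ∫ y, ∑' k, F k y ∂ν =
        MeasureTheory.charFun (ν.map ((↑) : Sphere d → EuclideanSpace ℝ (Fin (d + 1)))) b := by
      rw [charFun_apply, hemb.integral_map]
      refine integral_congr_ae (Filter.Eventually.of_forall fun y => ?_)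
      simp only
      have h1 := NormedSpace.expSeries_div_hasSum_exp
        (((inner ℝ b (y : EuclideanSpace ℝ (Fin (d + 1))) : ℝ) : ℂ) * Complex.I)
      rw [← Complex.exp_eq_exp_ℂ] at h1
      rw [real_inner_comm, ← h1.tsum_eq]
      refine tsum_congr fun k => ?_
      rw [hF]
      push_cast
      rw [mul_pow]
      ring
    rw [← e2]
    simpa only [e1] using key
  have hmap : ν₁.map ((↑) : Sphere d → EuclideanSpace ℝ (Fin (d + 1))) =
      ν₂.map ((↑) : Sphere d → EuclideanSpace ℝ (Fin (d + 1))) := by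
    refine Measure.ext_of_charFun (funext fun b => ?_)
    have h1 := hsum ν₁ b
    simp only [h] at h1
    exact h1.unique (hsum ν₂ b)
  rw [← hemb.comap_map ν₁, hmap, hemb.comap_map]

/-- Uniqueness of the signed equilibrium. -/
lemma IsSignedEquilibrium.unique (hs : 0 < s) (hsd : s < (d : ℝ) - 1)
    {Q : EuclideanSpace ℝ (Fin (d + 1)) → ℝ} {η η' : SignedMeasure (Sphere d)}
    (h : IsSignedEquilibrium d s Q η) (h' : IsSignedEquilibrium d s Q η') : η = η' := by
  obtain ⟨hm, G, hG⟩ := h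
  obtain ⟨hm', G', hG'⟩ := h'
  have hη := η.toSignedMeasure_toJordanDecomposition
  have hη' := η'.toSignedMeasure_toJordanDecomposition
  rw [JordanDecomposition.toSignedMeasure] at hη hη'
  set P := η.toJordanDecomposition.posPart
  set N := η.toJordanDecomposition.negPart
  set P' := η'.toJordanDecomposition.posPart
  set N' := η'.toJordanDecomposition.negPart
  have hpot : ∀ (μ ν : Measure (Sphere d)) x,
      rieszPotential s (μ + ν) x = rieszPotential s μ x + rieszPotential s ν x :=
    fun μ ν x => lintegral_add_measure _ _ _
  -- The equality `P - N = P' - N'` with all terms on their positive sides, so that only positive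
  -- measures are compared.
  have key : P + N' = N + P' := by
    refine measure_eq_of_integral_inner_pow_eq (integral_inner_pow_eq (p := s / 2) (by positivity)
      fun v hv => ?_)
    obtain ⟨a, ha, c, hc, hac⟩ := exists_norm_sub_rpow_eq (s := s) hv
    have hmass : (P + N') univ = (N + P') univ := by
      rw [← hη, sub_apply, Measure.toSignedMeasure_apply_measurable .univ,
        Measure.toSignedMeasure_apply_measurable .univ] at hm
      rw [← hη', sub_apply, Measure.toSignedMeasure_apply_measurable .univ,
        Measure.toSignedMeasure_apply_measurable .univ] at hm'
      rw [← measureReal_eq_measureReal_iff, measureReal_add_apply, measureReal_add_apply]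
      linarith
    -- The real constant `G' - G` enters through its positive and negative parts, one on each side.
    have := rpow_norm_sub_integral_eq hs hsd hmass (c₁ := ENNReal.ofReal (G' - G))
      (c₂ := ENNReal.ofReal (G - G')) ENNReal.ofReal_ne_top (fun x => ?_) ha
    · simp only [hac, integral_const_mul] at this
      exact mul_left_cancel₀ hc.ne' this
    · obtain ⟨f1, f2, hx⟩ := hG x
      obtain ⟨f1', f2', hx'⟩ := hG' x
      rw [hpot, hpot]
      refine (ENNReal.toReal_eq_toReal_iff' ?_ ?_).1 ?_
      · simp [f1, f2']
      · simp [f2, f1']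
      · rw [ENNReal.toReal_add (by simp [f1, f2']) ENNReal.ofReal_ne_top,
          ENNReal.toReal_add (by simp [f2, f1']) ENNReal.ofReal_ne_top,
          ENNReal.toReal_add f1 f2', ENNReal.toReal_add f2 f1', ENNReal.toReal_ofReal',
          ENNReal.toReal_ofReal']
        rcases le_total G G' with hle | hle
        · rw [max_eq_left (by linarith), max_eq_right (by linarith)]
          linarith
        · rw [max_eq_right (by linarith), max_eq_left (by linarith)]
          linarith
  have hsgn : (P + N').toSignedMeasure = (N + P').toSignedMeasure := by
    simp only [key]
  rw [Measure.toSignedMeasure_add, Measure.toSignedMeasure_add] at hsgn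
  rw [← hη, ← hη', sub_eq_sub_iff_add_eq_add, hsgn]
  exact add_comm _ _

end Gonchar

/-! ### Positivity of the density and its value at the South Pole -/

namespace Gonchar

variable {d : ℕ} {s : ℝ}

lemma norm_source_lt_one {R : ℝ} (hR : R ∈ Ico (0 : ℝ) 1) : ‖source d R‖ < 1 := by
  rw [norm_source]
  exact abs_lt_one_of_mem_Ico hR

lemma balayageDensity_source (R : ℝ) (y : Sphere d) :
    balayageDensity d s (source d R) y =
      (1 - R ^ 2) ^ ((d : ℝ) - s) * distSq R (height y) ^ ((s - 2 * d) / 2) := by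
  rw [balayageDensity, norm_source, sq_abs, norm_sub_source_rpow]

lemma balayageDensity_southPole {R : ℝ} (hR : R ∈ Ico (0 : ℝ) 1) :
    balayageDensity d s (source d R) (southPole d) = charFun d s R + sigmaPotential d s R := by
  have h1 : 0 < 1 - R := by linarith [hR.2]
  have h2 : 0 < 1 + R := by linarith [hR.1]
  have e1 : distSq R (-1) = (1 + R) ^ (2 : ℝ) := by
    rw [Real.rpow_two, distSq]
    ring
  have e2 : 1 - R ^ 2 = (1 - R) * (1 + R) := by ring
  rw [balayageDensity_source, height_southPole, e1, e2, Real.mul_rpow h1.le h2.le,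
    ← Real.rpow_mul h2.le, mul_assoc, ← Real.rpow_add h2, charFun, sub_add_cancel, abs_sub_comm,
    abs_of_pos h1, add_comm R 1]
  have e3 : (d : ℝ) - s + 2 * ((s - 2 * d) / 2) = -d := by ring
  rw [e3, Real.rpow_neg h2.le, Real.rpow_natCast, div_eq_mul_inv]

lemma distSq_le_distSq_neg_one {R u : ℝ} (hR : 0 ≤ R) (hu : -1 ≤ u) :
    distSq R u ≤ distSq R (-1) := by
  unfold distSq
  nlinarith

/-- The South Pole is the farthest point from the source, and the exponent `s - 2d` is negative. -/
lemma balayageDensity_southPole_le (hs : 0 < s) (hsd : s < (d : ℝ) - 1) {R : ℝ}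
    (hR : R ∈ Ico (0 : ℝ) 1) (y : Sphere d) :
    balayageDensity d s (source d R) (southPole d) ≤ balayageDensity d s (source d R) y := by
  have hR' := abs_lt_one_of_mem_Ico hR
  rw [balayageDensity_source, balayageDensity_source, height_southPole]
  refine mul_le_mul_of_nonneg_left ?_ (Real.rpow_nonneg (one_sub_sq_pos hR').le _)
  exact Real.rpow_le_rpow_of_nonpos (distSq_pos hR' (height_mem_Icc y))
    (distSq_le_distSq_neg_one hR.1 (height_mem_Icc y).1) (by linarith)

lemma balayageDensity_southPole_lt (hs : 0 < s) (hsd : s < (d : ℝ) - 1) {R : ℝ}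
    (hR : R ∈ Ioo (0 : ℝ) 1) {y : Sphere d} (hy : y ≠ southPole d) :
    balayageDensity d s (source d R) (southPole d) < balayageDensity d s (source d R) y := by
  have hR' := abs_lt_one_of_mem_Ioo hR
  have hh : -1 < height y :=
    lt_of_le_of_ne (height_mem_Icc y).1 fun h => hy (height_eq_neg_one_iff.1 h.symm)
  rw [balayageDensity_source, balayageDensity_source, height_southPole]
  refine mul_lt_mul_of_pos_left ?_ (Real.rpow_pos_of_pos (one_sub_sq_pos hR') _)
  refine Real.rpow_lt_rpow_of_neg (distSq_pos hR' (height_mem_Icc y)) ?_ (by linarith)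
  unfold distSq
  nlinarith [mul_pos hR.1 (by linarith : 0 < height y + 1)]

section Density

variable {q R : ℝ}

lemma eqDensity_southPole (hs : 0 < s) (hsd : s < (d : ℝ) - 1) (hq : q < 0)
    (hR : R ∈ Ico (0 : ℝ) 1) :
    eqDensity d s q (norm_source_lt_one hR) (southPole d) =
      -q / sphereEnergy d s * (charFun d s R - sphereEnergy d s / q) := by
  have hW := sphereEnergy_pos hs hsd
  have hq' := hq.ne
  rw [eqDensity_apply, balayageDensity_southPole hR]
  field_simp
  ring

lemma eqDensity_southPole_le (hs : 0 < s) (hsd : s < (d : ℝ) - 1) (hq : q < 0)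
    (hR : R ∈ Ico (0 : ℝ) 1) (y : Sphere d) :
    eqDensity d s q (norm_source_lt_one hR) (southPole d) ≤
      eqDensity d s q (norm_source_lt_one hR) y := by
  have hb : 0 ≤ -q / sphereEnergy d s := div_nonneg (by linarith) (sphereEnergy_pos hs hsd).le
  rw [eqDensity_apply, eqDensity_apply]
  gcongr
  exact balayageDensity_southPole_le hs hsd hR y

lemma neg_div_sphereEnergy_pos (hs : 0 < s) (hsd : s < (d : ℝ) - 1) (hq : q < 0) :
    0 < -q / sphereEnergy d s := div_pos (by linarith) (sphereEnergy_pos hs hsd)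

lemma eqDensity_southPole_pos_iff (hs : 0 < s) (hsd : s < (d : ℝ) - 1) (hq : q < 0)
    (hR : R ∈ Ico (0 : ℝ) 1) : 0 < eqDensity d s q (norm_source_lt_one hR) (southPole d) ↔
      sphereEnergy d s / q < charFun d s R := by
  rw [eqDensity_southPole hs hsd hq hR, mul_pos_iff_of_pos_left
    (neg_div_sphereEnergy_pos hs hsd hq), sub_pos]

lemma eqDensity_southPole_nonneg_iff (hs : 0 < s) (hsd : s < (d : ℝ) - 1) (hq : q < 0)
    (hR : R ∈ Ico (0 : ℝ) 1) : 0 ≤ eqDensity d s q (norm_source_lt_one hR) (southPole d) ↔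
      sphereEnergy d s / q ≤ charFun d s R := by
  rw [eqDensity_southPole hs hsd hq hR, mul_nonneg_iff_of_pos_left
    (neg_div_sphereEnergy_pos hs hsd hq), sub_nonneg]

lemma eqDensity_southPole_eq_zero_iff (hs : 0 < s) (hsd : s < (d : ℝ) - 1) (hq : q < 0)
    (hR : R ∈ Ico (0 : ℝ) 1) : eqDensity d s q (norm_source_lt_one hR) (southPole d) = 0 ↔
      sphereEnergy d s / q = charFun d s R := by
  rw [eqDensity_southPole hs hsd hq hR, mul_eq_zero_iff_left
    (neg_div_sphereEnergy_pos hs hsd hq).ne', sub_eq_zero, eq_comm]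

lemma sphereEnergy_div_neg (hs : 0 < s) (hsd : s < (d : ℝ) - 1) (hq : q < 0) :
    sphereEnergy d s / q < 0 := div_neg_of_pos_of_neg (sphereEnergy_pos hs hsd) hq

lemma eqDensity_pos_of_ne_southPole (hs : 0 < s) (hsd : s < (d : ℝ) - 1) (hq : q < 0)
    (hR : R ∈ Ico (0 : ℝ) 1) (h : sphereEnergy d s / q ≤ charFun d s R) {y : Sphere d}
    (hy : y ≠ southPole d) : 0 < eqDensity d s q (norm_source_lt_one hR) y := by
  rcases eq_or_lt_of_le hR.1 with rfl | hR0
  · refine lt_of_lt_of_le ?_ (eqDensity_southPole_le hs hsd hq hR y)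
    rw [eqDensity_southPole_pos_iff hs hsd hq hR, charFun_zero]
    exact sphereEnergy_div_neg hs hsd hq
  · refine lt_of_le_of_lt ((eqDensity_southPole_nonneg_iff hs hsd hq hR).2 h) ?_
    rw [eqDensity_apply, eqDensity_apply]
    have hb := neg_div_sphereEnergy_pos hs hsd hq
    gcongr
    exact balayageDensity_southPole_lt hs hsd ⟨hR0, hR.2⟩ hy

/-- Uniqueness of the measure gives equality almost everywhere; as `σ` charges every nonempty open
set, continuous densities then agree everywhere. -/
lemma IsEquilibriumDensity.eq_eqDensity (hs : 0 < s) (hsd : s < (d : ℝ) - 1) (hq : q < 0)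
    (hR : R ∈ Ico (0 : ℝ) 1) {g : C(Sphere d, ℝ)} (hg : IsEquilibriumDensity d s q R g) :
    g = eqDensity d s q (norm_source_lt_one hR) := by
  have h := IsSignedEquilibrium.unique hs hsd hg
    (isEquilibriumDensity_eqDensity hs hsd hq (norm_source_lt_one hR))
  have h2 := Integrable.ae_eq_of_withDensityᵥ_eq (integrable_continuousMap g)
    (integrable_continuousMap _) h
  exact DFunLike.coe_injective ((g.continuous.ae_eq_iff_eq _ (ContinuousMap.continuous _)).1 h2)

lemma withDensityᵥ_nonneg_iff (g : C(Sphere d, ℝ)) :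
    0 ≤ (sigma d).withDensityᵥ g ↔ ∀ y, 0 ≤ g y := by
  have hg := integrable_continuousMap g
  constructor
  · intro h
    have h1 : 0 ≤ᵐ[sigma d] g := by
      refine ae_nonneg_of_forall_setIntegral_nonneg hg fun t ht _ => ?_
      rw [← withDensityᵥ_apply hg ht]
      exact h t ht
    have h2 : (fun y => max (g y) 0) =ᵐ[sigma d] g := by
      filter_upwards [h1] with y hy
      exact max_eq_left hy
    have h3 := ((by fun_prop : Continuous fun y => max (g y) 0).ae_eq_iff_eq _ g.continuous).1 h2
    intro y
    rw [← congrFun h3 y]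
    exact le_max_right _ _
  · intro h t ht
    rw [withDensityᵥ_apply hg ht]
    simpa using setIntegral_nonneg ht fun y _ => h y

lemma eqDensity_nonneg_iff (hs : 0 < s) (hsd : s < (d : ℝ) - 1) (hq : q < 0)
    (hR : R ∈ Ico (0 : ℝ) 1) :
    0 ≤ (sigma d).withDensityᵥ (eqDensity d s q (norm_source_lt_one hR)) ↔
      sphereEnergy d s / q ≤ charFun d s R := by
  rw [withDensityᵥ_nonneg_iff, ← eqDensity_southPole_nonneg_iff hs hsd hq hR]
  exact ⟨fun h => h _, fun h y => h.trans (eqDensity_southPole_le hs hsd hq hR y)⟩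

lemma eqDensity_pos_iff (hs : 0 < s) (hsd : s < (d : ℝ) - 1) (hq : q < 0)
    (hR : R ∈ Ico (0 : ℝ) 1) :
    (∀ y, 0 < eqDensity d s q (norm_source_lt_one hR) y) ↔
      sphereEnergy d s / q < charFun d s R := by
  rw [← eqDensity_southPole_pos_iff hs hsd hq hR]
  exact ⟨fun h => h _, fun h y => h.trans_le (eqDensity_southPole_le hs hsd hq hR y)⟩

lemma withDensityᵥ_eqDensity_pos_of_isOpen (hs : 0 < s) (hsd : s < (d : ℝ) - 1) (hq : q < 0)
    (hR : R ∈ Ico (0 : ℝ) 1) (h : sphereEnergy d s / q ≤ charFun d s R) {U : Set (Sphere d)}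
    (hU : IsOpen U) (hne : U.Nonempty) :
    0 < (sigma d).withDensityᵥ (eqDensity d s q (norm_source_lt_one hR)) U := by
  have hg := integrable_continuousMap (eqDensity d s q (norm_source_lt_one hR))
  have hnn : ∀ y, 0 ≤ eqDensity d s q (norm_source_lt_one hR) y :=
    (withDensityᵥ_nonneg_iff _).1 ((eqDensity_nonneg_iff hs hsd hq hR).2 h)
  rw [withDensityᵥ_apply hg hU.measurableSet, setIntegral_pos_iff_support_of_nonneg_ae
    (Filter.Eventually.of_forall hnn) hg.integrableOn]
  -- The density can vanish only at the South Pole, which is a null set; so the support is the whole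
  -- sphere even in the borderline case.
  have h1 : U \ {southPole d} ⊆
      Function.support (eqDensity d s q (norm_source_lt_one hR)) ∩ U := fun y hy =>
    ⟨(eqDensity_pos_of_ne_southPole hs hsd hq hR h hy.2).ne', hy.1⟩
  refine lt_of_lt_of_le ?_ (measure_mono h1)
  rw [measure_sdiff_null (sigma_singleton hs hsd _)]
  exact hU.measure_pos _ hne

/-- The centre `R = 0` is allowed in Gonchar's problem but gives nothing, since `f(0) = 0` while `W
/ q < 0`. -/
lemma goncharSolutions_eq (hs : 0 < s) (hsd : s < (d : ℝ) - 1) (hq : q < 0) :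
    goncharSolutions d s q = (fun R => 1 - R) '' criticalDistances d s q := by
  ext δ
  constructor
  · rintro ⟨R, hR, rfl, g, hg, h0⟩
    rw [hg.eq_eqDensity hs hsd hq hR, eqDensity_southPole_eq_zero_iff hs hsd hq hR] at h0
    refine ⟨R, ⟨⟨lt_of_le_of_ne hR.1 ?_, hR.2⟩, h0⟩, rfl⟩
    rintro rfl
    rw [charFun_zero] at h0
    exact (sphereEnergy_div_neg hs hsd hq).ne h0
  · rintro ⟨R, ⟨hR, h0⟩, rfl⟩
    have hR' : R ∈ Ico (0 : ℝ) 1 := ⟨hR.1.le, hR.2⟩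
    exact ⟨R, hR', rfl, _, isEquilibriumDensity_eqDensity hs hsd hq (norm_source_lt_one hR'),
      (eqDensity_southPole_eq_zero_iff hs hsd hq hR').2 h0⟩

lemma goncharDZeros_eq (d : ℕ) (s q : ℝ) : goncharDZeros d s q = criticalDistances d s q := by
  ext R
  refine and_congr_right fun hR => ?_
  have h1 : 0 < 1 - R := by linarith [hR.2]
  have h2 : 0 < (1 + R) ^ d := by
    have := hR.1
    positivity
  have e : goncharD d s q R = (1 + R) ^ d * (sphereEnergy d s / q - charFun d s R) := by
    rw [goncharD, charFun, abs_sub_comm, abs_of_pos h1, add_comm R 1]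
    field_simp
    ring
  rw [e, mul_eq_zero_iff_left h2.ne', sub_eq_zero]

end Density

lemma exists_polynomial_goncharD (hs : 0 < s) (hsd : s < (d : ℝ) - 1) {m : ℕ}
    (hm : s = (d : ℝ) - 1 - 2 * m) (q : ℝ) :
    ∃ P : ℝ[X], ∀ R ∈ Ico (0 : ℝ) 1, goncharD d s q R = P.eval R := by
  obtain ⟨Q, hQ⟩ := exists_polynomial_powMean (ne_zero_of_lt_sub_one hs hsd) m (s / 2)
    (by linarith)
  refine ⟨Polynomial.C (sphereEnergy d s / q) * (1 + Polynomial.X) ^ d -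
    (1 - Polynomial.X) ^ (2 * m + 1) + (1 + Polynomial.X) ^ d * Q, fun R hR => ?_⟩
  have e : (d : ℝ) - s = ((2 * m + 1 : ℕ) : ℝ) := by
    push_cast
    linarith
  rw [goncharD, sigmaPotential_eq_powMean (abs_lt_one_of_mem_Ico hR), hQ R hR, e,
    Real.rpow_natCast]
  simp

section Unimodal

variable {f : ℝ → ℝ} {Rs c : ℝ}

lemma lt_of_unimodal (hRs : Rs ∈ Ioo (0 : ℝ) 1) (ha : StrictAntiOn f (Icc 0 Rs))
    (hm : StrictMonoOn f (Icc Rs 1)) {R : ℝ} (hR : R ∈ Icc (0 : ℝ) 1) (hne : R ≠ Rs) :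
    f Rs < f R := by
  rcases lt_or_gt_of_ne hne with h | h
  · exact ha ⟨hR.1, h.le⟩ ⟨hRs.1.le, le_rfl⟩ h
  · exact hm ⟨le_rfl, hRs.2.le⟩ ⟨h.le, hR.2⟩ h

lemma le_iff_of_unimodal {R₁ R₂ : ℝ} (hR₁ : R₁ ∈ Ioo 0 Rs) (hR₂ : R₂ ∈ Ioo Rs 1)
    (ha : StrictAntiOn f (Icc 0 Rs)) (hm : StrictMonoOn f (Icc Rs 1)) (h₁ : f R₁ = c)
    (h₂ : f R₂ = c) {R : ℝ} (hR : R ∈ Icc (0 : ℝ) 1) :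
    (c ≤ f R ↔ R ≤ R₁ ∨ R₂ ≤ R) ∧ (c < f R ↔ R < R₁ ∨ R₂ < R) := by
  rcases le_total R Rs with h | h
  · have e1 : ¬ R₂ ≤ R := not_le.2 (h.trans_lt hR₂.1)
    have e2 : ¬ R₂ < R := not_lt.2 (h.trans hR₂.1.le)
    simp only [e1, e2, or_false, ← h₁]
    exact ⟨ha.le_iff_ge ⟨hR₁.1.le, hR₁.2.le⟩ ⟨hR.1, h⟩,
      ha.lt_iff_gt ⟨hR₁.1.le, hR₁.2.le⟩ ⟨hR.1, h⟩⟩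
  · have e1 : ¬ R ≤ R₁ := not_le.2 (hR₁.2.trans_le h)
    have e2 : ¬ R < R₁ := not_lt.2 (hR₁.2.le.trans h)
    simp only [e1, e2, false_or, ← h₂]
    exact ⟨hm.le_iff_le ⟨hR₂.1.le, hR₂.2.le⟩ ⟨h, hR.2⟩,
      hm.lt_iff_lt ⟨hR₂.1.le, hR₂.2.le⟩ ⟨h, hR.2⟩⟩

lemma eq_iff_of_unimodal {R₁ R₂ : ℝ} (hR₁ : R₁ ∈ Ioo 0 Rs) (hR₂ : R₂ ∈ Ioo Rs 1)
    (ha : StrictAntiOn f (Icc 0 Rs)) (hm : StrictMonoOn f (Icc Rs 1)) (h₁ : f R₁ = c)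
    (h₂ : f R₂ = c) {R : ℝ} (hR : R ∈ Icc (0 : ℝ) 1) : c = f R ↔ R = R₁ ∨ R = R₂ := by
  refine ⟨fun h => ?_, ?_⟩
  · rcases le_total R Rs with h' | h'
    · exact Or.inl (ha.injOn ⟨hR.1, h'⟩ ⟨hR₁.1.le, hR₁.2.le⟩ (by rw [← h, h₁]))
    · exact Or.inr (hm.injOn ⟨h', hR.2⟩ ⟨hR₂.1.le, hR₂.2.le⟩ (by rw [← h, h₂]))
  · rintro (rfl | rfl)
    · exact h₁.symm
    · exact h₂.symm

/-- When the level is at least `f 1`, the rising branch stays below it, so only the falling branch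
meets it. For `c = f 1` the exclusion of `R = 1` is essential. -/
lemma le_iff_of_unimodal_of_le {R₀ : ℝ} (hR₀ : R₀ ∈ Ioo 0 Rs)
    (hRs : Rs ∈ Ioo (0 : ℝ) 1) (ha : StrictAntiOn f (Icc 0 Rs)) (hm : StrictMonoOn f (Icc Rs 1))
    (h₀ : f R₀ = c) (hc : f 1 ≤ c) {R : ℝ} (hR : R ∈ Ico (0 : ℝ) 1) :
    (c ≤ f R ↔ R ≤ R₀) ∧ (c = f R ↔ R = R₀) := by
  rcases le_total R Rs with h | h
  · rw [← h₀]
    exact ⟨ha.le_iff_ge ⟨hR₀.1.le, hR₀.2.le⟩ ⟨hR.1, h⟩,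
      ha.injOn.eq_iff ⟨hR₀.1.le, hR₀.2.le⟩ ⟨hR.1, h⟩ |>.trans eq_comm⟩
  · have h1 : f R < c := (hm ⟨h, hR.2.le⟩ ⟨hRs.2.le, le_rfl⟩ hR.2).trans_le hc
    have h2 : R₀ < R := hR₀.2.trans_le h
    exact ⟨iff_of_false (not_le.2 h1) (not_le.2 h2), iff_of_false h1.ne' h2.ne'⟩

end Unimodal

end Gonchar

/-! ### Comparison of `charFun` with the level `W / q` -/

theorem mainTheorem6 (d : ℕ) (s : ℝ) (hs : 0 < s) (hsd : s < (d : ℝ) - 1) :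
    -- existence and uniqueness of the signed equilibrium, and its continuous density
    (∀ q < (0 : ℝ), ∀ R ∈ Ico (0 : ℝ) 1,
      ∃ g : C(Gonchar.Sphere d, ℝ), Gonchar.IsEquilibriumDensity d s q R g ∧
        (∀ g', Gonchar.IsEquilibriumDensity d s q R g' → g' = g) ∧
        ∀ η : SignedMeasure (Gonchar.Sphere d),
          Gonchar.IsSignedEquilibrium d s (Gonchar.externalField d s q R) η →
            η = (Gonchar.sigma d).withDensityᵥ g) ∧
    -- the minimum of `f` on `(0, 1)` and the threshold `q*`
    (∃ Rs ∈ Ioo (0 : ℝ) 1,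
      (∀ R ∈ Ioo (0 : ℝ) 1, R ≠ Rs → Gonchar.charFun d s Rs < Gonchar.charFun d s R) ∧
      Gonchar.charFun d s Rs < -Gonchar.sphereEnergy d s ∧
      ∃ qs : ℝ, qs = Gonchar.sphereEnergy d s / Gonchar.charFun d s Rs ∧ -1 < qs ∧ qs < 0 ∧
      ∃ R₁ R₂ R₀ : ℝ → ℝ,
        -- the signed equilibrium is positive iff one of the five conditions holds
        (∀ q < (0 : ℝ), ∀ R ∈ Ico (0 : ℝ) 1, ∀ η : SignedMeasure (Gonchar.Sphere d),
          Gonchar.IsSignedEquilibrium d s (Gonchar.externalField d s q R) η →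
            ((0 ≤ η ↔
              (q ∈ Ioo qs 0 ∧ R ∈ Ioo (0 : ℝ) 1) ∨
              (q = qs ∧ R ∈ Ioo (0 : ℝ) 1) ∨
              (q ∈ Ioo (-1) qs ∧ R ∈ Ioc 0 (R₁ q) ∪ Ico (R₂ q) 1) ∨
              (q ≤ -1 ∧ R ∈ Ioc 0 (R₀ q)) ∨
              R = 0) ∧
            (0 ≤ η → ∀ U : Set (Gonchar.Sphere d), IsOpen U → U.Nonempty → 0 < η U))) ∧
        -- (i)
        (∀ q ∈ Ioo qs 0,
          Gonchar.criticalDistances d s q = ∅ ∧ Gonchar.goncharSolutions d s q = ∅) ∧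
        -- (ii)
        (Gonchar.criticalDistances d s qs = {Rs} ∧
          Gonchar.goncharSolutions d s qs = {1 - Rs} ∧
          ∀ R ∈ Ioo (0 : ℝ) 1, ∀ g : C(Gonchar.Sphere d, ℝ),
            Gonchar.IsEquilibriumDensity d s qs R g →
              (R = Rs → g (Gonchar.southPole d) = 0) ∧
              (R ≠ Rs → 0 < g (Gonchar.southPole d))) ∧
        -- (iii)
        (∀ q ∈ Ioo (-1) qs,
          0 < R₁ q ∧ R₁ q < R₂ q ∧ R₂ q < 1 ∧
          Gonchar.goncharDZeros d s q = {R₁ q, R₂ q} ∧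
          Gonchar.criticalDistances d s q = {R₁ q, R₂ q} ∧
          Gonchar.goncharSolutions d s q = {1 - R₁ q, 1 - R₂ q} ∧
          ∀ R ∈ Ioo (0 : ℝ) 1, ∀ g : C(Gonchar.Sphere d, ℝ),
            Gonchar.IsEquilibriumDensity d s q R g →
              ((∀ x, 0 < g x) ↔ R ∈ Ioo 0 (R₁ q) ∪ Ioo (R₂ q) 1)) ∧
        -- (iv)
        (∀ q ≤ (-1 : ℝ),
          R₀ q ∈ Ioo (0 : ℝ) 1 ∧
          Gonchar.goncharDZeros d s q = {R₀ q} ∧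
          Gonchar.criticalDistances d s q = {R₀ q} ∧
          Gonchar.goncharSolutions d s q = {1 - R₀ q})) ∧
    -- (v)
    (∀ q < (0 : ℝ), ∀ g : C(Gonchar.Sphere d, ℝ),
      Gonchar.IsEquilibriumDensity d s q 0 g → ∀ x, 0 < g x) ∧
    -- the polynomial case
    (∀ m : ℕ, s = (d : ℝ) - 1 - 2 * m → ∀ q < (0 : ℝ),
      ∃ P : ℝ[X], ∀ R ∈ Ico (0 : ℝ) 1, Gonchar.goncharD d s q R = P.eval R) := by
  have hW := Gonchar.sphereEnergy_pos hs hsd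
  set W := Gonchar.sphereEnergy d s with hWdef
  set f := Gonchar.charFun d s with hf
  obtain ⟨Rs, hRs, ha, hm⟩ := Gonchar.exists_charFun_unimodal hs hsd
  have hcont := Gonchar.continuousOn_charFun hs hsd
  have hf0 : f 0 = 0 := Gonchar.charFun_zero d s
  have hf1 : f 1 = -W := Gonchar.charFun_one hs hsd
  have hfs : f Rs < -W := hf1 ▸ hm ⟨le_rfl, hRs.2.le⟩ ⟨hRs.2.le, le_rfl⟩ hRs.2
  have hfs0 : f Rs < 0 := by linarith
  have hmin : ∀ R ∈ Icc (0 : ℝ) 1, R ≠ Rs → f Rs < f R := fun R hR hne =>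
    Gonchar.lt_of_unimodal hRs ha hm hR hne
  have hle : ∀ R ∈ Icc (0 : ℝ) 1, f Rs ≤ f R := fun R hR => by
    rcases eq_or_ne R Rs with rfl | hne
    · exact le_rfl
    · exact (hmin R hR hne).le
  have hneg : ∀ q < (0 : ℝ), W / q < 0 := fun q hq => div_neg_of_pos_of_neg hW hq
  have hqs1 : -1 < W / f Rs := by
    rw [lt_div_iff_of_neg hfs0]
    linarith
  have hqs0 : W / f Rs < 0 := hneg _ hfs0
  -- On `q < 0` the level `W / q` decreases in `q`: it is `f(1) = -W` at `q = -1` and the minimum of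
  -- `f` at `q = W / f Rs`. These two values separate the cases.
  have hq1 : ∀ q ∈ Ioo (W / f Rs) 0, W / q < f Rs := fun q hq => by
    have := (div_lt_iff_of_neg hfs0).1 hq.1
    rw [div_lt_iff_of_neg hq.2]
    linarith
  have hq2 : W / (W / f Rs) = f Rs := by
    field_simp
  have hq3 : ∀ q ∈ Ioo (-1) (W / f Rs), f Rs < W / q ∧ W / q < -W := fun q hq => by
    have hq0 : q < 0 := hq.2.trans hqs0
    have := (lt_div_iff_of_neg hfs0).1 hq.2
    rw [lt_div_iff_of_neg hq0, div_lt_iff_of_neg hq0]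
    refine ⟨by linarith, ?_⟩
    nlinarith [mul_pos hW (by linarith [hq.1] : 0 < q + 1)]
  have hq4 : ∀ q ≤ (-1 : ℝ), -W ≤ W / q := fun q hq => by
    rw [le_div_iff_of_neg (by linarith)]
    nlinarith [mul_nonneg hW.le (by linarith : 0 ≤ -1 - q)]
  have hIcc : ∀ R ∈ Ioo (0 : ℝ) 1, R ∈ Icc (0 : ℝ) 1 := fun R hR => ⟨hR.1.le, hR.2.le⟩
  have hIco : ∀ R ∈ Ioo (0 : ℝ) 1, R ∈ Ico (0 : ℝ) 1 := fun R hR => ⟨hR.1.le, hR.2⟩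
  have hdec : ∀ c, f Rs < c → c < 0 → ∃ R ∈ Ioo 0 Rs, f R = c := fun c h1 h2 =>
    intermediate_value_Ioo' hRs.1.le (hcont.mono (Icc_subset_Icc_right hRs.2.le))
      ⟨h1, by rwa [← hf, hf0]⟩
  have hinc : ∀ c, f Rs < c → c < -W → ∃ R ∈ Ioo Rs 1, f R = c := fun c h1 h2 =>
    intermediate_value_Ioo hRs.2.le (hcont.mono (Icc_subset_Icc_left hRs.1.le))
      ⟨h1, by rwa [← hf, hf1]⟩
  have hex₁ : ∀ q, ∃ R, q ∈ Ioo (-1) (W / f Rs) → R ∈ Ioo 0 Rs ∧ f R = W / q := fun q => by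
    by_cases hq : q ∈ Ioo (-1) (W / f Rs)
    · obtain ⟨R, h1, h2⟩ := hdec _ (hq3 q hq).1 (hneg q (hq.2.trans hqs0))
      exact ⟨R, fun _ => ⟨h1, h2⟩⟩
    · exact ⟨0, fun h => absurd h hq⟩
  have hex₂ : ∀ q, ∃ R, q ∈ Ioo (-1) (W / f Rs) → R ∈ Ioo Rs 1 ∧ f R = W / q := fun q => by
    by_cases hq : q ∈ Ioo (-1) (W / f Rs)
    · obtain ⟨R, h1, h2⟩ := hinc _ (hq3 q hq).1 (hq3 q hq).2
      exact ⟨R, fun _ => ⟨h1, h2⟩⟩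
    · exact ⟨0, fun h => absurd h hq⟩
  have hex₀ : ∀ q, ∃ R, q ≤ -1 → R ∈ Ioo 0 Rs ∧ f R = W / q := fun q => by
    by_cases hq : q ≤ -1
    · obtain ⟨R, h1, h2⟩ := hdec (W / q) (hfs.trans_le (hq4 q hq)) (hneg q (by linarith))
      exact ⟨R, fun _ => ⟨h1, h2⟩⟩
    · exact ⟨0, fun h => absurd h hq⟩
  choose R₁ hR₁ using hex₁
  choose R₂ hR₂ using hex₂
  choose R₀ hR₀ using hex₀
  have hcrit₃ : ∀ q ∈ Ioo (-1) (W / f Rs), Gonchar.criticalDistances d s q = {R₁ q, R₂ q} := by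
    intro q hq
    obtain ⟨h1, h1'⟩ := hR₁ q hq
    obtain ⟨h2, h2'⟩ := hR₂ q hq
    ext R
    refine ⟨fun ⟨hR, h⟩ => (Gonchar.eq_iff_of_unimodal h1 h2 ha hm h1' h2' (hIcc R hR)).1 h, ?_⟩
    rintro (rfl | rfl)
    · exact ⟨⟨h1.1, h1.2.trans hRs.2⟩, h1'.symm⟩
    · exact ⟨⟨hRs.1.trans h2.1, h2.2⟩, h2'.symm⟩
  have hcrit₄ : ∀ q ≤ (-1 : ℝ), Gonchar.criticalDistances d s q = {R₀ q} := by
    intro q hq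
    obtain ⟨h1, h1'⟩ := hR₀ q hq
    ext R
    refine ⟨fun ⟨hR, h⟩ => (Gonchar.le_iff_of_unimodal_of_le h1 hRs ha hm h1'
      (by rw [← hf, hf1]; exact hq4 q hq) (hIco R hR)).2.1 h, ?_⟩
    rintro rfl
    exact ⟨⟨h1.1, h1.2.trans hRs.2⟩, h1'.symm⟩
  have hcrit₂ : Gonchar.criticalDistances d s (W / f Rs) = {Rs} := by
    ext R
    refine ⟨fun ⟨hR, h⟩ => ?_, ?_⟩
    · by_contra hne
      exact (hmin R (hIcc R hR) hne).ne (hq2 ▸ h)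
    · rintro rfl
      exact ⟨hRs, hq2⟩
  have hcrit₁ : ∀ q ∈ Ioo (W / f Rs) 0, Gonchar.criticalDistances d s q = ∅ := by
    intro q hq
    refine eq_empty_of_forall_notMem fun R hR => ?_
    exact ((hq1 q hq).trans_le (hle R (hIcc R hR.1))).ne hR.2
  refine ⟨fun q hq R hR => ?_, ⟨Rs, hRs, fun R hR => hmin R (hIcc R hR), hfs, W / f Rs, rfl, hqs1,
    hqs0, R₁, R₂, R₀, fun q hq R hR η hη => ?_, fun q hq => ⟨hcrit₁ q hq, ?_⟩,
    ⟨hcrit₂, ?_, fun R hR g hg => ?_⟩, fun q hq => ?_, fun q hq => ?_⟩, fun q hq g hg => ?_,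
    fun m hm q _ => Gonchar.exists_polynomial_goncharD hs hsd hm q⟩
  · have h := Gonchar.isEquilibriumDensity_eqDensity hs hsd hq (Gonchar.norm_source_lt_one hR)
    exact ⟨_, h, fun g' hg' => hg'.eq_eqDensity hs hsd hq hR, fun η hη => hη.unique hs hsd h⟩
  · obtain rfl := hη.unique hs hsd
      (Gonchar.isEquilibriumDensity_eqDensity hs hsd hq (Gonchar.norm_source_lt_one hR))
    rw [Gonchar.eqDensity_nonneg_iff hs hsd hq hR]
    refine ⟨?_, fun h U hU hne =>
      Gonchar.withDensityᵥ_eqDensity_pos_of_isOpen hs hsd hq hR h hU hne⟩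
    rcases eq_or_lt_of_le hR.1 with rfl | hR0
    · refine iff_of_true ?_ (by simp)
      rw [← hf, hf0]
      exact (hneg q hq).le
    have hR' : R ∈ Ioo (0 : ℝ) 1 := ⟨hR0, hR.2⟩
    rcases lt_trichotomy q (W / f Rs) with h | h | h
    · have n1 : q ∉ Ioo (W / f Rs) 0 := fun h' => h.not_gt h'.1
      rcases le_or_gt q (-1) with h' | h'
      · obtain ⟨h1, h1'⟩ := hR₀ q h'
        have n3 : q ∉ Ioo (-1) (W / f Rs) := fun h'' => h'.not_gt h''.1
        rw [(Gonchar.le_iff_of_unimodal_of_le h1 hRs ha hm h1'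
          (by rw [← hf, hf1]; exact hq4 q h') hR).1]
        simp [n1, n3, h.ne, h', hR0, hR0.ne']
      · have h3 : q ∈ Ioo (-1) (W / f Rs) := ⟨h', h⟩
        obtain ⟨h1, h1'⟩ := hR₁ q h3
        obtain ⟨h2, h2'⟩ := hR₂ q h3
        rw [(Gonchar.le_iff_of_unimodal h1 h2 ha hm h1' h2' (hIcc R hR')).1]
        simp [n1, h3, h.ne, h', hR0, hR0.ne', hR.2]
    · refine iff_of_true ?_ (Or.inr (Or.inl ⟨h, hR'⟩))
      rw [h, hq2]
      exact hle R (hIcc R hR')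
    · exact iff_of_true ((hq1 q ⟨h, hq⟩).le.trans (hle R (hIcc R hR'))) (Or.inl ⟨⟨h, hq⟩, hR'⟩)
  · rw [Gonchar.goncharSolutions_eq hs hsd hq.2, hcrit₁ q hq, image_empty]
  · rw [Gonchar.goncharSolutions_eq hs hsd hqs0, hcrit₂, image_singleton]
  · rw [hg.eq_eqDensity hs hsd hqs0 (hIco R hR)]
    refine ⟨fun h => ?_, fun h => ?_⟩
    · rw [Gonchar.eqDensity_southPole_eq_zero_iff hs hsd hqs0 (hIco R hR), ← hWdef, hq2, h]
    · rw [Gonchar.eqDensity_southPole_pos_iff hs hsd hqs0 (hIco R hR), ← hWdef, hq2]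
      exact hmin R (hIcc R hR) h
  · have hq0 : q < 0 := hq.2.trans hqs0
    obtain ⟨h1, h1'⟩ := hR₁ q hq
    obtain ⟨h2, h2'⟩ := hR₂ q hq
    refine ⟨h1.1, h1.2.trans h2.1, h2.2, (Gonchar.goncharDZeros_eq d s q).trans (hcrit₃ q hq),
      hcrit₃ q hq, ?_, fun R hR g hg => ?_⟩
    · rw [Gonchar.goncharSolutions_eq hs hsd hq0, hcrit₃ q hq, image_pair]
    · rw [hg.eq_eqDensity hs hsd hq0 (hIco R hR), Gonchar.eqDensity_pos_iff hs hsd hq0 (hIco R hR),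
        (Gonchar.le_iff_of_unimodal h1 h2 ha hm h1' h2' (hIcc R hR)).2]
      simp [hR.1, hR.2]
  · obtain ⟨h1, h1'⟩ := hR₀ q hq
    refine ⟨⟨h1.1, h1.2.trans hRs.2⟩, (Gonchar.goncharDZeros_eq d s q).trans (hcrit₄ q hq),
      hcrit₄ q hq, ?_⟩
    rw [Gonchar.goncharSolutions_eq hs hsd (by linarith), hcrit₄ q hq, image_singleton]
  · have h0 : (0 : ℝ) ∈ Ico (0 : ℝ) 1 := left_mem_Ico.2 one_pos
    rw [hg.eq_eqDensity hs hsd hq h0, Gonchar.eqDensity_pos_iff hs hsd hq h0, ← hf, hf0]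
    exact hneg q hq
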